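/- \textbf{Setting.} Let $n\ge 2$, let $G$ be a simple undirected graph on $n$ vertices with adjacency matrix $\mathbf A$, and let $\mathbf B=\mathbf A-\rho\,\mathbf 1\mathbf 1^\top$ with $\rho=\mathbf 1^\top\mathbf A\mathbf 1/n^2$. The \emph{noisy power iteration} with $N\ge 1$ iterations and noise multiplier $\sigma$ draws $\mathbf y_0$ uniformly from the unit sphere of $\mathbb R^n$ and, for $t=1,\dots,N$, computes \[ \mathbf x_t=\mathbf B\mathbf y_{t-1}+\mathbf z_t,\qquad \mathbf z_t\sim\mathcal N\bigl(0,(\|\mathbf y_{t-1}\|_\infty+\tfrac1n)^2\sigma^2 \mathbf I_n\bigr)\ \text{given the past},\qquad \mathbf y_t=\mathbf x_t/\|\mathbf x_t\|_2 ; \] its output is the entrywise sign vector $\hat{\boldsymbol\sigma}=\mathbf y_N/|\mathbf y_N|$. A randomized function $M$ of a graph is $(\varepsilon,\delta)$-edge DP if $\Pr(M(G)\in S)\le e^{\varepsilon}\Pr(M(G')\in S)+\delta$ for all graphs $G,G'$ on the same vertices that differ in exactly one edge and all measurable $S$. Throughout, $\sigma=\varepsilon^{-1}\sqrt{4N\log(1/\delta)}$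 with $0<\varepsilon\le 1$ and $0<\delta\le 4/5$. \textbf{Lemma.} (a) (Privacy.) For all $n\ge2$, $N\ge1$, the noisy power iteration with $N$ iterations is $(\varepsilon,\delta)$-edge DP; this holds for the whole sequence $(\mathbf x_1,\dots,\mathbf x_N)$ and for the output $\hat{\boldsymbol\sigma}$. (b) (Utility.) For all $\eta,\theta\in(0,1)$ there is a constant $C=C(\eta,\theta)>0$ such that the following holds for every $n\ge 2$, every graph $G$ on $n$ vertices, and all such $\varepsilon,\delta$. Order the eigenvalues of $\mathbf B$ by absolute value, let $\lambda_1\ge\lambda_2\ge 0$ be the two largest absolute values of eigenvalues (with multiplicity), that is, the two largest singular values of $\mathbf B$, suppose $\lambda_1>\lambda_2$, and let $\mathbf u_2$ be a unit eigenvector of $\mathbf B$ for the eigenvalue of absolute value $\lambda_1$. If the number of iterations satisfies $N\ge C\,\frac{\lambda_1}{\lambda_1-\lambda_2}\log n$, then with probability at least $1-\eta$: either $R>\theta$ or \[ \bigl\|(\mathbf I-\mathbf u_2\mathbf u_2^\top)\mathbf y_N\bigr\|_2\le R,\qquad R=\frac{\sigma\,\bigl(\max_{1\le t\le N}\|\mathbf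 y_t\|_\infty+\tfrac1n\bigr)\bigl(\sqrt n+\sqrt{2\log(2N/\eta)}\bigr)}{\lambda_1-\lambda_2}. \] (The left-hand side never exceeds $1$, so the bound is trivial when $R\ge 1$.) -/

import Mathlib

open MeasureTheory ProbabilityTheory

namespace NoisyPower

/-- Vectors of `ℝⁿ` with the Euclidean norm. -/
abbrev Vec (n : ℕ) := EuclideanSpace ℝ (Fin n)

/-- The sup norm `‖y‖_∞ = max_i |y i|` of a vector. -/
noncomputable def supNorm {n : ℕ} (y : Vec n) : ℝ := ‖(WithLp.ofLp y : Fin n → ℝ)‖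

open Classical in
/-- The adjacency matrix of the graph `G` on `n` vertices. -/
noncomputable def adj {n : ℕ} (G : SimpleGraph (Fin n)) : Matrix (Fin n) (Fin n) ℝ :=
  G.adjMatrix ℝ

/-- The edge density `ρ = 1ᵀ A 1 / n²`. -/
noncomputable def density {n : ℕ} (G : SimpleGraph (Fin n)) : ℝ :=
  (∑ i, ∑ j, adj G i j) / (n : ℝ) ^ 2

/-- The centered adjacency matrix `B = A - ρ 1 1ᵀ`. -/
noncomputable def centered {n : ℕ} (G : SimpleGraph (Fin n)) : Matrix (Fin n) (Fin n) ℝ :=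
  adj G - density G • Matrix.of (fun _ _ => (1 : ℝ))

/-- The product `B y`. -/
noncomputable def applyB {n : ℕ} (G : SimpleGraph (Fin n)) (y : Vec n) : Vec n :=
  Matrix.toEuclideanLin (centered G) y

/-- The uniform probability measure on the unit sphere of `ℝⁿ`: normalized surface measure. -/
noncomputable def uniformSphere (n : ℕ) : Measure (Metric.sphere (0 : Vec n) 1) :=
  ((volume : Measure (Vec n)).toSphere Set.univ)⁻¹ • (volume : Measure (Vec n)).toSphere

/-- The random seed of `N` iterations: the starting vector and `N` standard Gaussian vectors. -/
abbrev Seed (n N : ℕ) := Metric.sphere (0 : Vec n) 1 × (Fin N → Vec n)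

/-- The starting vector is uniform on the sphere, the Gaussian vectors are standard, and
all of them are independent. -/
noncomputable def seedLaw (n N : ℕ) : Measure (Seed n N) :=
  (uniformSphere n).prod (Measure.pi fun _ => stdGaussian (Vec n))

/-- One unnormalized step `x = B y + z` with `z = (‖y‖_∞ + 1/n) σ g`; for a standard Gaussian
vector `g` that is independent of `y`, the noise `z` has, given `y`, the law
`𝒩(0, (‖y‖_∞ + 1/n)² σ² I)`. -/
noncomputable def step {n : ℕ} (G : SimpleGraph (Fin n)) (σ : ℝ) (y g : Vec n) : Vec n :=
  applyB G y + ((supNorm y + 1 / (n : ℝ)) * σ) • g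

/-- The iterates `y_0, y_1, …, y_N`, where `y_t = x_t / ‖x_t‖₂`. -/
noncomputable def iterate {n N : ℕ} (G : SimpleGraph (Fin n)) (σ : ℝ) (ω : Seed n N) :
    Fin (N + 1) → Vec n :=
  Fin.induction (ω.1 : Vec n)
    (fun t y => ‖step G σ y (ω.2 t)‖⁻¹ • step G σ y (ω.2 t))

/-- The unnormalized vectors `x_1, …, x_N` (the entry with index `t : Fin N` is `x_{t+1}`). -/
noncomputable def transcript {n N : ℕ} (G : SimpleGraph (Fin n)) (σ : ℝ) (ω : Seed n N) :
    Fin N → Vec n :=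
  fun t => step G σ (iterate G σ ω t.castSucc) (ω.2 t)

/-- The last iterate `y_N`. -/
noncomputable def lastIterate {n N : ℕ} (G : SimpleGraph (Fin n)) (σ : ℝ) (ω : Seed n N) :
    Vec n :=
  iterate G σ ω (Fin.last N)

/-- The labelling vector `y_N / |y_N|` (entrywise), the output of the algorithm. -/
noncomputable def labels {n N : ℕ} (G : SimpleGraph (Fin n)) (σ : ℝ) (ω : Seed n N) :
    Fin n → ℝ :=
  fun i => lastIterate G σ ω i / |lastIterate G σ ω i|

/-- `max_{1 ≤ t ≤ N} ‖y_t‖_∞`. -/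
noncomputable def maxSup {n N : ℕ} (G : SimpleGraph (Fin n)) (σ : ℝ) (ω : Seed n N) : ℝ :=
  ⨆ t : Fin N, supNorm (iterate G σ ω t.succ)

/-- The noise multiplier `σ = ε⁻¹ √(4 N log (1/δ))`. -/
noncomputable def noiseLevel (N : ℕ) (ε δ : ℝ) : ℝ :=
  ε⁻¹ * Real.sqrt (4 * N * Real.log (1 / δ))

/-- Two graphs on the same vertices differ in exactly one edge. -/
def Neighbors {n : ℕ} (G G' : SimpleGraph (Fin n)) : Prop :=
  ∃ e : Sym2 (Fin n), symmDiff G.edgeSet G'.edgeSet = {e}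

/-- `(ε, δ)`-edge differential privacy of a randomized function `M` of a graph, whose
randomness is a seed with law `P`. -/
def EdgeDP {n : ℕ} {Ω α : Type*} [MeasurableSpace Ω] [MeasurableSpace α]
    (P : Measure Ω) (M : SimpleGraph (Fin n) → Ω → α) (ε δ : ℝ) : Prop :=
  ∀ G G' : SimpleGraph (Fin n), Neighbors G G' → ∀ S : Set α, MeasurableSet S →
    P {ω | M G ω ∈ S} ≤
      ENNReal.ofReal (Real.exp ε) * P {ω | M G' ω ∈ S} + ENNReal.ofReal δ

/-- `v_0, v_1, …` is an orthonormal basis of eigenvectors of `B` with eigenvalues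
`lam 0, lam 1, …` ordered such that `|lam 0| ≥ |lam 1| ≥ …`. -/
def IsSpectralDecomposition {n : ℕ} (G : SimpleGraph (Fin n)) (lam : Fin n → ℝ)
    (v : OrthonormalBasis (Fin n) ℝ (Vec n)) : Prop :=
  (∀ i, applyB G (v i) = lam i • v i) ∧ Antitone fun i => |lam i|

/-- The error `‖(I - u uᵀ) y‖₂`. -/
noncomputable def projError {n : ℕ} (u y : Vec n) : ℝ :=
  ‖y - (inner ℝ u y : ℝ) • u‖

/-- The error bound
`σ (max_t ‖y_t‖_∞ + 1/n) (√n + √(2 log (2N/η))) / gap`. -/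
noncomputable def errorBound {n N : ℕ} (G : SimpleGraph (Fin n)) (σ η gap : ℝ)
    (ω : Seed n N) : ℝ :=
  σ * (maxSup G σ ω + 1 / (n : ℝ)) *
    (Real.sqrt n + Real.sqrt (2 * Real.log (2 * N / η))) / gap

end NoisyPower

/-! Privacy. For a fixed unit vector y, changing one edge moves B y by at most √2 (‖y‖_∞ + 1/n)
(`norm_sq_applyB_sub_le`), so in one step it shifts a standard Gaussian by a vector of squared norm
at most 2/σ². Cameron–Martin and Hölder give E f(x + h) ≤ exp(s‖h‖²/2) (E f^((1+s)/s))^(s/(1+s)),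
the dual form of a Rényi bound. This form composes over adaptive steps without loss, so P(S) ≤ exp(N
s/σ²) P'(S)^(s/(1+s)) for the whole transcript. With s = 2 log(1/δ)/ε the factor is e^(ε/2), and
weighted AM-GM turns the right side into e^ε P'(S) + δ (`gaussian_tradeoff`). The labels are a
function of the transcript.

Utility. Divide B by its leading signed eigenvalue: the operator S fixes u and contracts its
orthogonal complement by 1 - p, where p = (λ₁ - λ₂)/λ₁, and the noise multiplier becomes τ = σ/λ₁.
The uniform start is the direction of a Gaussian vector. The noise scale is homogeneous of degree
one, so y_t is the direction of an unnormalized process w_t. When R ≤ θ, the noise scale from time 1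
on is at most k‖w_t‖ with k = θp/√n, hence capping it there changes nothing. The capped process has
closed second-moment recursions.

If τ² log n > 64, then y_1 is so close to a Gaussian direction, with entries so large, that R > θ
with high probability. Otherwise the aligned part ⟨u, w_s⟩ is bounded away from 0 at a constant time
s: moving the start along u moves it by almost the same amount, so it inherits the
anti-concentration of a scalar Gaussian (`measure_abs_inner_le`). From s to a time L of order log n
/ p the aligned part hardly moves in mean square, while the orthogonal part decays to constant size.
So the ratio of orthogonal to aligned part is at most a constant K at time L
(`eventually_measure_ratio_le`).

After L the argument is pathwise (`norm_perp_le_of_path`). The ratio stays below K, and its excess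
over the tangent T of the angle with sine R obeys a contracting recursion driven by ‖z_t‖ - √n +
O(|⟨u, z_t⟩|) - √(2 log(2N/η)). This is dominated by a decaying term plus a Lindley workload with
uniformly bounded exponential moments. Only the last step needs a tail bound at the sharp scale, so
no union bound over N steps enters the constant of R.

Finally R ≤ 1 forces N ≤ 2n³, which makes the crude union bounds affordable and disposes of small n
through the choice of C. -/

namespace NoisyPower

/-! ### Gaussian densities, the Cameron–Martin shift and exponential moments. -/

section GaussianDensity

/-- The density of the standard Gaussian measure of a Euclidean space. -/
noncomputable def stdGaussianDensity (E : Type*) [NormedAddCommGroup E] [InnerProductSpace ℝ E]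
    (x : E) : ℝ :=
  ((Real.pi / (1 / 2)) ^ (Module.finrank ℝ E / 2 : ℝ))⁻¹ * Real.exp (-(1 / 2) * ‖x‖ ^ 2)

lemma stdGaussianDensity_nonneg {E : Type*} [NormedAddCommGroup E] [InnerProductSpace ℝ E] (x : E) :
    0 ≤ stdGaussianDensity E x := by
  unfold stdGaussianDensity; positivity

lemma continuous_stdGaussianDensity {E : Type*} [NormedAddCommGroup E] [InnerProductSpace ℝ E] :
    Continuous (stdGaussianDensity E) := by
  unfold stdGaussianDensity; fun_prop

variable {E : Type*} [NormedAddCommGroup E] [InnerProductSpace ℝ E] [FiniteDimensional ℝ E]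
  [MeasurableSpace E] [BorelSpace E]

lemma integrable_exp_neg_mul_sq_norm {b : ℝ} (hb : 0 < b) :
    Integrable (fun x : E => Real.exp (-b * ‖x‖ ^ 2)) := by
  have h := (GaussianFourier.integrable_cexp_neg_mul_sq_norm_add (V := E) (b := (b : ℂ))
    (by simpa using hb) 0 0).re
  refine h.congr (Filter.Eventually.of_forall fun x => ?_)
  simp only [zero_mul, add_zero]
  rw [← Complex.ofReal_pow, ← Complex.ofReal_neg, ← Complex.ofReal_mul]
  exact Complex.exp_ofReal_re _

theorem stdGaussian_eq_withDensity :
    stdGaussian E =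
      (volume : Measure E).withDensity (fun x => ENNReal.ofReal (stdGaussianDensity E x)) := by
  have hint : Integrable (fun x : E => stdGaussianDensity E x) :=
    (integrable_exp_neg_mul_sq_norm (by norm_num)).const_mul _
  have : IsFiniteMeasure ((volume : Measure E).withDensity
      (fun x => ENNReal.ofReal (stdGaussianDensity E x))) :=
    isFiniteMeasure_withDensity_ofReal hint.2
  refine Measure.ext_of_charFun (funext fun t => ?_)
  rw [charFun_stdGaussian, charFun_apply, integral_withDensity_eq_integral_toReal_smul
    (by exact (continuous_stdGaussianDensity.measurable).ennreal_ofReal) (by simp)]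
  simp_rw [ENNReal.toReal_ofReal (stdGaussianDensity_nonneg _)]
  have h := GaussianFourier.integral_cexp_neg_mul_sq_norm_add (V := E) (b := (1 / 2 : ℂ))
    (by norm_num) Complex.I t
  have hc : ∀ x : E, stdGaussianDensity E x • Complex.exp ((inner ℝ x t : ℝ) * Complex.I) =
      (((Real.pi / (1 / 2)) ^ (Module.finrank ℝ E / 2 : ℝ) : ℝ) : ℂ)⁻¹ *
        Complex.exp (-(1 / 2) * ‖x‖ ^ 2 + Complex.I * (inner ℝ t x : ℝ)) := by
    intro x
    rw [Complex.exp_add, stdGaussianDensity, real_inner_comm x t, Complex.real_smul]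
    push_cast
    ring_nf
  simp_rw [hc]
  rw [integral_const_mul, h, ← mul_assoc]
  have hne : (((Real.pi / (1 / 2)) ^ (Module.finrank ℝ E / 2 : ℝ) : ℝ) : ℂ) ≠ 0 := by
    exact_mod_cast (Real.rpow_pos_of_pos (by positivity) _).ne'
  have : ((Real.pi : ℂ) / (1 / 2)) ^ (Module.finrank ℝ E / 2 : ℂ) =
      (((Real.pi / (1 / 2)) ^ (Module.finrank ℝ E / 2 : ℝ) : ℝ) : ℂ) := by
    rw [Complex.ofReal_cpow (by positivity)]; push_cast; rfl
  rw [this, inv_mul_cancel₀ hne, one_mul]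
  congr 1
  rw [Complex.I_sq]; ring

theorem lintegral_stdGaussian (f : E → ENNReal) (hf : Measurable f) :
    ∫⁻ x, f x ∂(stdGaussian E) =
      ∫⁻ x, ENNReal.ofReal (stdGaussianDensity E x) * f x := by
  rw [stdGaussian_eq_withDensity, lintegral_withDensity_eq_lintegral_mul _
    (continuous_stdGaussianDensity.measurable).ennreal_ofReal hf]
  rfl

/-- The Cameron–Martin formula for the standard Gaussian measure. -/
theorem lintegral_stdGaussian_add (f : E → ENNReal) (hf : Measurable f) (h : E) :
    ∫⁻ x, f (x + h) ∂(stdGaussian E) =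
      ∫⁻ x, ENNReal.ofReal (Real.exp (inner ℝ h x - ‖h‖ ^ 2 / 2)) * f x ∂(stdGaussian E) := by
  rw [lintegral_stdGaussian _ (by fun_prop), lintegral_stdGaussian _ (by fun_prop),
    ← lintegral_add_right_eq_self
      (fun x => ENNReal.ofReal (stdGaussianDensity E x) *
        (ENNReal.ofReal (Real.exp (inner ℝ h x - ‖h‖ ^ 2 / 2)) * f x)) h]
  refine lintegral_congr fun x => ?_
  rw [← mul_assoc, ← ENNReal.ofReal_mul (stdGaussianDensity_nonneg _)]
  congr 2
  unfold stdGaussianDensity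
  rw [mul_assoc, ← Real.exp_add, norm_add_sq_real, inner_add_right, real_inner_self_eq_norm_sq,
    real_inner_comm]
  ring_nf

/-- The Cameron–Martin density has total mass 1. -/
theorem lintegral_exp_inner_stdGaussian (a : E) :
    ∫⁻ x, ENNReal.ofReal (Real.exp (inner ℝ a x)) ∂(stdGaussian E) =
      ENNReal.ofReal (Real.exp (‖a‖ ^ 2 / 2)) := by
  have h := lintegral_stdGaussian_add (E := E) (fun _ => 1) measurable_const a
  simp only [lintegral_const, measure_univ, mul_one] at h
  have h2 : ∀ x : E, ENNReal.ofReal (Real.exp (inner ℝ a x)) =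
      ENNReal.ofReal (Real.exp (‖a‖ ^ 2 / 2)) *
        ENNReal.ofReal (Real.exp (inner ℝ a x - ‖a‖ ^ 2 / 2)) := by
    intro x
    rw [← ENNReal.ofReal_mul (by positivity), ← Real.exp_add]; ring_nf
  simp_rw [h2]
  rw [lintegral_const_mul _ (by fun_prop), ← h, mul_one]

/-- The chi-square moment generating function. It yields the tails of single entries (dimension 1)
and of the norm (dimension n). -/
theorem lintegral_exp_sq_norm_stdGaussian {l : ℝ} (hl : l < 1 / 2) :
    ∫⁻ x, ENNReal.ofReal (Real.exp (l * ‖x‖ ^ 2)) ∂(stdGaussian E) =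
      ENNReal.ofReal ((1 - 2 * l) ^ (-(Module.finrank ℝ E / 2 : ℝ))) := by
  rw [lintegral_stdGaussian _ (by fun_prop)]
  have hb : 0 < 1 / 2 - l := by linarith
  have h : ∀ x : E, ENNReal.ofReal (stdGaussianDensity E x) *
      ENNReal.ofReal (Real.exp (l * ‖x‖ ^ 2)) = ENNReal.ofReal
        (((Real.pi / (1 / 2)) ^ (Module.finrank ℝ E / 2 : ℝ))⁻¹ *
          Real.exp (-(1 / 2 - l) * ‖x‖ ^ 2)) := by
    intro x
    rw [← ENNReal.ofReal_mul (stdGaussianDensity_nonneg _), stdGaussianDensity, mul_assoc,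
      ← Real.exp_add]
    ring_nf
  simp_rw [h]
  rw [← ofReal_integral_eq_lintegral_ofReal ((integrable_exp_neg_mul_sq_norm hb).const_mul _)
    (Filter.Eventually.of_forall fun x => by positivity), integral_const_mul,
    GaussianFourier.integral_rexp_neg_mul_sq_norm hb]
  congr 1
  rw [← Real.inv_rpow (by positivity), ← Real.mul_rpow (by positivity) (by positivity),
    Real.rpow_neg (by linarith), ← Real.inv_rpow (by linarith)]
  congr 1
  have : Real.pi ≠ 0 := Real.pi_ne_zero
  have h2 : 1 - 2 * l ≠ 0 := by linarith
  field_simp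

/-- Shifting a standard Gaussian measure: the bound dual to the Rényi divergence. -/
theorem lintegral_stdGaussian_add_le {s : ℝ} (hs : 0 < s) (f : E → ENNReal) (hf : Measurable f)
    (h : E) :
    ∫⁻ x, f (x + h) ∂(stdGaussian E) ≤
      ENNReal.ofReal (Real.exp (s * ‖h‖ ^ 2 / 2)) *
        (∫⁻ x, f x ^ ((1 + s) / s) ∂(stdGaussian E)) ^ (s / (1 + s)) := by
  -- Hölder with exponents 1 + s and (1 + s)/s separates the shift density from f. The (1 + s)-th
  -- moment of the density is again a Gaussian exponential moment.
  rw [lintegral_stdGaussian_add f hf]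
  have hpq : (1 + s).HolderConjugate ((1 + s) / s) := by
    rw [Real.holderConjugate_iff]
    refine ⟨by linarith, ?_⟩
    have : 1 + s ≠ 0 := by linarith
    field_simp
  refine (ENNReal.lintegral_mul_le_Lp_mul_Lq (stdGaussian E) hpq (by fun_prop)
    hf.aemeasurable).trans_eq ?_
  congr 1
  · have h2 : ∀ x : E, ENNReal.ofReal (Real.exp (inner ℝ h x - ‖h‖ ^ 2 / 2)) ^ (1 + s) =
        ENNReal.ofReal (Real.exp (-(1 + s) * ‖h‖ ^ 2 / 2)) *
          ENNReal.ofReal (Real.exp (inner ℝ ((1 + s) • h) x)) := by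
      intro x
      rw [ENNReal.ofReal_rpow_of_pos (by positivity), ← Real.exp_mul,
        ← ENNReal.ofReal_mul (by positivity), ← Real.exp_add, real_inner_smul_left]
      ring_nf
    simp_rw [h2]
    rw [lintegral_const_mul _ (by fun_prop), lintegral_exp_inner_stdGaussian,
      ← ENNReal.ofReal_mul (by positivity), ← Real.exp_add,
      ENNReal.ofReal_rpow_of_pos (by positivity), ← Real.exp_mul, norm_smul, Real.norm_eq_abs,
      abs_of_pos (by linarith)]
    congr 2
    field_simp
    ring
  · rw [one_div_div]

end GaussianDensity

end NoisyPower

namespace NoisyPower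

/-! ### The uniform law on the sphere as the direction of a Gaussian vector. -/

section UniformSphere

open Classical in
/-- The direction of a nonzero vector (and an arbitrary fixed direction for the zero vector). -/
noncomputable def direction {n : ℕ} (e : Metric.sphere (0 : Vec n) 1) (x : Vec n) :
    Metric.sphere (0 : Vec n) 1 :=
  if h : x = 0 then e else ⟨‖x‖⁻¹ • x, by simp [norm_smul, norm_ne_zero_iff.2 h]⟩

lemma direction_coe {n : ℕ} (e : Metric.sphere (0 : Vec n) 1) {x : Vec n} (hx : x ≠ 0) :
    (direction e x : Vec n) = ‖x‖⁻¹ • x := by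
  simp [direction, hx]

lemma measurable_direction {n : ℕ} (e : Metric.sphere (0 : Vec n) 1) :
    Measurable (direction e) := by
  refine measurable_of_measurable_on_compl_singleton 0 ?_
  have h : Set.domRestrict ({0}ᶜ : Set (Vec n)) (direction e) = fun x =>
      ⟨‖(x : Vec n)‖⁻¹ • (x : Vec n), by
        have : (x : Vec n) ≠ 0 := x.2
        simp [norm_smul, norm_ne_zero_iff.2 this]⟩ := by
    funext x
    have : (x : Vec n) ≠ 0 := x.2
    ext1
    exact direction_coe e this
  change Measurable (Set.domRestrict ({0}ᶜ : Set (Vec n)) (direction e))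
  rw [h]
  refine Measurable.subtype_mk ?_
  fun_prop

/-- In polar coordinates the Gaussian density depends on the radius only, so the image is a constant
K times the surface measure. Total mass 1 then identifies K as the normalizing factor. -/
theorem map_direction_stdGaussian {n : ℕ} (e : Metric.sphere (0 : Vec n) 1) :
    (stdGaussian (Vec n)).map (direction e) = uniformSphere n := by
  have hn : Nontrivial (Vec n) := ⟨⟨e, 0, fun h => by
    have := e.2; rw [h] at this; simp at this⟩⟩
  have hvol : Measure.IsAddHaarMeasure (volume : Measure (Vec n)) := inferInstance
  set K : ENNReal := ∫⁻ r, ENNReal.ofReal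
    (((Real.pi / (1 / 2)) ^ (Module.finrank ℝ (Vec n) / 2 : ℝ))⁻¹ *
      Real.exp (-(1 / 2) * (r : ℝ) ^ 2))
      ∂(Measure.volumeIoiPow (Module.finrank ℝ (Vec n) - 1)) with hK
  have key : ∀ s : Set (Metric.sphere (0 : Vec n) 1), MeasurableSet s →
      (stdGaussian (Vec n)).map (direction e) s = (volume : Measure (Vec n)).toSphere s * K := by
    intro s hs
    rw [Measure.map_apply (measurable_direction e) hs,
      ← lintegral_indicator_one (measurable_direction e hs),
      lintegral_stdGaussian _ (measurable_one.indicator (measurable_direction e hs))]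
    have hsub : ∀ f : Vec n → ENNReal, ∫⁻ x, f x =
        ∫⁻ x : ({0}ᶜ : Set (Vec n)), f x ∂(Measure.comap Subtype.val volume) := fun f => by
      rw [lintegral_subtype_comap (measurableSet_singleton _).compl, restrict_compl_singleton]
    rw [hsub]
    have hmp := (volume : Measure (Vec n)).measurePreserving_homeomorphUnitSphereProd
    have hg : Measurable (fun z : Metric.sphere (0 : Vec n) 1 × Set.Ioi (0 : ℝ) =>
        s.indicator (1 : Metric.sphere (0 : Vec n) 1 → ENNReal) z.1 * ENNReal.ofReal
          (((Real.pi / (1 / 2)) ^ (Module.finrank ℝ (Vec n) / 2 : ℝ))⁻¹ *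
          Real.exp (-(1 / 2) * (z.2 : ℝ) ^ 2))) :=
      ((measurable_one.indicator hs).comp measurable_fst).mul (by fun_prop)
    have h1 := hmp.lintegral_comp hg
    rw [lintegral_prod_mul (f := s.indicator (1 : Metric.sphere (0 : Vec n) 1 → ENNReal))
      (g := fun r : Set.Ioi (0 : ℝ) => ENNReal.ofReal
          (((Real.pi / (1 / 2)) ^ (Module.finrank ℝ (Vec n) / 2 : ℝ))⁻¹ *
          Real.exp (-(1 / 2) * (r : ℝ) ^ 2)))
      ((measurable_one.indicator hs).aemeasurable) (by fun_prop),
      lintegral_indicator_one hs, ← hK] at h1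
    rw [← h1]
    refine lintegral_congr fun x => ?_
    have hx : (x : Vec n) ≠ 0 := x.2
    rw [mul_comm]
    congr 1
    · have : direction e (x : Vec n) = (homeomorphUnitSphereProd (Vec n) x).1 := by
        ext1
        rw [direction_coe e hx]
        simp
      rw [← this]
      rfl
    · simp [stdGaussianDensity]
  have hprob : IsProbabilityMeasure ((stdGaussian (Vec n)).map (direction e)) :=
    Measure.isProbabilityMeasure_map (measurable_direction e).aemeasurable
  have h1 := key Set.univ MeasurableSet.univ
  rw [measure_univ] at h1
  ext s hs
  rw [key s hs, uniformSphere, Measure.smul_apply, smul_eq_mul, mul_comm]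
  congr 1
  exact ENNReal.eq_inv_of_mul_eq_one_left (by rw [mul_comm]; exact h1.symm)

instance isProbabilityMeasure_uniformSphere {n : ℕ} [NeZero n] :
    IsProbabilityMeasure (uniformSphere n) := by
  let e : Metric.sphere (0 : Vec n) 1 := ⟨EuclideanSpace.single 0 1, by simp⟩
  rw [← map_direction_stdGaussian e]
  exact Measure.isProbabilityMeasure_map (measurable_direction e).aemeasurable

end UniformSphere
end NoisyPower

namespace NoisyPower

/-! ### Sensitivity of one step to one edge. -/

section Sensitivity

lemma supNorm_nonneg {n : ℕ} (y : Vec n) : 0 ≤ supNorm y := norm_nonneg _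

lemma abs_apply_le_supNorm {n : ℕ} (y : Vec n) (i : Fin n) : |y i| ≤ supNorm y :=
  norm_le_pi_norm (WithLp.ofLp y) i

lemma supNorm_le_norm {n : ℕ} (y : Vec n) : supNorm y ≤ ‖y‖ :=
  (pi_norm_le_iff_of_nonneg (norm_nonneg y)).2 fun i => PiLp.norm_apply_le y i

/-- The left side is r² - (n-2) r s - (n-1) s². Dropping the last term and using one factor |r| ≤
√(n-2) leaves 3 (n-2)^(3/2) M, and with n = q² + 2 this reduces to 3q³ ≤ (q² + 2)². -/
lemma quadratic_sensitivity_bound {n M s r : ℝ} (hn : 2 ≤ n) (hM : 0 ≤ M) (hr : r ^ 2 ≤ n - 2)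
    (hrM : |r| ≤ (n - 2) * M) (hs : |s| ≤ 2 * M) :
    (s + r) ^ 2 - n * (s + r) * s ≤ M * n ^ 2 := by
  obtain ⟨q, hq0, hq⟩ : ∃ q : ℝ, 0 ≤ q ∧ n = q ^ 2 + 2 :=
    ⟨√(n - 2), Real.sqrt_nonneg _, by rw [Real.sq_sqrt (by linarith)]; ring⟩
  have hrq : |r| ≤ q := abs_le_of_sq_le_sq (by linarith) hq0
  have h1 : r ^ 2 ≤ |r| * ((n - 2) * M) := by
    rw [← sq_abs, sq]; gcongr
  have h2 : -(n - 2) * (r * s) ≤ (n - 2) * (|r| * (2 * M)) := by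
    have : -(r * s) ≤ |r| * (2 * M) :=
      (neg_le_abs _).trans (by rw [abs_mul]; gcongr)
    nlinarith
  have h3 : |r| * ((n - 2) * (3 * M)) ≤ q * ((n - 2) * (3 * M)) := by
    gcongr
  have h4 : q * ((n - 2) * (3 * M)) ≤ M * n ^ 2 := by
    have : 0 ≤ q ^ 4 - 3 * q ^ 3 + 4 * q ^ 2 + 4 := by nlinarith [sq_nonneg (q * (2 * q - 3)), sq_nonneg q]
    rw [hq]; nlinarith
  nlinarith [mul_nonneg (show (0:ℝ) ≤ n - 1 by linarith) (sq_nonneg s)]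

/-- The vector is, up to sign, (B - B') y for graphs that differ in the edge ij. With S = ∑ y, its
squared norm is y_i² + y_j² + (4/n³)(S² - n S (y_i + y_j)) ≤ 2M² + 4M/n. The cross term is what the
summand 1/n in the noise scale pays for. -/
lemma sum_sq_rankTwo_le {n : ℕ} {i j : Fin n} (hij : i ≠ j) (y : Fin n → ℝ)
    (hy : ∑ a, y a ^ 2 ≤ 1) {M : ℝ} (hM : ∀ a, |y a| ≤ M) :
    ∑ a, ((if a = i then y j else 0) + (if a = j then y i else 0)
        - 2 / (n : ℝ) ^ 2 * ∑ b, y b) ^ 2 ≤ 2 * (M + 1 / n) ^ 2 := by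
  have hM0 : 0 ≤ M := (abs_nonneg _).trans (hM i)
  set S := ∑ b, y b with hS
  set T : Finset (Fin n) := (Finset.univ.erase i).erase j with hT
  have hjm : j ∈ Finset.univ.erase i := Finset.mem_erase.2 ⟨hij.symm, Finset.mem_univ _⟩
  have hsplit : ∀ f : Fin n → ℝ, ∑ a, f a = f i + f j + ∑ a ∈ T, f a := fun f => by
    rw [← Finset.add_sum_erase _ f (Finset.mem_univ i), ← Finset.add_sum_erase _ f hjm]; ring
  have hcard : T.card = n - 2 := by
    rw [hT, Finset.card_erase_of_mem hjm, Finset.card_erase_of_mem (Finset.mem_univ i)]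
    simp; omega
  have hn2 : 2 ≤ n := by
    have := i.2; have := j.2
    have : (i : ℕ) ≠ j := fun h => hij (Fin.ext h)
    omega
  have hn : (2 : ℝ) ≤ n := by exact_mod_cast hn2
  have hcard' : (T.card : ℝ) = n - 2 := by rw [hcard]; push_cast [hn2]; ring
  set r := ∑ a ∈ T, y a with hr
  have hSr : S = (y i + y j) + r := hsplit y
  have hr2 : r ^ 2 ≤ n - 2 := by
    have h1 : r ^ 2 ≤ T.card * ∑ a ∈ T, y a ^ 2 := sq_sum_le_card_mul_sum_sq
    have h2 : ∑ a ∈ T, y a ^ 2 ≤ 1 := by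
      have := hsplit fun a => y a ^ 2
      nlinarith [sq_nonneg (y i), sq_nonneg (y j)]
    rw [hcard'] at h1
    nlinarith
  have hrM : |r| ≤ (n - 2) * M := by
    refine (Finset.abs_sum_le_sum_abs _ _).trans ?_
    refine (Finset.sum_le_sum fun a _ => hM a).trans ?_
    simp [hcard']
  have hs : |y i + y j| ≤ 2 * M := by
    have := abs_add_le (y i) (y j); linarith [hM i, hM j]
  have hq := quadratic_sensitivity_bound hn hM0 hr2 hrM hs
  rw [← hSr] at hq
  have hexp : ∑ a, ((if a = i then y j else 0) + (if a = j then y i else 0)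
      - 2 / (n : ℝ) ^ 2 * S) ^ 2 =
      y i ^ 2 + y j ^ 2 + 4 / (n : ℝ) ^ 3 * (S ^ 2 - n * S * (y i + y j)) := by
    rw [hsplit]
    have h1 : ∑ a ∈ T, ((if a = i then y j else 0) + (if a = j then y i else 0)
      - 2 / (n : ℝ) ^ 2 * S) ^ 2 = ∑ a ∈ T, (2 / (n : ℝ) ^ 2 * S) ^ 2 := by
      refine Finset.sum_congr rfl fun a ha => ?_
      rw [hT, Finset.mem_erase, Finset.mem_erase] at ha
      simp [ha.1, ha.2.1]
    rw [h1, Finset.sum_const, nsmul_eq_mul, hcard']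
    simp only [if_true, hij, hij.symm, if_false]
    field_simp
    ring
  rw [hexp]
  have h4 : 4 / (n : ℝ) ^ 3 * (S ^ 2 - n * S * (y i + y j)) ≤ 4 / (n : ℝ) ^ 3 * (M * n ^ 2) := by
    gcongr
  have h5 : 4 / (n : ℝ) ^ 3 * (M * n ^ 2) = 4 * M * (1 / n) := by field_simp
  have hi : y i ^ 2 ≤ M ^ 2 := sq_le_sq.2 (by rw [abs_of_nonneg hM0]; exact hM i)
  have hj : y j ^ 2 ≤ M ^ 2 := sq_le_sq.2 (by rw [abs_of_nonneg hM0]; exact hM j)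
  nlinarith [sq_nonneg (1 / (n : ℝ))]

/-- The factor c = ±1 records which of the two graphs contains the edge. Only c² matters later. -/
lemma adj_sub_adj_of_neighbors {n : ℕ} {G G' : SimpleGraph (Fin n)} (h : Neighbors G G') :
    ∃ (i j : Fin n) (c : ℝ), i ≠ j ∧ c ^ 2 = 1 ∧ ∀ a b, adj G a b - adj G' a b =
      c * ((if a = i ∧ b = j then 1 else 0) + (if a = j ∧ b = i then 1 else 0)) := by
  classical
  obtain ⟨e, he⟩ := h
  induction e with | _ i j
  have hmem : ∀ a b, (s(a, b) ∈ symmDiff G.edgeSet G'.edgeSet) ↔ (a = i ∧ b = j ∨ a = j ∧ b = i) := by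
    intro a b; rw [he, Set.mem_singleton_iff, Sym2.eq_iff]
  have hmem' : ∀ a b, (G.Adj a b ∧ ¬ G'.Adj a b ∨ G'.Adj a b ∧ ¬ G.Adj a b) ↔
      (a = i ∧ b = j ∨ a = j ∧ b = i) := by
    intro a b; rw [← hmem, Set.mem_symmDiff]; simp
  have hij : i ≠ j := by
    rintro rfl
    have := (hmem' i i).2 (Or.inl ⟨rfl, rfl⟩)
    simp at this
  have hadj : ∀ (H : SimpleGraph (Fin n)) a b, adj H a b = if H.Adj a b then 1 else 0 := by
    intro H a b; simp [adj, SimpleGraph.adjMatrix_apply]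
  have hcomm := G.adj_comm i j
  have hcomm' := G'.adj_comm i j
  have key : ∀ c : ℝ, adj G i j - adj G' i j = c → ∀ a b, adj G a b - adj G' a b =
      c * ((if a = i ∧ b = j then 1 else 0) + (if a = j ∧ b = i then 1 else 0)) := by
    intro c hc a b
    by_cases h1 : a = i ∧ b = j
    · have h2 : ¬ (a = j ∧ b = i) := fun h2 => hij (h1.1.symm.trans h2.1)
      rw [if_pos h1, if_neg h2, h1.1, h1.2, hc]; ring
    · by_cases h2 : a = j ∧ b = i
      · rw [if_neg h1, if_pos h2, h2.1, h2.2, hadj, hadj, ← hcomm, ← hcomm', ← hadj, ← hadj, hc]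
        ring
      · have := (hmem' a b).not.2 (by tauto)
        rw [if_neg h1, if_neg h2, hadj, hadj]
        by_cases g1 : G.Adj a b <;> by_cases g2 : G'.Adj a b <;> simp_all
  refine ⟨i, j, adj G i j - adj G' i j, hij, ?_, key _ rfl⟩
  rw [hadj, hadj]
  have := (hmem' i j).2 (Or.inl ⟨rfl, rfl⟩)
  by_cases g1 : G.Adj i j <;> by_cases g2 : G'.Adj i j <;> simp_all

lemma applyB_apply {n : ℕ} (G : SimpleGraph (Fin n)) (y : Vec n) (a : Fin n) :
    applyB G y a = ∑ b, adj G a b * y b - density G * ∑ b, y b := by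
  simp only [applyB, centered, Matrix.toLpLin_apply, Matrix.mulVec, dotProduct, Matrix.sub_apply,
    Matrix.smul_apply, Matrix.of_apply, smul_eq_mul, mul_one, sub_mul, Finset.sum_sub_distrib,
    Finset.mul_sum]

/-- The sensitivity of one step of the power iteration. -/
theorem norm_sq_applyB_sub_le {n : ℕ} {G G' : SimpleGraph (Fin n)} (h : Neighbors G G')
    (y : Vec n) (hy : ‖y‖ ≤ 1) :
    ‖applyB G y - applyB G' y‖ ^ 2 ≤ 2 * (supNorm y + 1 / n) ^ 2 := by
  obtain ⟨i, j, c, hij, hc, hd⟩ := adj_sub_adj_of_neighbors h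
  have hdens : density G - density G' = c * (2 / (n : ℝ) ^ 2) := by
    rw [density, density, ← sub_div, ← Finset.sum_sub_distrib]
    simp_rw [← Finset.sum_sub_distrib, hd, ← Finset.mul_sum, Finset.sum_add_distrib, ite_and]
    simp
    ring
  have hcoord : ∀ a, (applyB G y - applyB G' y) a = c * ((if a = i then y j else 0) +
      (if a = j then y i else 0) - 2 / (n : ℝ) ^ 2 * ∑ b, y b) := by
    intro a
    rw [PiLp.sub_apply, applyB_apply, applyB_apply]
    have h1 : ∑ b, adj G a b * y b - ∑ b, adj G' a b * y b =
        c * ((if a = i then y j else 0) + (if a = j then y i else 0)) := by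
      rw [← Finset.sum_sub_distrib]
      simp_rw [← sub_mul, hd, mul_assoc, ← Finset.mul_sum, add_mul, Finset.sum_add_distrib, ite_and]
      by_cases h1 : a = i <;> by_cases h2 : a = j <;> simp [h1, h2]
    linear_combination h1 - (∑ b, y b) * hdens
  rw [EuclideanSpace.norm_sq_eq]
  simp_rw [hcoord, Real.norm_eq_abs, sq_abs, mul_pow, hc, one_mul]
  refine sum_sq_rankTwo_le hij _ ?_ (abs_apply_le_supNorm y)
  rw [EuclideanSpace.norm_eq] at hy
  have := Real.sqrt_le_one.1 hy
  simpa [sq_abs] using this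

end Sensitivity
end NoisyPower

namespace NoisyPower

/-! ### Composition over the iterations and the privacy guarantee. -/

section Privacy

/-- The normalization `x / ‖x‖₂`. -/
noncomputable def normalize {n : ℕ} (x : Vec n) : Vec n := ‖x‖⁻¹ • x

lemma norm_normalize_le_one {n : ℕ} (x : Vec n) : ‖normalize x‖ ≤ 1 := by
  rw [normalize, norm_smul, norm_inv, norm_norm]
  exact inv_mul_le_one

/-- The iterates with an arbitrary starting vector. -/
noncomputable def iterateFrom {n N : ℕ} (G : SimpleGraph (Fin n)) (σ : ℝ) (y : Vec n)
    (g : Fin N → Vec n) : Fin (N + 1) → Vec n :=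
  Fin.induction y (fun t y => normalize (step G σ y (g t)))

/-- The unnormalized iterates with an arbitrary starting vector. -/
noncomputable def transcriptFrom {n N : ℕ} (G : SimpleGraph (Fin n)) (σ : ℝ) (y : Vec n)
    (g : Fin N → Vec n) : Fin N → Vec n :=
  fun t => step G σ (iterateFrom G σ y g t.castSucc) (g t)

lemma iterate_eq_iterateFrom {n N : ℕ} (G : SimpleGraph (Fin n)) (σ : ℝ) (ω : Seed n N) :
    iterate G σ ω = iterateFrom G σ ω.1 ω.2 := rfl

lemma iterateFrom_zero {n N : ℕ} (G : SimpleGraph (Fin n)) (σ : ℝ) (y : Vec n)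
    (g : Fin N → Vec n) : iterateFrom G σ y g 0 = y := rfl

lemma iterateFrom_succ {n N : ℕ} (G : SimpleGraph (Fin n)) (σ : ℝ) (y : Vec n)
    (g : Fin N → Vec n) (t : Fin N) :
    iterateFrom G σ y g t.succ = normalize (step G σ (iterateFrom G σ y g t.castSucc) (g t)) :=
  Fin.induction_succ _ _ _

/-- Peeling off the first step restarts the chain at a new vector. This is the form that an
induction on the number of steps needs. -/
lemma iterateFrom_cons_succ {n N : ℕ} (G : SimpleGraph (Fin n)) (σ : ℝ) (y g₀ : Vec n)
    (g : Fin N → Vec n) (k : Fin (N + 1)) :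
    iterateFrom G σ y (Fin.cons g₀ g : Fin (N + 1) → Vec n) k.succ =
      iterateFrom G σ (normalize (step G σ y g₀)) g k := by
  induction k using Fin.induction with
  | zero =>
    rw [iterateFrom_succ, Fin.castSucc_zero, iterateFrom_zero, iterateFrom_zero, Fin.cons_zero]
  | succ t ih =>
    rw [iterateFrom_succ, iterateFrom_succ, Fin.cons_succ, ← Fin.succ_castSucc, ih]

lemma transcriptFrom_cons {n N : ℕ} (G : SimpleGraph (Fin n)) (σ : ℝ) (y g₀ : Vec n)
    (g : Fin N → Vec n) :
    transcriptFrom G σ y (Fin.cons g₀ g : Fin (N + 1) → Vec n) =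
      Fin.cons (step G σ y g₀) (transcriptFrom G σ (normalize (step G σ y g₀)) g) := by
  funext t
  refine Fin.cases ?_ (fun k => ?_) t
  · simp [transcriptFrom, iterateFrom_zero]
  · simp only [transcriptFrom, Fin.cons_succ, ← Fin.succ_castSucc, iterateFrom_cons_succ]

lemma continuous_supNorm {n : ℕ} : Continuous (supNorm : Vec n → ℝ) := by
  unfold supNorm; fun_prop

lemma continuous_applyB {n : ℕ} (G : SimpleGraph (Fin n)) : Continuous (applyB G) :=
  LinearMap.continuous_of_finiteDimensional (Matrix.toEuclideanLin (centered G))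

lemma measurable_normalize {n : ℕ} : Measurable (normalize : Vec n → Vec n) := by
  unfold normalize; fun_prop

lemma measurable_step {n : ℕ} (G : SimpleGraph (Fin n)) (σ : ℝ) {X : Type*} [MeasurableSpace X]
    {y g : X → Vec n} (hy : Measurable y) (hg : Measurable g) :
    Measurable (fun x => step G σ (y x) (g x)) := by
  have h1 := (continuous_applyB G).measurable.comp hy
  have h2 := (continuous_supNorm (n := n)).measurable.comp hy
  exact h1.add (((h2.add_const _).mul_const _).smul hg)

lemma measurable_iterateFrom {n N : ℕ} (G : SimpleGraph (Fin n)) (σ : ℝ) {X : Type*}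
    [MeasurableSpace X] {y : X → Vec n} {g : X → Fin N → Vec n} (hy : Measurable y)
    (hg : Measurable g) (k : Fin (N + 1)) :
    Measurable (fun x => iterateFrom G σ (y x) (g x) k) := by
  induction k using Fin.induction with
  | zero => simpa only [iterateFrom_zero] using hy
  | succ t ih =>
    simp only [iterateFrom_succ]
    exact measurable_normalize.comp (measurable_step G σ ih ((measurable_pi_apply t).comp hg))

lemma measurable_transcriptFrom {n N : ℕ} (G : SimpleGraph (Fin n)) (σ : ℝ) {X : Type*}
    [MeasurableSpace X] {y : X → Vec n} {g : X → Fin N → Vec n} (hy : Measurable y)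
    (hg : Measurable g) :
    Measurable (fun x => transcriptFrom G σ (y x) (g x)) :=
  measurable_pi_lambda _ fun t => measurable_step G σ (measurable_iterateFrom G σ hy hg _)
    ((measurable_pi_apply t).comp hg)

lemma lintegral_pi_succ {N : ℕ} {X : Type*} [MeasurableSpace X] (μ : Measure X) [SigmaFinite μ]
    (f : (Fin (N + 1) → X) → ENNReal) (hf : Measurable f) :
    ∫⁻ g, f g ∂(Measure.pi fun _ => μ) =
      ∫⁻ x, ∫⁻ g : Fin N → X, f (Fin.cons x g) ∂(Measure.pi fun _ => μ) ∂μ := by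
  have h := (measurePreserving_piFinSuccAbove (fun _ : Fin (N + 1) => μ) 0).symm
  rw [← h.lintegral_comp hf, lintegral_prod _ (by
    exact (hf.comp (MeasurableEquiv.measurable _)).aemeasurable)]
  simp [Fin.insertNthEquiv]

/-- The noise scale depends on y and not on the graph, so the two steps differ by a translation of
g. Dividing the sensitivity by the scale leaves a shift of squared norm at most 2/σ². -/
lemma lintegral_step_le {n : ℕ} [NeZero n] {G G' : SimpleGraph (Fin n)} (h : Neighbors G G')
    {σ s : ℝ} (hσ : 0 < σ) (hs : 0 < s) {y : Vec n} (hy : ‖y‖ ≤ 1) (f : Vec n → ENNReal)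
    (hf : Measurable f) :
    ∫⁻ g, f (step G σ y g) ∂(stdGaussian (Vec n)) ≤
      ENNReal.ofReal (Real.exp (s / σ ^ 2)) *
        (∫⁻ g, f (step G' σ y g) ^ ((1 + s) / s) ∂(stdGaussian (Vec n))) ^ (s / (1 + s)) := by
  have hn : 0 < (n : ℝ) := by exact_mod_cast Nat.pos_of_ne_zero (NeZero.ne n)
  set c := (supNorm y + 1 / (n : ℝ)) * σ with hc
  have hm : 0 < supNorm y + 1 / (n : ℝ) := add_pos_of_nonneg_of_pos (supNorm_nonneg y) (by positivity)
  have hc0 : 0 < c := by positivity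
  set v := c⁻¹ • (applyB G y - applyB G' y) with hv
  have hstep : ∀ g, step G σ y g = step G' σ y (g + v) := by
    intro g
    rw [step, step, smul_add, ← hc, hv, smul_inv_smul₀ hc0.ne']
    abel
  have hvn : ‖v‖ ^ 2 ≤ 2 / σ ^ 2 := by
    have := norm_sq_applyB_sub_le h y hy
    rw [hv, norm_smul, mul_pow, norm_inv, Real.norm_of_nonneg hc0.le, inv_pow, inv_mul_le_iff₀ (by positivity), hc,
      mul_pow]
    refine this.trans_eq ?_
    field_simp
  simp_rw [hstep]
  refine (lintegral_stdGaussian_add_le hs (fun g => f (step G' σ y g))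
    (hf.comp (measurable_step G' σ measurable_const measurable_id)) v).trans ?_
  refine mul_le_mul_left (ENNReal.ofReal_le_ofReal (Real.exp_le_exp.2 ?_)) _
  calc s * ‖v‖ ^ 2 / 2 ≤ s * (2 / σ ^ 2) / 2 := by gcongr
    _ = s / σ ^ 2 := by ring

/-- Adaptive composition. The statement is for arbitrary f rather than indicators, since fixing the
first step and integrating out the others leaves a general function. -/
theorem lintegral_transcriptFrom_le {n : ℕ} [NeZero n] {G G' : SimpleGraph (Fin n)}
    (h : Neighbors G G') {σ s : ℝ} (hσ : 0 < σ) (hs : 0 < s) (N : ℕ) (y : Vec n) (hy : ‖y‖ ≤ 1)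
    (f : (Fin N → Vec n) → ENNReal) (hf : Measurable f) :
    ∫⁻ g, f (transcriptFrom G σ y g) ∂(Measure.pi fun _ => stdGaussian (Vec n)) ≤
      ENNReal.ofReal (Real.exp (s / σ ^ 2)) ^ N *
        (∫⁻ g, f (transcriptFrom G' σ y g) ^ ((1 + s) / s)
          ∂(Measure.pi fun _ => stdGaussian (Vec n))) ^ (s / (1 + s)) := by
  have hss : (1 + s) / s * (s / (1 + s)) = 1 := by
    have : 1 + s ≠ 0 := by linarith
    field_simp
  have hpos : 0 < (1 + s) / s := by positivity
  have hpos' : 0 < s / (1 + s) := by positivity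
  induction N generalizing y with
  | zero =>
    have hconst : ∀ (H : SimpleGraph (Fin n)) g, f (transcriptFrom H σ y g) = f Fin.elim0 :=
      fun H g => congrArg f (Subsingleton.elim _ _)
    simp only [hconst, lintegral_const, measure_univ, mul_one, pow_zero, one_mul]
    rw [← ENNReal.rpow_mul, hss, ENNReal.rpow_one]
  | succ N ih =>
    have hmT : ∀ H : SimpleGraph (Fin n),
        Measurable fun g : Fin (N + 1) → Vec n => f (transcriptFrom H σ y g) := fun H =>
      hf.comp (measurable_transcriptFrom H σ measurable_const measurable_id)
    have hmc : Measurable (fun p : Vec n × (Fin N → Vec n) =>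
        (Fin.cons p.1 p.2 : Fin (N + 1) → Vec n)) := by
      refine measurable_pi_lambda _ fun t => ?_
      refine Fin.cases ?_ (fun k => ?_) t
      · simpa using measurable_fst
      · simp only [Fin.cons_succ]
        exact (measurable_pi_apply k).comp measurable_snd
    rw [lintegral_pi_succ _ _ (hmT G), lintegral_pi_succ _ _ ((hmT G').pow_const _)]
    simp_rw [transcriptFrom_cons]
    -- The outer exponent s/(1+s) in Φ is cancelled when the one-step bound raises Φ to the power
    -- (1+s)/s. So exponents do not accumulate, and only the prefactor is multiplied.
    set Φ : Vec n → ENNReal := fun x => (∫⁻ g, f (Fin.cons x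
      (transcriptFrom G' σ (normalize x) g)) ^ ((1 + s) / s)
        ∂(Measure.pi fun _ : Fin N => stdGaussian (Vec n))) ^ (s / (1 + s)) with hΦ
    have hΦm : Measurable Φ := by
      refine Measurable.pow_const ?_ _
      refine Measurable.lintegral_prod_right (f := fun x g => f (Fin.cons x
        (transcriptFrom G' σ (normalize x) g)) ^ ((1 + s) / s)) ?_
      refine Measurable.pow_const (hf.comp (hmc.comp (measurable_fst.prodMk
        (measurable_transcriptFrom G' σ (measurable_normalize.comp measurable_fst)
          measurable_snd)))) _
    calc _ ≤ ∫⁻ x, ENNReal.ofReal (Real.exp (s / σ ^ 2)) ^ N * Φ (step G σ y x)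
          ∂(stdGaussian (Vec n)) := by
          refine lintegral_mono fun x => ?_
          exact ih (normalize (step G σ y x)) (norm_normalize_le_one _)
            (fun g => f (Fin.cons (step G σ y x) g))
            (hf.comp (hmc.comp (measurable_const.prodMk measurable_id)))
      _ = ENNReal.ofReal (Real.exp (s / σ ^ 2)) ^ N * ∫⁻ x, Φ (step G σ y x)
          ∂(stdGaussian (Vec n)) := lintegral_const_mul _ (hΦm.comp
            (measurable_step G σ measurable_const measurable_id))
      _ ≤ _ := by
          rw [pow_succ _ N, mul_assoc]
          gcongr
          refine (lintegral_step_le h hσ hs hy Φ hΦm).trans_eq ?_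
          congr 2
          refine lintegral_congr fun x => ?_
          rw [hΦ]
          simp only
          rw [← ENNReal.rpow_mul, mul_comm (s / (1 + s)), hss, ENNReal.rpow_one]

/-- Young's inequality: the concave function of a on the left lies below a line of slope e^ε. It
remains to bound the intercept by δ. -/
lemma gaussian_tradeoff {ε δ a : ℝ} (hε : 0 < ε) (hε1 : ε ≤ 1) (hδ : 0 < δ) (hδ1 : δ ≤ 4 / 5)
    (ha : 0 ≤ a) {s : ℝ} (hs : s = 2 * Real.log (1 / δ) / ε) :
    Real.exp (ε / 2) * a ^ (s / (1 + s)) ≤ Real.exp ε * a + δ := by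
  set l := Real.log (1 / δ) with hl
  have hl5 : 1 / 5 ≤ l := by
    have := Real.one_sub_inv_le_log_of_pos (show 0 < 1 / δ by positivity)
    rw [one_div, inv_inv] at this
    rw [← one_div] at this; linarith
  have hδl : δ = Real.exp (-l) := by
    rw [hl, Real.log_div one_ne_zero hδ.ne', Real.log_one, zero_sub, neg_neg, Real.exp_log hδ]
  have hsε : s * ε = 2 * l := by rw [hs]; field_simp
  have hs4 : 2 / 5 ≤ s := by nlinarith
  have hs0 : 0 < s := by linarith
  have h1s : 0 < 1 + s := by linarith
  set w := s / (1 + s) with hw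
  have hw0 : 0 < w := by positivity
  have hw1 : w + 1 / (1 + s) = 1 := by rw [hw]; field_simp; ring
  -- X is solved from the requirement that the weighted geometric mean of e^ε a / w and X be exactly
  -- the left side.
  set X := Real.exp (ε / 2 - l) * w ^ s with hX
  have hXpos : 0 < X := by positivity
  have hyoung := Real.geom_mean_le_arith_mean2_weighted hw0.le (by positivity : 0 ≤ 1 / (1 + s))
    (by positivity : 0 ≤ Real.exp ε * a / w) hXpos.le hw1
  have hleft : (Real.exp ε * a / w) ^ w * X ^ (1 / (1 + s)) = Real.exp (ε / 2) * a ^ w := by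
    rw [Real.div_rpow (by positivity) hw0.le, Real.mul_rpow (by positivity) ha, hX,
      Real.mul_rpow (by positivity) (by positivity), ← Real.rpow_mul hw0.le, ← Real.exp_mul,
      ← Real.exp_mul]
    have h1 : s * (1 / (1 + s)) = w := by rw [hw]; ring
    rw [h1]
    have h2 : Real.exp (ε * w) * Real.exp ((ε / 2 - l) * (1 / (1 + s))) = Real.exp (ε / 2) := by
      rw [← Real.exp_add]
      congr 1
      rw [hw]; field_simp; linear_combination hsε
    have h3 : w ^ w ≠ 0 := (Real.rpow_pos_of_pos hw0 _).ne'
    rw [← h2]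
    field_simp
  have hright : w * (Real.exp ε * a / w) = Real.exp ε * a := by field_simp
  have hXδ : 1 / (1 + s) * X ≤ δ := by
    have h1 : 1 / (1 + s) ≤ Real.exp (-w) := by
      have := Real.one_sub_le_exp_neg w
      linarith
    have h2 : w ^ s ≤ Real.exp (-w) := by
      have h3 : w ≤ Real.exp (-(1 / (1 + s))) := by
        have := Real.one_sub_le_exp_neg (1 / (1 + s)); linarith
      calc w ^ s ≤ Real.exp (-(1 / (1 + s))) ^ s := Real.rpow_le_rpow hw0.le h3 hs0.le
        _ = Real.exp (-w) := by rw [← Real.exp_mul, hw]; ring_nf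
    calc 1 / (1 + s) * X ≤ Real.exp (-w) * (Real.exp (ε / 2 - l) * Real.exp (-w)) := by
          rw [hX]; gcongr
      _ = Real.exp (-l + (ε / 2 - 2 * w)) := by rw [← Real.exp_add, ← Real.exp_add]; ring_nf
      _ ≤ Real.exp (-l) := by
          gcongr
          -- Here δ ≤ 4/5 and ε ≤ 1 enter: they give s ≥ 2/5, hence 2w ≥ 1/2 ≥ ε/2.
          have : 1 / 4 ≤ w := by rw [hw, div_le_div_iff₀ (by norm_num) h1s]; linarith
          linarith
      _ = δ := hδl.symm
  rw [hleft, hright] at hyoung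
  linarith

lemma noiseLevel_pos {N : ℕ} (hN : 1 ≤ N) {ε δ : ℝ} (hε : 0 < ε) (hδ : 0 < δ) (hδ1 : δ ≤ 4 / 5) :
    0 < noiseLevel N ε δ := by
  have hl : 0 < Real.log (1 / δ) :=
    Real.log_pos (by rw [lt_div_iff₀ hδ]; linarith)
  have : (0 : ℝ) < N := by exact_mod_cast hN
  unfold noiseLevel; positivity

theorem measure_transcriptFrom_le {n N : ℕ} [NeZero n] (hN : 1 ≤ N) {G G' : SimpleGraph (Fin n)}
    (h : Neighbors G G') {ε δ : ℝ} (hε : 0 < ε) (hε1 : ε ≤ 1) (hδ : 0 < δ) (hδ1 : δ ≤ 4 / 5)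
    (y : Vec n) (hy : ‖y‖ ≤ 1) (S : Set (Fin N → Vec n)) (hS : MeasurableSet S) :
    (Measure.pi fun _ => stdGaussian (Vec n))
        {g | transcriptFrom G (noiseLevel N ε δ) y g ∈ S} ≤
      ENNReal.ofReal (Real.exp ε) * (Measure.pi fun _ => stdGaussian (Vec n))
        {g | transcriptFrom G' (noiseLevel N ε δ) y g ∈ S} + ENNReal.ofReal δ := by
  set σ := noiseLevel N ε δ with hσ
  have hσ0 : 0 < σ := noiseLevel_pos hN hε hδ hδ1
  set l := Real.log (1 / δ) with hl
  have hl0 : 0 < l := Real.log_pos (by rw [lt_div_iff₀ hδ]; linarith)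
  set s := 2 * l / ε with hs
  have hs0 : 0 < s := by positivity
  have hN0 : (0 : ℝ) < N := by exact_mod_cast hN
  have hσ2 : σ ^ 2 = ε⁻¹ ^ 2 * (4 * N * l) := by
    rw [hσ, noiseLevel, mul_pow, Real.sq_sqrt (by positivity)]
  have hmT : ∀ H : SimpleGraph (Fin n),
      MeasurableSet {g : Fin N → Vec n | transcriptFrom H σ y g ∈ S} := fun H =>
    measurable_transcriptFrom H σ measurable_const measurable_id hS
  have key := lintegral_transcriptFrom_le h hσ0 hs0 N y hy (S.indicator 1)
    (measurable_one.indicator hS)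
  have hind : ∀ (H : SimpleGraph (Fin n)) g, S.indicator (1 : (Fin N → Vec n) → ENNReal)
      (transcriptFrom H σ y g) =
        {g : Fin N → Vec n | transcriptFrom H σ y g ∈ S}.indicator 1 g := fun H g => rfl
  -- An indicator equals its own positive powers, so the inner exponent disappears.
  have hindp : ∀ (H : SimpleGraph (Fin n)) g, S.indicator (1 : (Fin N → Vec n) → ENNReal)
      (transcriptFrom H σ y g) ^ ((1 + s) / s) =
        {g : Fin N → Vec n | transcriptFrom H σ y g ∈ S}.indicator 1 g := by
    intro H g
    have hpos : 0 < (1 + s) / s := by positivity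
    rw [hind]
    by_cases hg : g ∈ {g : Fin N → Vec n | transcriptFrom H σ y g ∈ S}
    · simp [Set.indicator_of_mem hg]
    · rw [Set.indicator_of_notMem hg, ENNReal.zero_rpow_of_pos hpos]
  simp_rw [hindp, hind] at key
  rw [lintegral_indicator_one (hmT G), lintegral_indicator_one (hmT G')] at key
  refine key.trans ?_
  set P' := (Measure.pi fun _ => stdGaussian (Vec n))
    {g : Fin N → Vec n | transcriptFrom G' σ y g ∈ S} with hP'
  have hP'1 : P' ≠ ⊤ := measure_ne_top _ _
  -- The choice of s makes N s/σ² = ε/2, since σ² = 4 N l / ε².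
  have hK : ENNReal.ofReal (Real.exp (s / σ ^ 2)) ^ N = ENNReal.ofReal (Real.exp (ε / 2)) := by
    rw [← ENNReal.ofReal_pow (by positivity), ← Real.exp_nat_mul]
    congr 2
    rw [hσ2, hs]
    field_simp
    ring
  rw [hK, ← ENNReal.ofReal_toReal hP'1, ENNReal.ofReal_rpow_of_nonneg (by positivity)
    (by positivity), ← ENNReal.ofReal_mul (by positivity), ← ENNReal.ofReal_mul (by positivity),
    ← ENNReal.ofReal_add (by positivity) hδ.le]
  exact ENNReal.ofReal_le_ofReal (gaussian_tradeoff hε hε1 hδ hδ1 (by positivity) hs)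

theorem edgeDP_transcript {n N : ℕ} [NeZero n] (hN : 1 ≤ N) {ε δ : ℝ} (hε : 0 < ε) (hε1 : ε ≤ 1)
    (hδ : 0 < δ) (hδ1 : δ ≤ 4 / 5) :
    EdgeDP (seedLaw n N)
      (fun (G : SimpleGraph (Fin n)) ω => transcript G (noiseLevel N ε δ) ω) ε δ := by
  intro G G' h S hS
  have hm : ∀ H : SimpleGraph (Fin n),
      MeasurableSet {ω : Seed n N | transcript H (noiseLevel N ε δ) ω ∈ S} := fun H =>
    measurable_transcriptFrom H (noiseLevel N ε δ)
      (measurable_subtype_coe.comp measurable_fst) measurable_snd hS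
  rw [seedLaw, Measure.prod_apply (hm G), Measure.prod_apply (hm G')]
  calc _ ≤ ∫⁻ y, (ENNReal.ofReal (Real.exp ε) * (Measure.pi fun _ => stdGaussian (Vec n))
          (Prod.mk y ⁻¹' {ω : Seed n N | transcript G' (noiseLevel N ε δ) ω ∈ S})
          + ENNReal.ofReal δ) ∂(uniformSphere n) := by
        refine lintegral_mono fun y => ?_
        exact measure_transcriptFrom_le hN h hε hε1 hδ hδ1 y (by simp) S hS
    _ = _ := by
        rw [lintegral_add_right _ measurable_const, lintegral_const_mul _
          (measurable_measure_prodMk_left (hm G')), lintegral_const, measure_univ, mul_one]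

lemma lastIterate_eq {n N : ℕ} (G : SimpleGraph (Fin n)) (σ : ℝ) (ω : Seed n (N + 1)) :
    lastIterate G σ ω = normalize (transcript G σ ω (Fin.last N)) := by
  rw [lastIterate, iterate_eq_iterateFrom, ← Fin.succ_last, iterateFrom_succ]
  rfl

/-- Post-processing: the labels are a measurable function F of the last entry of the transcript,
which exists because N ≥ 1. -/
theorem edgeDP_labels {n N : ℕ} [NeZero n] (hN : 1 ≤ N) {ε δ : ℝ} (hε : 0 < ε) (hε1 : ε ≤ 1)
    (hδ : 0 < δ) (hδ1 : δ ≤ 4 / 5) :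
    EdgeDP (seedLaw n N)
      (fun (G : SimpleGraph (Fin n)) ω => labels G (noiseLevel N ε δ) ω) ε δ := by
  obtain ⟨N, rfl⟩ : ∃ k, N = k + 1 := ⟨N - 1, by omega⟩
  intro G G' h S hS
  set F : (Fin (N + 1) → Vec n) → Fin n → ℝ := fun x i =>
    normalize (x (Fin.last N)) i / |normalize (x (Fin.last N)) i| with hF
  have hFm : Measurable F := by
    have hm := (measurable_normalize (n := n))
    refine measurable_pi_lambda _ fun i => ?_
    have h1 : Measurable fun x : Fin (N + 1) → Vec n => normalize (x (Fin.last N)) i :=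
      (by fun_prop : Measurable fun v : Vec n => v i).comp (hm.comp (measurable_pi_apply _))
    exact h1.div h1.abs
  have hset : ∀ H : SimpleGraph (Fin n),
      {ω : Seed n (N + 1) | labels H (noiseLevel (N + 1) ε δ) ω ∈ S} =
        {ω | transcript H (noiseLevel (N + 1) ε δ) ω ∈ F ⁻¹' S} := by
    intro H; ext ω
    have : labels H (noiseLevel (N + 1) ε δ) ω = F (transcript H (noiseLevel (N + 1) ε δ) ω) := by
      funext i; rw [labels, lastIterate_eq]
    change labels H (noiseLevel (N + 1) ε δ) ω ∈ S ↔ F _ ∈ S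
    rw [this]
  have := edgeDP_transcript (n := n) hN hε hε1 hδ hδ1 G G' h (F ⁻¹' S) (hFm hS)
  simp only [hset]
  exact this

end Privacy
end NoisyPower

namespace NoisyPower

/-! ### Second and exponential moments of Gaussian vectors. -/

section GaussianMoments

variable {E : Type*} [NormedAddCommGroup E] [InnerProductSpace ℝ E] [FiniteDimensional ℝ E]
  [MeasurableSpace E] [BorelSpace E]

lemma memLp_inner_stdGaussian (u : E) : MemLp (fun x => (inner ℝ u x : ℝ)) 2 (stdGaussian E) :=
  IsGaussian.memLp_dual (stdGaussian E) (innerSL ℝ u) 2 (by simp)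

lemma integral_inner_stdGaussian (u : E) : ∫ x, (inner ℝ u x : ℝ) ∂(stdGaussian E) = 0 :=
  integral_strongDual_stdGaussian (innerSL ℝ u)

lemma integral_inner_sq_stdGaussian (u : E) :
    ∫ x, (inner ℝ u x : ℝ) ^ 2 ∂(stdGaussian E) = ‖u‖ ^ 2 := by
  have h := variance_dual_stdGaussian (E := E) (innerSL ℝ u)
  rw [variance_eq_sub (X := innerSL ℝ u) (memLp_inner_stdGaussian u),
    integral_strongDual_stdGaussian, innerSL_apply_norm] at h
  simpa using h

lemma lintegral_add_inner_sq_stdGaussian (u : E) (c h : ℝ) :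
    ∫⁻ x, ENNReal.ofReal ((c + h * inner ℝ u x) ^ 2) ∂(stdGaussian E) =
      ENNReal.ofReal (c ^ 2 + h ^ 2 * ‖u‖ ^ 2) := by
  have h2 := memLp_inner_stdGaussian u
  have h1 : Integrable (fun x => (inner ℝ u x : ℝ)) (stdGaussian E) := h2.integrable (by simp)
  have h3 : Integrable (fun x => (inner ℝ u x : ℝ) ^ 2) (stdGaussian E) := h2.integrable_sq
  have hexp : ∀ x : E, (c + h * inner ℝ u x) ^ 2 =
      c ^ 2 + (2 * c * h) * inner ℝ u x + h ^ 2 * inner ℝ u x ^ 2 := fun x => by ring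
  simp_rw [hexp]
  rw [← ofReal_integral_eq_lintegral_ofReal
    (f := fun x : E => c ^ 2 + (2 * c * h) * inner ℝ u x + h ^ 2 * inner ℝ u x ^ 2)
    (((integrable_const _).add (h1.const_mul _)).add (h3.const_mul _))
    (Filter.Eventually.of_forall fun x => by
      simp only [Pi.zero_apply]; rw [← hexp]; positivity),
    integral_add (f := fun x : E => c ^ 2 + (2 * c * h) * inner ℝ u x)
      ((integrable_const _).add (h1.const_mul _)) (h3.const_mul _),
    integral_add (integrable_const _) (h1.const_mul _), integral_const_mul, integral_const_mul,
    integral_inner_stdGaussian, integral_inner_sq_stdGaussian]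
  simp

lemma lintegral_norm_add_sq_stdGaussian {n : ℕ} (v : Vec n) (h : ℝ) :
    ∫⁻ x, ENNReal.ofReal (‖v + h • x‖ ^ 2) ∂(stdGaussian (Vec n)) =
      ENNReal.ofReal (‖v‖ ^ 2 + h ^ 2 * n) := by
  have h1 : ∀ x : Vec n, ENNReal.ofReal (‖v + h • x‖ ^ 2) = ∑ i, ENNReal.ofReal
      ((v i + h * inner ℝ (EuclideanSpace.basisFun (Fin n) ℝ i) x) ^ 2) := by
    intro x
    rw [← ENNReal.ofReal_sum_of_nonneg (fun i _ => sq_nonneg _), EuclideanSpace.norm_sq_eq]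
    have h2 : ∀ i, inner ℝ (EuclideanSpace.basisFun (Fin n) ℝ i) x = x i := fun i => by
      rw [EuclideanSpace.basisFun_inner]
    simp_rw [h2]; simp
  simp_rw [h1]
  rw [lintegral_finsetSum _ (fun i _ => by fun_prop)]
  simp_rw [lintegral_add_inner_sq_stdGaussian]
  rw [← ENNReal.ofReal_sum_of_nonneg (fun i _ => by positivity), EuclideanSpace.norm_sq_eq,
    Finset.sum_add_distrib]
  simp [mul_comm]

lemma map_inner_stdGaussian (u : E) :
    (stdGaussian E).map (fun x => (inner ℝ u x : ℝ)) =
      (stdGaussian ℝ).map (fun y => ‖u‖ * y) := by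
  refine Measure.ext_of_charFun (funext fun t => ?_)
  rw [charFun_apply, charFun_apply, integral_map (by fun_prop) (by fun_prop),
    integral_map (by fun_prop) (by fun_prop)]
  have h1 := charFun_stdGaussian (E := E) (t • u)
  have h2 := charFun_stdGaussian (E := ℝ) (t * ‖u‖)
  rw [charFun_apply] at h1 h2
  have e1 : ∀ x : E, (inner ℝ (inner ℝ u x : ℝ) t : ℝ) = inner ℝ x (t • u) := by
    intro x; rw [real_inner_smul_right, real_inner_comm u x]; simp
  have e2 : ∀ x : ℝ, (inner ℝ (‖u‖ * x) t : ℝ) = inner ℝ x (t * ‖u‖) := by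
    intro x; simp; ring
  simp_rw [e1, e2]
  rw [h1, h2]
  simp [norm_smul]

lemma stdGaussian_real : stdGaussian ℝ = gaussianReal 0 1 := by
  refine Measure.ext_of_charFun (funext fun t => ?_)
  rw [charFun_stdGaussian, charFun_gaussianReal]
  simp
  norm_cast
  simp [sq_abs, neg_div]

lemma lintegral_exp_abs_inner_le {u : E} (hu : ‖u‖ ≤ 1) (k : ℝ) :
    ∫⁻ x, ENNReal.ofReal (Real.exp (k * |(inner ℝ u x : ℝ)|)) ∂(stdGaussian E) ≤
      ENNReal.ofReal (2 * Real.exp (k ^ 2 / 2)) := by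
  have h : ∀ x : E, ENNReal.ofReal (Real.exp (k * |(inner ℝ u x : ℝ)|)) ≤
      ENNReal.ofReal (Real.exp (inner ℝ (k • u) x)) +
        ENNReal.ofReal (Real.exp (inner ℝ ((-k) • u) x)) := by
    intro x
    rw [real_inner_smul_left, real_inner_smul_left]
    rcases abs_choice (inner ℝ u x : ℝ) with h | h <;> rw [h]
    · exact le_self_add
    · rw [mul_neg, neg_mul]; exact le_add_self
  refine (lintegral_mono h).trans ?_
  rw [lintegral_add_left (by fun_prop), lintegral_exp_inner_stdGaussian,
    lintegral_exp_inner_stdGaussian, ← ENNReal.ofReal_add (by positivity) (by positivity)]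
  refine ENNReal.ofReal_le_ofReal ?_
  have h1 : Real.exp (‖k • u‖ ^ 2 / 2) ≤ Real.exp (k ^ 2 / 2) := by
    rw [norm_smul, mul_pow, Real.norm_eq_abs, sq_abs]
    gcongr
    have : ‖u‖ ^ 2 ≤ 1 := by nlinarith [norm_nonneg u]
    nlinarith [sq_nonneg k]
  have h2 : ‖(-k) • u‖ = ‖k • u‖ := by rw [neg_smul, norm_neg]
  rw [h2]; linarith

lemma lintegral_exp_inner_sq_le {u : E} (hu : ‖u‖ ≤ 1) :
    ∫⁻ x, ENNReal.ofReal (Real.exp ((inner ℝ u x : ℝ) ^ 2 / 4)) ∂(stdGaussian E) ≤ 2 := by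
  have h1 : ∫⁻ x, ENNReal.ofReal (Real.exp ((inner ℝ u x : ℝ) ^ 2 / 4)) ∂(stdGaussian E) =
      ∫⁻ y, ENNReal.ofReal (Real.exp (y ^ 2 / 4))
        ∂((stdGaussian E).map (fun x => (inner ℝ u x : ℝ))) := by
    rw [lintegral_map (by fun_prop) (by fun_prop)]
  rw [h1, map_inner_stdGaussian, lintegral_map (by fun_prop) (by fun_prop)]
  have h2 : ∀ y : ℝ, ENNReal.ofReal (Real.exp ((‖u‖ * y) ^ 2 / 4)) ≤
      ENNReal.ofReal (Real.exp (1 / 4 * ‖y‖ ^ 2)) := by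
    intro y
    refine ENNReal.ofReal_le_ofReal (Real.exp_le_exp.2 ?_)
    rw [Real.norm_eq_abs, sq_abs, mul_pow]
    have : ‖u‖ ^ 2 ≤ 1 := by nlinarith [norm_nonneg u]
    nlinarith [sq_nonneg y]
  refine (lintegral_mono h2).trans ?_
  rw [lintegral_exp_sq_norm_stdGaussian (by norm_num)]
  simp only [Module.finrank_self, Nat.cast_one]
  rw [← ENNReal.ofReal_ofNat 2]
  refine ENNReal.ofReal_le_ofReal ?_
  rw [show (1 - 2 * (1 / 4) : ℝ) = 2⁻¹ by norm_num, Real.inv_rpow (by norm_num),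
    Real.rpow_neg (by norm_num), inv_inv]
  calc (2 : ℝ) ^ (1 / 2 : ℝ) ≤ 2 ^ (1 : ℝ) :=
        Real.rpow_le_rpow_of_exponent_le (by norm_num) (by norm_num)
    _ = 2 := Real.rpow_one 2

/-- The maximum is handled by a soft maximum: each entry has E exp(a²/4) ≤ 2, and the sum over
entries dominates the exponential of the largest. A linear map with rows of norm at most 1 is
allowed because the bound is needed for all powers of the contraction. -/
lemma lintegral_supNorm_sq_le {n : ℕ} [NeZero n] (A : Vec n →ₗ[ℝ] Vec n)
    (hA : ∀ i, ∃ a : Vec n, ‖a‖ ≤ 1 ∧ ∀ x, A x i = inner ℝ a x) :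
    ∫⁻ x, ENNReal.ofReal (supNorm (A x) ^ 2) ∂(stdGaussian (Vec n)) ≤
      ENNReal.ofReal (4 * (Real.log n + 2)) := by
  choose a ha hax using hA
  have hn : (0 : ℝ) < n := by exact_mod_cast Nat.pos_of_ne_zero (NeZero.ne n)
  have hn1 : (1 : ℝ) ≤ n := by exact_mod_cast Nat.pos_of_ne_zero (NeZero.ne n)
  have hlog : 0 ≤ Real.log n := Real.log_nonneg hn1
  have h1 : ∀ x, ENNReal.ofReal (supNorm (A x) ^ 2) ≤ ENNReal.ofReal (4 * Real.log n) +
      ENNReal.ofReal (4 / n) * ∑ i, ENNReal.ofReal (Real.exp ((inner ℝ (a i) x : ℝ) ^ 2 / 4)) := by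
    intro x
    rw [← ENNReal.ofReal_sum_of_nonneg (fun i _ => by positivity),
      ← ENNReal.ofReal_mul (by positivity), ← ENNReal.ofReal_add (by positivity) (by positivity)]
    refine ENNReal.ofReal_le_ofReal ?_
    obtain ⟨i, hi⟩ : ∃ i, supNorm (A x) = |A x i| := by
      obtain ⟨i, -, hi⟩ := Finset.exists_mem_eq_sup (Finset.univ : Finset (Fin n))
        Finset.univ_nonempty (fun i => ‖A x i‖₊)
      refine ⟨i, ?_⟩
      have : ‖(WithLp.ofLp (A x) : Fin n → ℝ)‖₊ = ‖A x i‖₊ := by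
        rw [Pi.nnnorm_def]; exact hi
      exact congrArg NNReal.toReal this
    rw [hi, sq_abs, hax]
    set z := (inner ℝ (a i) x : ℝ) ^ 2 / 4 with hz
    have h2 : Real.exp z ≤ ∑ i, Real.exp ((inner ℝ (a i) x : ℝ) ^ 2 / 4) :=
      Finset.single_le_sum (f := fun i => Real.exp ((inner ℝ (a i) x : ℝ) ^ 2 / 4))
        (fun i _ => by positivity) (Finset.mem_univ i)
    -- This is x + 1 ≤ e^x at x = z - log n. The shift by log n balances the n summands.
    have h3 : z - Real.log n ≤ Real.exp z / n := by
      have := Real.add_one_le_exp (z - Real.log n)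
      rw [Real.exp_sub, Real.exp_log hn] at this
      linarith
    have h4 : Real.exp z / n ≤ (∑ i, Real.exp ((inner ℝ (a i) x : ℝ) ^ 2 / 4)) / n := by gcongr
    have h5 : (inner ℝ (a i) x : ℝ) ^ 2 = 4 * z := by rw [hz]; ring
    rw [h5, show 4 / (n : ℝ) * ∑ i, Real.exp ((inner ℝ (a i) x : ℝ) ^ 2 / 4) =
      4 * ((∑ i, Real.exp ((inner ℝ (a i) x : ℝ) ^ 2 / 4)) / n) by ring]
    linarith
  refine (lintegral_mono h1).trans ?_
  rw [lintegral_add_left measurable_const, lintegral_const, measure_univ, mul_one,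
    lintegral_const_mul _ (by fun_prop), lintegral_finsetSum _ (fun i _ => by fun_prop)]
  have h6 : ∑ i, ∫⁻ x, ENNReal.ofReal (Real.exp ((inner ℝ (a i) x : ℝ) ^ 2 / 4))
      ∂(stdGaussian (Vec n)) ≤ ENNReal.ofReal (2 * n) := by
    refine (Finset.sum_le_sum fun i _ => lintegral_exp_inner_sq_le (ha i)).trans_eq ?_
    simp [mul_comm]
  calc _ ≤ ENNReal.ofReal (4 * Real.log n) + ENNReal.ofReal (4 / n) * ENNReal.ofReal (2 * n) := by
        gcongr
    _ = _ := by
        rw [← ENNReal.ofReal_mul (by positivity), ← ENNReal.ofReal_add (by positivity)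
          (by positivity)]
        congr 1; field_simp

/-- With r = √n, the tangent bound ‖x‖ ≤ r/2 + ‖x‖²/(2r) reduces the claim to the chi-square moment.
The linear terms cancel, and log(1 - y) ≥ -y - 2y² for y = h/r ≤ 1/2 leaves h². The norm thus
fluctuates around √n by O(1), uniformly in n. -/
lemma lintegral_exp_norm_sub_le {n : ℕ} {h : ℝ} (hh : 0 ≤ h) (hn : 2 * h ≤ √n) (hn1 : 1 ≤ n) :
    ∫⁻ x, ENNReal.ofReal (Real.exp (h * (‖x‖ - √n))) ∂(stdGaussian (Vec n)) ≤
      ENNReal.ofReal (Real.exp (h ^ 2)) := by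
  have hn0 : (0 : ℝ) < n := by exact_mod_cast hn1
  have hr : 0 < √(n : ℝ) := Real.sqrt_pos.2 hn0
  have hr2 : √(n : ℝ) ^ 2 = n := Real.sq_sqrt hn0.le
  set r := √(n : ℝ) with hrdef
  have hl : h / (2 * r) < 1 / 2 := by
    rw [div_lt_iff₀ (by positivity)]; linarith
  have h1 : ∀ x : Vec n, ENNReal.ofReal (Real.exp (h * (‖x‖ - r))) ≤
      ENNReal.ofReal (Real.exp (-(h * r / 2))) *
        ENNReal.ofReal (Real.exp (h / (2 * r) * ‖x‖ ^ 2)) := by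
    intro x
    rw [← ENNReal.ofReal_mul (by positivity), ← Real.exp_add]
    refine ENNReal.ofReal_le_ofReal (Real.exp_le_exp.2 ?_)
    have : ‖x‖ - r ≤ -(r / 2) + 1 / (2 * r) * ‖x‖ ^ 2 := by
      rw [← sub_nonneg]
      have : -(r / 2) + 1 / (2 * r) * ‖x‖ ^ 2 - (‖x‖ - r) = (‖x‖ - r) ^ 2 / (2 * r) := by
        field_simp; ring
      rw [this]; positivity
    calc h * (‖x‖ - r) ≤ h * (-(r / 2) + 1 / (2 * r) * ‖x‖ ^ 2) := by gcongr
      _ = _ := by ring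
  refine (lintegral_mono h1).trans ?_
  rw [lintegral_const_mul _ (by fun_prop), lintegral_exp_sq_norm_stdGaussian hl,
    ← ENNReal.ofReal_mul (by positivity)]
  refine ENNReal.ofReal_le_ofReal ?_
  have hx0 : 0 ≤ h / r := by positivity
  have hx : h / r ≤ 1 / 2 := by rw [div_le_iff₀ hr]; linarith
  have hpos : 0 < 1 - h / r := by linarith
  rw [show 1 - 2 * (h / (2 * r)) = 1 - h / r by field_simp, Real.rpow_def_of_pos hpos,
    ← Real.exp_add]
  refine Real.exp_le_exp.2 ?_
  have hlog : -(h / r) - 2 * (h / r) ^ 2 ≤ Real.log (1 - h / r) := by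
    refine le_trans ?_ (Real.one_sub_inv_le_log_of_pos hpos)
    rw [le_sub_iff_add_le, ← le_sub_iff_add_le', inv_le_iff_one_le_mul₀ hpos]
    nlinarith [mul_nonneg (sq_nonneg (h / r)) (show 0 ≤ 1 - 2 * (h / r) by linarith)]
  have hfr : (Module.finrank ℝ (Vec n) : ℝ) = r ^ 2 := by rw [hr2]; simp
  rw [hfr]
  have : Real.log (1 - h / r) * -(r ^ 2 / 2) ≤ (-(h / r) - 2 * (h / r) ^ 2) * -(r ^ 2 / 2) := by
    nlinarith [sq_nonneg r]
  refine (add_le_add_right this _).trans_eq ?_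
  field_simp
  ring

end GaussianMoments
end NoisyPower

namespace NoisyPower

/-! ### Anti-concentration along a direction and lower bounds for the largest entry. -/

section AntiConcentration

/-- The component `(I - u uᵀ) x` of `x` orthogonal to the unit vector `u`. -/
noncomputable def perp {n : ℕ} (u x : Vec n) : Vec n := x - (inner ℝ u x : ℝ) • u

lemma measurable_perp {n : ℕ} (u : Vec n) : Measurable (perp u) := by
  unfold perp; fun_prop

lemma inner_perp {n : ℕ} {u : Vec n} (hu : ‖u‖ = 1) (x : Vec n) : (inner ℝ u (perp u x) : ℝ) = 0 := by
  rw [perp, inner_sub_right, real_inner_smul_right, real_inner_self_eq_norm_sq, hu]; ring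

lemma inner_perp_symm {n : ℕ} (u x y : Vec n) :
    (inner ℝ x (perp u y) : ℝ) = inner ℝ (perp u x) y := by
  simp only [perp, inner_sub_right, inner_sub_left, real_inner_smul_right, real_inner_smul_left]
  rw [real_inner_comm u x]; ring

/-- The pair is jointly Gaussian, so vanishing covariance suffices. -/
lemma indepFun_inner_perp {n : ℕ} {u : Vec n} (hu : ‖u‖ = 1) :
    IndepFun (fun x : Vec n => (inner ℝ u x : ℝ)) (perp u) (stdGaussian (Vec n)) := by
  have hg : HasGaussianLaw (fun x : Vec n => ((inner ℝ u x : ℝ), perp u x)) (stdGaussian (Vec n)) := by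
    have h := (IsGaussian.hasGaussianLaw_id (μ := stdGaussian (Vec n))).map_of_measurable
      ((innerSL ℝ u).prod (ContinuousLinearMap.id ℝ (Vec n) - (innerSL ℝ u).smulRight u))
      (ContinuousLinearMap.measurable _)
    exact h
  refine hg.indepFun_of_covariance_inner fun a y => ?_
  have h1 : (fun x : Vec n => (inner ℝ a (inner ℝ u x : ℝ) : ℝ)) = fun x => inner ℝ (a • u) x := by
    funext x; rw [real_inner_smul_left]; simp [mul_comm]
  have h2 : (fun x : Vec n => (inner ℝ y (perp u x) : ℝ)) = fun x => inner ℝ (perp u y) x := by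
    funext x; rw [inner_perp_symm]
  rw [h1, h2, ← covarianceBilin_apply_eq_cov (IsGaussian.memLp_two_id), covarianceBilin_stdGaussian]
  rw [innerSL_apply_apply, real_inner_smul_left, inner_perp hu, mul_zero]

lemma gaussianReal_Icc_le (c k : ℝ) :
    gaussianReal 0 1 {a | |a + c| ≤ k} ≤ ENNReal.ofReal k := by
  rw [gaussianReal_apply 0 one_ne_zero]
  have h1 : ∀ x : ℝ, gaussianPDF 0 1 x ≤ ENNReal.ofReal (1 / 2) := by
    intro x
    refine ENNReal.ofReal_le_ofReal ?_
    rw [gaussianPDFReal]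
    have h2 : (2 : ℝ) ≤ √(2 * Real.pi * (1 : NNReal)) := by
      refine Real.le_sqrt_of_sq_le ?_
      simp; nlinarith [Real.pi_gt_three]
    have h3 : (√(2 * Real.pi * (1 : NNReal)))⁻¹ ≤ 1 / 2 := by
      rw [one_div]; exact inv_anti₀ (by norm_num) h2
    have h4 : Real.exp (-(x - 0) ^ 2 / (2 * (1 : NNReal))) ≤ 1 := by
      rw [Real.exp_le_one_iff]
      exact div_nonpos_of_nonpos_of_nonneg (by nlinarith [sq_nonneg (x - 0)]) (by simp)
    calc _ ≤ (1 / 2 : ℝ) * 1 := by gcongr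
      _ = _ := by norm_num
  have hset : {a : ℝ | |a + c| ≤ k} = Set.Icc (-c - k) (-c + k) := by
    ext a; simp only [Set.mem_ofPred_eq, abs_le, Set.mem_Icc]
    constructor <;> rintro ⟨h1, h2⟩ <;> constructor <;> linarith
  calc _ ≤ ∫⁻ _ in {a : ℝ | |a + c| ≤ k}, ENNReal.ofReal (1 / 2) := lintegral_mono fun x => h1 x
    _ = ENNReal.ofReal k := by
      rw [setLIntegral_const, hset, Real.volume_Icc, ← ENNReal.ofReal_mul (by norm_num)]
      congr 1; ring

/-- Given the orthogonal part, the sum is a shifted scalar standard Gaussian. Its density is at most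
1/2, and the interval has length 2k. The shift m may be any measurable function of the orthogonal
part. -/
theorem stdGaussian_abs_inner_add_le {n : ℕ} {u : Vec n} (hu : ‖u‖ = 1) {m : Vec n → ℝ}
    (hm : Measurable m) (k : ℝ) :
    stdGaussian (Vec n) {x | |(inner ℝ u x : ℝ) + m (perp u x)| ≤ k} ≤ ENNReal.ofReal k := by
  have hind := (indepFun_iff_map_prod_eq_prod_map_map (by fun_prop)
    (measurable_perp u).aemeasurable).1 (indepFun_inner_perp hu)
  have hlaw : (stdGaussian (Vec n)).map (fun x => (inner ℝ u x : ℝ)) = gaussianReal 0 1 := by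
    rw [map_inner_stdGaussian, hu, ← stdGaussian_real]; simp
  have hS : MeasurableSet {p : ℝ × Vec n | |p.1 + m p.2| ≤ k} :=
    measurableSet_le (by fun_prop) measurable_const
  have h1 : stdGaussian (Vec n) {x | |(inner ℝ u x : ℝ) + m (perp u x)| ≤ k} =
      ((stdGaussian (Vec n)).map (fun x => ((inner ℝ u x : ℝ), perp u x)))
        {p : ℝ × Vec n | |p.1 + m p.2| ≤ k} := by
    rw [Measure.map_apply (Measurable.prodMk (by fun_prop) (measurable_perp u)) hS]; rfl
  have : IsProbabilityMeasure ((stdGaussian (Vec n)).map (perp u)) :=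
    Measure.isProbabilityMeasure_map (measurable_perp u).aemeasurable
  rw [h1, hind, hlaw, Measure.prod_apply_symm hS]
  calc _ ≤ ∫⁻ _, ENNReal.ofReal k ∂((stdGaussian (Vec n)).map (perp u)) :=
        lintegral_mono fun y => gaussianReal_Icc_le (m y) k
    _ = _ := by rw [lintegral_const, measure_univ, mul_one]

lemma gaussianReal_Ici_ge {t : ℝ} (ht : 0 ≤ t) :
    ENNReal.ofReal (Real.exp (-(t + 1) ^ 2 / 2) / 3) ≤ gaussianReal 0 1 (Set.Ici t) := by
  have h0 : gaussianReal 0 1 (Set.Icc t (t + 1)) ≤ gaussianReal 0 1 (Set.Ici t) :=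
    measure_mono Set.Icc_subset_Ici_self
  refine le_trans ?_ h0
  rw [gaussianReal_apply 0 one_ne_zero]
  have h1 : ∀ x ∈ Set.Icc t (t + 1), ENNReal.ofReal (Real.exp (-(t + 1) ^ 2 / 2) / 3) ≤
      gaussianPDF 0 1 x := by
    intro x hx
    refine ENNReal.ofReal_le_ofReal ?_
    rw [gaussianPDFReal, div_eq_inv_mul]
    have h2 : √(2 * Real.pi * (1 : NNReal)) ≤ 3 := by
      refine Real.sqrt_le_iff.2 ⟨by norm_num, ?_⟩
      simp; nlinarith [Real.pi_lt_four]
    have h3 : 0 < √(2 * Real.pi * (1 : NNReal)) := Real.sqrt_pos.2 (by simp; positivity)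
    have h4 : x ^ 2 ≤ (t + 1) ^ 2 := by
      have := hx.1; have := hx.2
      gcongr
      linarith
    refine mul_le_mul (inv_anti₀ h3 h2) (Real.exp_le_exp.2 ?_) (Real.exp_pos _).le (by positivity)
    simp only [sub_zero, NNReal.coe_one, mul_one]
    linarith
  calc _ = ∫⁻ _ in Set.Icc t (t + 1), ENNReal.ofReal (Real.exp (-(t + 1) ^ 2 / 2) / 3) := by
        rw [setLIntegral_const, Real.volume_Icc]; simp
    _ ≤ _ := setLIntegral_mono (measurable_gaussianPDF 0 1) h1

/-- A deterministic shift cannot help to stay small: by the sign of m, either the upper or the lower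
tail of a is excluded. -/
lemma gaussianReal_abs_add_mul_lt_le (m : ℝ) {h t : ℝ} (hh : 0 < h) :
    gaussianReal 0 1 {a | |m + h * a| < h * t} ≤ 1 - gaussianReal 0 1 (Set.Ici t) := by
  have hsymm : gaussianReal 0 1 (Set.Iic (-t)) = gaussianReal 0 1 (Set.Ici t) := by
    have h1 := gaussianReal_map_neg (μ := 0) (v := 1)
    rw [neg_zero] at h1
    conv_rhs => rw [← h1]
    rw [Measure.map_apply measurable_neg measurableSet_Ici]
    simp
  rcases le_total 0 m with hm | hm
  · rw [← prob_compl_eq_one_sub measurableSet_Ici]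
    refine measure_mono fun a ha => ?_
    simp only [Set.mem_ofPred_eq, abs_lt] at ha
    simp only [Set.mem_compl_iff, Set.mem_Ici, not_le]
    nlinarith [ha.2]
  · rw [← hsymm, ← prob_compl_eq_one_sub measurableSet_Iic]
    refine measure_mono fun a ha => ?_
    simp only [Set.mem_ofPred_eq, abs_lt] at ha
    simp only [Set.mem_compl_iff, Set.mem_Iic, not_le]
    nlinarith [ha.1]

/-- A lower bound in probability for the largest entry of a Gaussian vector. -/
theorem stdGaussian_supNorm_lt_le {n : ℕ} (m : Vec n) {h t : ℝ} (hh : 0 < h) (ht : 0 ≤ t) :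
    stdGaussian (Vec n) {x | supNorm (m + h • x) < h * t} ≤
      ENNReal.ofReal (Real.exp (-(n * (Real.exp (-(t + 1) ^ 2 / 2) / 3)))) := by
  set p := Real.exp (-(t + 1) ^ 2 / 2) / 3 with hp
  have hp1 : p ≤ 1 := by
    have : Real.exp (-(t + 1) ^ 2 / 2) ≤ 1 := by
      rw [Real.exp_le_one_iff]
      have : 0 ≤ (t + 1) ^ 2 := sq_nonneg _
      linarith
    rw [hp]; linarith
  rw [← map_pi_eq_stdGaussian, Measure.map_apply (by fun_prop) (measurableSet_lt (by
    exact continuous_supNorm.measurable.comp (by fun_prop)) measurable_const)]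
  -- A small sup norm confines every coordinate. Independence then gives (1 - p)^n ≤ e^(-np).
  have hsub : (WithLp.toLp 2 ⁻¹' {x : Vec n | supNorm (m + h • x) < h * t} : Set (Fin n → ℝ)) ⊆
      Set.univ.pi fun i => {a | |m i + h * a| < h * t} := by
    intro x hx i _
    exact (abs_apply_le_supNorm (m + h • WithLp.toLp 2 x) i).trans_lt hx
  refine (measure_mono hsub).trans ?_
  rw [Measure.pi_pi]
  calc _ ≤ ∏ _i : Fin n, ENNReal.ofReal (Real.exp (-p)) := by
        refine Finset.prod_le_prod' fun i _ => (gaussianReal_abs_add_mul_lt_le (m i) hh).trans ?_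
        calc _ ≤ 1 - ENNReal.ofReal p := tsub_le_tsub_left (gaussianReal_Ici_ge ht) 1
          _ = ENNReal.ofReal (1 - p) := by
            rw [ENNReal.ofReal_sub _ (by positivity), ENNReal.ofReal_one]
          _ ≤ _ := ENNReal.ofReal_le_ofReal (Real.one_sub_le_exp_neg p)
    _ = _ := by
        rw [Finset.prod_const, Finset.card_univ, Fintype.card_fin, ← ENNReal.ofReal_pow
          (by positivity), ← Real.exp_nat_mul]
        ring_nf

end AntiConcentration

/-! ### Independent Gaussian sequences and integration over one member. -/

section GaussianSequence

/-- A sequence of independent standard Gaussian vectors. -/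
structure GaussianSeq {n : ℕ} {Ω : Type*} [MeasurableSpace Ω] (P : Measure Ω)
    (g : ℕ → Ω → Vec n) : Prop where
  meas : ∀ t, Measurable (g t)
  indep : iIndepFun g P
  law : ∀ t, P.map (g t) = stdGaussian (Vec n)

/-- The σ-algebra generated by the members of a sequence with index in `T`. -/
@[reducible] def sigmaOf {n : ℕ} {Ω : Type*} (g : ℕ → Ω → Vec n) (T : Set ℕ) : MeasurableSpace Ω :=
  ⨆ k ∈ T, MeasurableSpace.comap (g k) inferInstance

lemma measurable_sigmaOf {n : ℕ} {Ω : Type*} (g : ℕ → Ω → Vec n) {T : Set ℕ} {k : ℕ} (hk : k ∈ T) :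
    Measurable[sigmaOf g T] (g k) :=
  (comap_measurable (g k)).mono (le_biSup (fun k => MeasurableSpace.comap (g k) _) hk) le_rfl

variable {n : ℕ} {Ω : Type*} [mΩ : MeasurableSpace Ω] {P : Measure Ω} {g : ℕ → Ω → Vec n}

lemma sigmaOf_le (hg : GaussianSeq P g) (T : Set ℕ) : sigmaOf g T ≤ mΩ :=
  iSup₂_le fun k _ => (hg.meas k).comap_le

lemma GaussianSeq.isProbabilityMeasure (hg : GaussianSeq P g) : IsProbabilityMeasure P :=
  hg.indep.isProbabilityMeasure

/-- A random variable that depends on other members of the sequence only may be frozen when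
integrating over one member. -/
theorem GaussianSeq.lintegral_freeze (hg : GaussianSeq P g) {T : Set ℕ} {j : ℕ} (hj : j ∉ T)
    {X : Type*} [MeasurableSpace X] {Z : Ω → X} (hZ : Measurable[sigmaOf g T] Z)
    {Φ : X × Vec n → ENNReal} (hΦ : Measurable Φ) :
    ∫⁻ ω, Φ (Z ω, g j ω) ∂P = ∫⁻ ω, ∫⁻ x, Φ (Z ω, x) ∂(stdGaussian (Vec n)) ∂P := by
  have := hg.isProbabilityMeasure
  have hZ' : Measurable Z := hZ.mono (sigmaOf_le hg T) le_rfl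
  have hindep : IndepFun Z (g j) P := by
    have h1 : Indep (⨆ k ∈ T, MeasurableSpace.comap (g k) inferInstance)
        (⨆ k ∈ ({j} : Set ℕ), MeasurableSpace.comap (g k) inferInstance) P :=
      indep_iSup_of_disjoint (fun k => (hg.meas k).comap_le) hg.indep
        (Set.disjoint_singleton_right.2 hj)
    rw [iSup_singleton] at h1
    exact indep_of_indep_of_le_left h1 hZ.comap_le
  have h2 := (indepFun_iff_map_prod_eq_prod_map_map hZ'.aemeasurable
    (hg.meas j).aemeasurable).1 hindep
  have : IsProbabilityMeasure (P.map Z) := Measure.isProbabilityMeasure_map hZ'.aemeasurable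
  rw [← lintegral_map (f := Φ) (g := fun ω => (Z ω, g j ω)) hΦ (hZ'.prodMk (hg.meas j)), h2, hg.law,
    lintegral_prod _ hΦ.aemeasurable, lintegral_map (hΦ.lintegral_prod_right') hZ']

lemma GaussianSeq.lintegral_comp (hg : GaussianSeq P g) (t : ℕ) {f : Vec n → ENNReal}
    (hf : Measurable f) : ∫⁻ ω, f (g t ω) ∂P = ∫⁻ x, f x ∂(stdGaussian (Vec n)) := by
  rw [← hg.law t, lintegral_map hf (hg.meas t)]

lemma GaussianSeq.measure_freeze_le (hg : GaussianSeq P g) {T : Set ℕ} {j : ℕ} (hj : j ∉ T)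
    {X : Type*} [MeasurableSpace X] {Z : Ω → X} (hZ : Measurable[sigmaOf g T] Z)
    {S : Set (X × Vec n)} (hS : MeasurableSet S) {c : ENNReal}
    (hc : ∀ z, stdGaussian (Vec n) {x | (z, x) ∈ S} ≤ c) : P {ω | (Z ω, g j ω) ∈ S} ≤ c := by
  have := hg.isProbabilityMeasure
  have hZ' : Measurable Z := hZ.mono (sigmaOf_le hg T) le_rfl
  have h1 := hg.lintegral_freeze hj hZ (Φ := S.indicator 1) (measurable_one.indicator hS)
  have h2 : P {ω | (Z ω, g j ω) ∈ S} = ∫⁻ ω, S.indicator 1 (Z ω, g j ω) ∂P := by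
    exact (lintegral_indicator_one (μ := P) ((hZ'.prodMk (hg.meas j)) hS)).symm
  rw [h2, h1]
  calc _ ≤ ∫⁻ _, c ∂P := by
        refine lintegral_mono fun ω => ?_
        refine le_trans (le_of_eq ?_) (hc (Z ω))
        exact lintegral_indicator_one (μ := stdGaussian (Vec n)) (measurable_prodMk_left hS)
    _ = c := by simp

end GaussianSequence
end NoisyPower

namespace NoisyPower

/-! ### The homogeneous noisy contraction and its one-step inequalities. -/

section NoisyContraction

/-- The recursion `w_{t+1} = S w_t + h_t(w_t) z_t`. -/
noncomputable def noisySeq {n : ℕ} (S : Vec n →L[ℝ] Vec n) (h : ℕ → Vec n → ℝ) (x : Vec n)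
    (z : ℕ → Vec n) : ℕ → Vec n
  | 0 => x
  | t + 1 => S (noisySeq S h x z t) + h t (noisySeq S h x z t) • z t

/-- A linear contraction with fixed unit vector `u` that contracts the orthogonal complement of `u`
by the factor `1 - p`. -/
structure IsPowerMap {n : ℕ} (S : Vec n →L[ℝ] Vec n) (u : Vec n) (p : ℝ) : Prop where
  norm_fixed : ‖u‖ = 1
  pos : 0 < p
  le_one : p ≤ 1
  map_fixed : S u = u
  inner_map : ∀ x, (inner ℝ u (S x) : ℝ) = inner ℝ u x
  norm_map_le : ∀ x, (inner ℝ u x : ℝ) = 0 → ‖S x‖ ≤ (1 - p) * ‖x‖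

lemma norm_sq_eq_inner_sq_add {n : ℕ} {u : Vec n} (hu : ‖u‖ = 1) (x : Vec n) :
    ‖x‖ ^ 2 = (inner ℝ u x : ℝ) ^ 2 + ‖perp u x‖ ^ 2 := by
  rw [perp, norm_sub_sq_real, norm_smul, hu, real_inner_smul_right, real_inner_comm, mul_one,
    Real.norm_eq_abs, sq_abs]
  ring

lemma norm_perp_le {n : ℕ} {u : Vec n} (hu : ‖u‖ = 1) (x : Vec n) : ‖perp u x‖ ≤ ‖x‖ := by
  refine (pow_le_pow_iff_left₀ (norm_nonneg _) (norm_nonneg _) two_ne_zero).1 ?_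
  linarith [norm_sq_eq_inner_sq_add hu x, sq_nonneg (inner ℝ u x : ℝ)]

lemma perp_add {n : ℕ} (u x y : Vec n) : perp u (x + y) = perp u x + perp u y := by
  simp only [perp, inner_add_right, add_smul]; abel

lemma perp_smul {n : ℕ} (u x : Vec n) (a : ℝ) : perp u (a • x) = a • perp u x := by
  simp only [perp, real_inner_smul_right, smul_sub, smul_smul]

lemma IsPowerMap.perp_map {n : ℕ} {S : Vec n →L[ℝ] Vec n} {u : Vec n} {p : ℝ}
    (hS : IsPowerMap S u p) (x : Vec n) : perp u (S x) = S (perp u x) := by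
  rw [perp, perp, map_sub, map_smul, hS.map_fixed, hS.inner_map]

lemma IsPowerMap.norm_perp_map_le {n : ℕ} {S : Vec n →L[ℝ] Vec n} {u : Vec n} {p : ℝ}
    (hS : IsPowerMap S u p) (x : Vec n) : ‖perp u (S x)‖ ≤ (1 - p) * ‖perp u x‖ := by
  rw [hS.perp_map]; exact hS.norm_map_le _ (inner_perp hS.norm_fixed x)

lemma IsPowerMap.norm_apply_le {n : ℕ} {S : Vec n →L[ℝ] Vec n} {u : Vec n} {p : ℝ}
    (hS : IsPowerMap S u p) (x : Vec n) : ‖S x‖ ≤ ‖x‖ := by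
  have h1 := norm_sq_eq_inner_sq_add hS.norm_fixed x
  have h2 := norm_sq_eq_inner_sq_add hS.norm_fixed (S x)
  have h3 := hS.norm_perp_map_le x
  have h4 : ‖perp u (S x)‖ ≤ ‖perp u x‖ := by nlinarith [hS.pos, norm_nonneg (perp u x)]
  rw [hS.inner_map] at h2
  have h5 := pow_le_pow_left₀ (norm_nonneg _) h4 2
  exact (pow_le_pow_iff_left₀ (norm_nonneg _) (norm_nonneg _) two_ne_zero).1 (by linarith)

/-- The noise scale of one step, homogeneous in the current vector. -/
noncomputable def noiseScale {n : ℕ} (τ : ℝ) (w : Vec n) : ℝ := τ * (supNorm w + ‖w‖ / n)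

/-- The noise scale, capped at a multiple `k` of the norm from the second step on. -/
noncomputable def cappedScale {n : ℕ} (τ k : ℝ) (t : ℕ) (w : Vec n) : ℝ :=
  -- The maximum in R runs over t ≥ 1, so R ≤ θ says nothing about y_0 and the first step must stay
  -- uncapped.
  if t = 0 then noiseScale τ w else min (noiseScale τ w) (k * ‖w‖)

lemma supNorm_smul {n : ℕ} (a : ℝ) (x : Vec n) : supNorm (a • x) = |a| * supNorm x := by
  rw [supNorm, WithLp.ofLp_smul, norm_smul, Real.norm_eq_abs]; rfl

lemma noiseScale_nonneg {n : ℕ} {τ : ℝ} (hτ : 0 ≤ τ) (w : Vec n) : 0 ≤ noiseScale τ w :=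
  mul_nonneg hτ (add_nonneg (supNorm_nonneg w) (by positivity))

lemma cappedScale_nonneg {n : ℕ} {τ k : ℝ} (hτ : 0 ≤ τ) (hk : 0 ≤ k) (t : ℕ) (w : Vec n) :
    0 ≤ cappedScale τ k t w := by
  unfold cappedScale
  split_ifs
  · exact noiseScale_nonneg hτ w
  · exact le_min (noiseScale_nonneg hτ w) (by positivity)

lemma cappedScale_le_noiseScale {n : ℕ} (τ k : ℝ) (t : ℕ) (w : Vec n) :
    cappedScale τ k t w ≤ noiseScale τ w := by
  unfold cappedScale
  split_ifs
  · exact le_rfl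
  · exact min_le_left _ _

lemma cappedScale_le {n : ℕ} (τ k : ℝ) {t : ℕ} (ht : t ≠ 0) (w : Vec n) :
    cappedScale τ k t w ≤ k * ‖w‖ := by
  rw [cappedScale, if_neg ht]; exact min_le_right _ _

lemma noiseScale_eq {n : ℕ} (τ : ℝ) {w : Vec n} (hw : w ≠ 0) :
    noiseScale τ w = ‖w‖ * (τ * (supNorm (normalize w) + 1 / n)) := by
  have : ‖w‖ ≠ 0 := norm_ne_zero_iff.2 hw
  rw [normalize, supNorm_smul, noiseScale, abs_of_nonneg (by positivity)]
  field_simp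

/-- The ratio of the orthogonal part to the aligned part stays below a fixed level. -/
lemma ratio_step {v m v' m' h c K p gn gu : ℝ} (hv : 0 ≤ v) (hm : 0 < m) (hvK : v ≤ K * m)
    (hh : h ≤ c * √(m ^ 2 + v ^ 2)) (hv' : v' ≤ (1 - p) * v + h * gn)
    (hm' : m - h * gu ≤ m') (hc : 0 ≤ c) (hp1 : p ≤ 1) (hgu : 0 ≤ gu)
    (hgn : gu ≤ gn) (hK : 0 < K) (hcK : c * (gn + K * gu) * √(1 + K ^ 2) ≤ p * K) :
    h ≤ c * √(1 + K ^ 2) * m ∧ 0 < m' ∧ v' ≤ K * m' := by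
  have h1 : √(m ^ 2 + v ^ 2) ≤ √(1 + K ^ 2) * m := by
    refine Real.sqrt_le_iff.2 ⟨by positivity, ?_⟩
    rw [mul_pow, Real.sq_sqrt (by positivity)]
    nlinarith [pow_le_pow_left₀ hv hvK 2]
  have h2 : h ≤ c * √(1 + K ^ 2) * m := hh.trans (by rw [mul_assoc]; gcongr)
  have hs : 0 < √(1 + K ^ 2) := Real.sqrt_pos.2 (by positivity)
  have h3 : h * gu ≤ c * √(1 + K ^ 2) * m * gu := by gcongr
  have h4 : h * gn ≤ c * √(1 + K ^ 2) * m * gn := by gcongr; linarith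
  refine ⟨h2, ?_, ?_⟩
  · have h5 : c * √(1 + K ^ 2) * gu * (1 + K) ≤ p * K := by
      refine le_trans ?_ hcK
      have : c * √(1 + K ^ 2) * gu ≤ c * √(1 + K ^ 2) * gn := by gcongr
      nlinarith
    -- Otherwise h5 would give 1 + K ≤ p K ≤ K. The aligned part therefore keeps its sign.
    have h6 : c * √(1 + K ^ 2) * gu < 1 := by
      by_contra hcon
      rw [not_lt] at hcon
      nlinarith
    nlinarith
  · have h5 : (1 - p) * v ≤ (1 - p) * (K * m) := by gcongr
    have h6 := mul_le_mul_of_nonneg_left h3 hK.le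
    have h7 := mul_le_mul_of_nonneg_right hcK hm.le
    have h8 := mul_le_mul_of_nonneg_left hm' hK.le
    linarith

/-- One step of the excess of the ratio over the target `T`, measured in units of `c √(1 + T²)`. -/
lemma excess_step {v m v' m' h c K p gn gu T b χ e e' : ℝ} (hv : 0 ≤ v) (hm : 0 < m)
    (hm'0 : 0 < m') (hK : 0 ≤ K) (hv'0 : 0 ≤ v')
    (hhK : h ≤ c * √(1 + K ^ 2) * m) (hv'K : v' ≤ K * m')
    (hh : h ≤ c * √(m ^ 2 + v ^ 2)) (hv' : v' ≤ (1 - p) * v + h * gn)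
    (hm' : m - h * gu ≤ m') (hc : 0 ≤ c) (hp1 : p ≤ 1) (hgu : 0 ≤ gu) (hgn : 0 ≤ gn)
    (hT : 0 ≤ T) (hb : c * b * √(1 + T ^ 2) = p * T) (he : 0 ≤ e)
    (hve : v ≤ (T + c * √(1 + T ^ 2) * e) * m) (hχ : 1 - p + c * gn ≤ χ)
    (he' : χ * e + (gn + K * √(1 + K ^ 2) * gu - b) ≤ e') :
    v' ≤ (T + c * √(1 + T ^ 2) * e') * m' := by
  set s := √(1 + T ^ 2) with hs
  set k := √(1 + K ^ 2) with hk
  have hs1 : 1 ≤ s := Real.one_le_sqrt.2 (by nlinarith)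
  have hs2 : s ^ 2 = 1 + T ^ 2 := Real.sq_sqrt (by positivity)
  have hTs : T ≤ s := by nlinarith
  have hk0 : 0 ≤ k := Real.sqrt_nonneg _
  set D := c * s * e with hD
  have hD0 : 0 ≤ D := by positivity
  -- The map T ↦ √(1 + T²) is 1-Lipschitz, so an excess D of the ratio costs at most D in the norm.
  have h1 : √(m ^ 2 + v ^ 2) ≤ (s + D) * m := by
    refine Real.sqrt_le_iff.2 ⟨by positivity, ?_⟩
    have h2 := pow_le_pow_left₀ hv hve 2
    have h3 : 1 + (T + D) ^ 2 ≤ (s + D) ^ 2 := by nlinarith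
    nlinarith [mul_le_mul_of_nonneg_right h3 (sq_nonneg m)]
  have h2 : h * gn ≤ c * ((s + D) * m) * gn := by
    have := hh.trans (mul_le_mul_of_nonneg_left h1 hc)
    gcongr
  have h3 : v' ≤ m * ((1 - p) * (T + D) + c * (s + D) * gn) := by
    have : (1 - p) * v ≤ (1 - p) * ((T + D) * m) := by gcongr
    linarith
  have h4 : h * gu ≤ c * k * m * gu := by gcongr
  set r := v' / m' with hr
  have hrv : v' = r * m' := by rw [hr]; field_simp
  have hr0 : 0 ≤ r := by positivity
  have hrK : r ≤ K := by rw [hr, div_le_iff₀ hm'0]; exact hv'K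
  -- The loss h·gu of the aligned part is multiplied by the new ratio r, for which the a priori
  -- bound K is good enough.
  have h5 : r * m ≤ v' + K * (c * k * m * gu) := by
    have h6 : r * (m - h * gu) ≤ v' := by rw [hrv]; gcongr
    have h7 : r * (h * gu) ≤ r * (c * k * m * gu) := by gcongr
    have h8 : r * (c * k * m * gu) ≤ K * (c * k * m * gu) := by gcongr
    linarith
  have h6 : r ≤ (1 - p) * (T + D) + c * (s + D) * gn + K * k * c * gu := by
    refine le_of_mul_le_mul_right (h5.trans (?_ : _ ≤ _ * m)) hm
    linarith
  -- By `hb`, T is balanced at noise level b: (1 - p) T + c s gn = T + c s (gn - b). So only the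
  -- deviation of gn from b drives the excess.
  have h7 : (1 - p) * (T + D) + c * (s + D) * gn + K * k * c * gu ≤ T + c * s * e' := by
    have h8 : (1 - p + c * gn) * D ≤ χ * D := by gcongr
    have h9 : K * k * c * gu ≤ c * s * (K * k * gu) := by
      have : 0 ≤ K * k * c * gu := by positivity
      have h13 := mul_nonneg this (sub_nonneg.2 hs1)
      linear_combination h13
    have h10 := mul_le_mul_of_nonneg_left he' (show 0 ≤ c * s by positivity)
    have h11 : χ * D = c * s * (χ * e) := by rw [hD]; ring
    linear_combination h8 + h9 + h10 + h11 + hb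
  rw [hrv]
  gcongr
  exact h6.trans h7

/-- The workload recursion `ℓ_{t+1} = (ℓ_t + ξ_t - s)⁺`. -/
noncomputable def lindley (s : ℝ) (ξ : ℕ → ℝ) : ℕ → ℝ
  | 0 => 0
  | t + 1 => max (lindley s ξ t + ξ t - s) 0

lemma lindley_nonneg (s : ℝ) (ξ : ℕ → ℝ) (t : ℕ) : 0 ≤ lindley s ξ t := by
  cases t with
  | zero => exact le_rfl
  | succ t => exact le_max_right _ _

/-- These two inequalities reduce the vector recursion to the scalars v = ‖perp‖ and m = |⟨u, ·⟩| of
`ratio_step` and `excess_step`. -/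
lemma noisySeq_step {n : ℕ} {S : Vec n →L[ℝ] Vec n} {u : Vec n} {p : ℝ} (hS : IsPowerMap S u p)
    {h : ℕ → Vec n → ℝ} (hh : ∀ t w, 0 ≤ h t w) (x : Vec n) (z : ℕ → Vec n) (t : ℕ) :
    ‖perp u (noisySeq S h x z (t + 1))‖ ≤
      (1 - p) * ‖perp u (noisySeq S h x z t)‖ + h t (noisySeq S h x z t) * ‖z t‖ ∧
    |(inner ℝ u (noisySeq S h x z t) : ℝ)| - h t (noisySeq S h x z t) * |(inner ℝ u (z t) : ℝ)| ≤
      |(inner ℝ u (noisySeq S h x z (t + 1)) : ℝ)| := by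
  set w := noisySeq S h x z t with hw
  have h1 : noisySeq S h x z (t + 1) = S w + h t w • z t := rfl
  rw [h1]
  constructor
  · rw [perp_add, perp_smul]
    refine (norm_add_le _ _).trans (add_le_add (hS.norm_perp_map_le _) ?_)
    rw [norm_smul, Real.norm_eq_abs, abs_of_nonneg (hh t w)]
    exact mul_le_mul_of_nonneg_left (norm_perp_le hS.norm_fixed _) (hh t w)
  · rw [inner_add_right, real_inner_smul_right, hS.inner_map]
    have := abs_sub_abs_le_abs_sub (inner ℝ u w : ℝ) (-(h t w * inner ℝ u (z t)))
    rw [abs_neg, abs_mul, abs_of_nonneg (hh t w), sub_neg_eq_add] at this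
    exact this

end NoisyContraction
end NoisyPower

namespace NoisyPower

/-! ### Deterministic convergence along a good noise path. -/

section Pathwise

lemma normalize_smul {n : ℕ} {a : ℝ} (ha : 0 < a) (x : Vec n) :
    normalize (a • x) = normalize x := by
  rw [normalize, normalize, norm_smul, Real.norm_eq_abs, abs_of_pos ha, smul_smul, mul_inv,
    mul_right_comm, inv_mul_cancel₀ ha.ne', one_mul]

lemma noiseScale_zero {n : ℕ} (τ : ℝ) : noiseScale τ (0 : Vec n) = 0 := by
  simp [noiseScale, supNorm]

lemma cappedScale_zero {n : ℕ} (τ k : ℝ) (t : ℕ) : cappedScale τ k t (0 : Vec n) = 0 := by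
  simp [cappedScale, noiseScale_zero]

lemma noisySeq_eq_zero {n : ℕ} {S : Vec n →L[ℝ] Vec n} {τ k : ℝ} {x : Vec n} {z : ℕ → Vec n}
    {t : ℕ} (ht : noisySeq S (cappedScale τ k) x z t = 0) {r : ℕ} (hr : t ≤ r) :
    noisySeq S (cappedScale τ k) x z r = 0 := by
  induction r, hr using Nat.le_induction with
  | base => exact ht
  | succ r _ ih => rw [noisySeq, ih, map_zero, cappedScale_zero, zero_smul, add_zero]

lemma norm_eq_sqrt {n : ℕ} {u : Vec n} (hu : ‖u‖ = 1) (x : Vec n) :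
    ‖x‖ = √(|(inner ℝ u x : ℝ)| ^ 2 + ‖perp u x‖ ^ 2) := by
  rw [sq_abs, ← norm_sq_eq_inner_sq_add hu, Real.sqrt_sq (norm_nonneg _)]

/-- The ratio bound is kept by the capped process. -/
lemma ratio_invariant {n : ℕ} {S : Vec n →L[ℝ] Vec n} {u : Vec n} {p : ℝ} (hS : IsPowerMap S u p)
    {τ k K : ℝ} (hτ : 0 ≤ τ) (hk : 0 ≤ k) (hK : 0 < K) {x : Vec n} {z : ℕ → Vec n} {L N : ℕ}
    (hL : 1 ≤ L)
    (hz : ∀ t < N, k * (‖z t‖ + K * |(inner ℝ u (z t) : ℝ)|) * √(1 + K ^ 2) ≤ p * K)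
    (hM : (inner ℝ u (noisySeq S (cappedScale τ k) x z L) : ℝ) ≠ 0)
    (hV : ‖perp u (noisySeq S (cappedScale τ k) x z L)‖ ≤
      K * |(inner ℝ u (noisySeq S (cappedScale τ k) x z L) : ℝ)|) {t : ℕ} (hLt : L ≤ t)
    (htN : t ≤ N) :
    0 < |(inner ℝ u (noisySeq S (cappedScale τ k) x z t) : ℝ)| ∧
    ‖perp u (noisySeq S (cappedScale τ k) x z t)‖ ≤
      K * |(inner ℝ u (noisySeq S (cappedScale τ k) x z t) : ℝ)| := by
  induction t, hLt using Nat.le_induction with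
  | base => exact ⟨abs_pos.2 hM, hV⟩
  | succ t ht ih =>
    obtain ⟨ih1, ih2⟩ := ih (by omega)
    obtain ⟨h1, h2⟩ := noisySeq_step hS (fun t w => cappedScale_nonneg hτ hk t w) x z t
    refine (ratio_step (norm_nonneg _) ih1 ih2 (h := cappedScale τ k t _) ?_ h1 h2 hk hS.le_one
      (abs_nonneg _) ?_ hK (hz t (by omega))).2
    · rw [← norm_eq_sqrt hS.norm_fixed]
      exact cappedScale_le τ k (by omega) _
    · have := abs_real_inner_le_norm u (z t)
      rwa [hS.norm_fixed, one_mul] at this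

/-- A normalized iteration agrees with the capped linear process while the cap is inactive. -/
lemma eq_normalize_noisySeq {n : ℕ} {S : Vec n →L[ℝ] Vec n} {τ k c : ℝ} {x : Vec n}
    {z Y : ℕ → Vec n} {N : ℕ}
    (hW : ∀ t ≤ N, noisySeq S (cappedScale τ k) x z t ≠ 0) (hY0 : Y 0 = normalize x)
    (hY : ∀ t < N, Y (t + 1) = normalize (S (Y t) + (τ * (supNorm (Y t) + 1 / n)) • z t))
    (hc : ∀ t, 1 ≤ t → t ≤ N → τ * (supNorm (Y t) + 1 / n) ≤ c) (hck : c ≤ k) {t : ℕ}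
    (ht : t ≤ N) :
    Y t = normalize (noisySeq S (cappedScale τ k) x z t) ∧
    (1 ≤ t → cappedScale τ k t (noisySeq S (cappedScale τ k) x z t) ≤
      c * ‖noisySeq S (cappedScale τ k) x z t‖) := by
  have hscale : ∀ t ≤ N, 1 ≤ t → Y t = normalize (noisySeq S (cappedScale τ k) x z t) →
      cappedScale τ k t (noisySeq S (cappedScale τ k) x z t) ≤
        c * ‖noisySeq S (cappedScale τ k) x z t‖ := by
    intro t ht h1 hYt
    refine (cappedScale_le_noiseScale τ k t _).trans ?_
    rw [noiseScale_eq τ (hW t ht), mul_comm, ← hYt]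
    have := hc t h1 ht
    gcongr
  have hmain : Y t = normalize (noisySeq S (cappedScale τ k) x z t) := by
    induction t with
    | zero => exact hY0
    | succ t ih =>
      have ih := ih (by omega)
      rw [hY t (by omega), noisySeq]
      set w := noisySeq S (cappedScale τ k) x z t with hw
      have hw0 : 0 < ‖w‖ := norm_pos_iff.2 (hW t (by omega))
      -- By homogeneity the noise scale at w is ‖w‖ times the scale at its direction, and `hc` with
      -- `c ≤ k` says that the cap is not reached for t ≥ 1.
      have h1 : cappedScale τ k t w = ‖w‖ * (τ * (supNorm (Y t) + 1 / n)) := by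
        rw [ih, ← noiseScale_eq τ (hW t (by omega)), cappedScale]
        split_ifs with h0
        · rfl
        · refine min_eq_left ?_
          rw [noiseScale_eq τ (hW t (by omega)), ← ih, mul_comm]
          have := (hc t (by omega) (by omega)).trans hck
          gcongr
      have h2 : S w = ‖w‖ • S (Y t) := by
        rw [ih, normalize, map_smul, smul_smul, mul_inv_cancel₀ hw0.ne', one_smul]
      rw [h1, h2, mul_smul ‖w‖, ← smul_add, normalize_smul hw0]
  exact ⟨hmain, fun h1 => hscale t ht h1 hmain⟩

/-- The pathwise convergence of the noisy power iteration. -/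
theorem norm_perp_le_of_path {n : ℕ} {S : Vec n →L[ℝ] Vec n} {u : Vec n} {p : ℝ}
    (hS : IsPowerMap S u p) {τ k K c b s χ E R : ℝ} (hτ : 0 ≤ τ) (hk : 0 ≤ k)
    (hK : 0 < K) {x : Vec n} {z Y : ℕ → Vec n} {L N : ℕ} (hL : 1 ≤ L) (hLN : L < N)
    (hz : ∀ t < N, k * (‖z t‖ + K * |(inner ℝ u (z t) : ℝ)|) * √(1 + K ^ 2) ≤ p * K)
    (hχ : ∀ t < N, 1 - p + k * ‖z t‖ ≤ χ) (hχ0 : 0 ≤ χ) (hχ1 : χ ≤ 1)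
    (hM : (inner ℝ u (noisySeq S (cappedScale τ k) x z L) : ℝ) ≠ 0)
    (hV : ‖perp u (noisySeq S (cappedScale τ k) x z L)‖ ≤
      K * |(inner ℝ u (noisySeq S (cappedScale τ k) x z L) : ℝ)|)
    (hY0 : Y 0 = normalize x)
    (hY : ∀ t < N, Y (t + 1) = normalize (S (Y t) + (τ * (supNorm (Y t) + 1 / n)) • z t))
    (hc : ∀ t, 1 ≤ t → t ≤ N → τ * (supNorm (Y t) + 1 / n) ≤ c) (hck : c ≤ k)
    (hb : b = √n + s) (hR : c * b = p * R) (hR1 : R < 1) (hb0 : 0 ≤ b)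
    (hE : K ≤ τ / n * E) (hE0 : 0 ≤ E) (hE1 : χ ^ (N - 1 - L) * E ≤ 1)
    (hℓ : lindley s (fun t => ‖z t‖ - √n + K * √(1 + K ^ 2) * |(inner ℝ u (z t) : ℝ)|) (N - 1) +
      (‖z (N - 1)‖ - √n + K * √(1 + K ^ 2) * |(inner ℝ u (z (N - 1)) : ℝ)|) + 1 ≤ s) :
    ‖perp u (Y N)‖ ≤ R := by
  set W := noisySeq S (cappedScale τ k) x z with hWdef
  set ξ : ℕ → ℝ := fun t => ‖z t‖ - √n + K * √(1 + K ^ 2) * |(inner ℝ u (z t) : ℝ)| with hξ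
  have hinv : ∀ t, L ≤ t → t ≤ N → 0 < |(inner ℝ u (W t) : ℝ)| ∧
      ‖perp u (W t)‖ ≤ K * |(inner ℝ u (W t) : ℝ)| := fun t h1 h2 =>
    ratio_invariant hS hτ hk hK hL hz hM hV h1 h2
  -- Zero is absorbing for the capped process, so a zero at any time would contradict the positive
  -- aligned part from time L on.
  have hW : ∀ t ≤ N, W t ≠ 0 := by
    intro t _ h0
    have h1 : W (max t L) = 0 := noisySeq_eq_zero h0 (le_max_left t L)
    rcases le_total t L with h | h
    · rw [max_eq_right h] at h1
      exact hM (by rw [h1, inner_zero_right])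
    · have := (hinv t h (by assumption)).1
      rw [h0, inner_zero_right, abs_zero] at this
      exact lt_irrefl _ this
  have hYW : ∀ t ≤ N, Y t = normalize (W t) ∧
      (1 ≤ t → cappedScale τ k t (W t) ≤ c * ‖W t‖) := fun t ht =>
    eq_normalize_noisySeq hW hY0 hY hc hck ht
  -- The summand 1/n in the noise scale keeps c from being tiny. Hence K ≤ c E, and the initial
  -- ratio fits under the excess E in units of c.
  have hcτ : τ / n ≤ c := by
    refine le_trans ?_ (hc N (by omega) le_rfl)
    rw [mul_add, mul_one_div]
    have := mul_nonneg hτ (supNorm_nonneg (Y N))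
    linarith
  have hc0 : 0 ≤ c := le_trans (by positivity) hcτ
  have hR0 : 0 ≤ R := by
    have h1 : 0 ≤ p * R := hR ▸ mul_nonneg hc0 hb0
    exact nonneg_of_mul_nonneg_right h1 hS.pos
  have hR2 : 0 < 1 - R ^ 2 := by nlinarith
  -- R is the sine of the target angle and T its tangent. Then c b = p R is exactly the balance
  -- condition of `excess_step`.
  obtain ⟨T, hT0, hT⟩ : ∃ T : ℝ, 0 ≤ T ∧ R * √(1 + T ^ 2) = T := by
    refine ⟨R / √(1 - R ^ 2), by positivity, ?_⟩
    have h1 : 1 + (R / √(1 - R ^ 2)) ^ 2 = 1 / (1 - R ^ 2) := by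
      rw [div_pow, Real.sq_sqrt hR2.le]
      field_simp
      ring
    rw [h1, Real.sqrt_div zero_le_one, Real.sqrt_one, mul_one_div]
  have hbT : c * b * √(1 + T ^ 2) = p * T := by rw [hR, mul_assoc, hT]
  have hs1 : 1 ≤ √(1 + T ^ 2) := Real.one_le_sqrt.2 (by nlinarith)
  have hstep : ∀ t, L ≤ t → t < N → ∀ e e' : ℝ, 0 ≤ e →
      ‖perp u (W t)‖ ≤ (T + c * √(1 + T ^ 2) * e) * |(inner ℝ u (W t) : ℝ)| →
      χ * e + (ξ t - s) ≤ e' →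
      ‖perp u (W (t + 1))‖ ≤ (T + c * √(1 + T ^ 2) * e') * |(inner ℝ u (W (t + 1)) : ℝ)| := by
    intro t hLt htN e e' he hve he'
    obtain ⟨h1, h2⟩ := noisySeq_step hS (fun t w => cappedScale_nonneg hτ hk t w) x z t
    have hh : cappedScale τ k t (W t) ≤ c * √(|(inner ℝ u (W t) : ℝ)| ^ 2 + ‖perp u (W t)‖ ^ 2) := by
      rw [← norm_eq_sqrt hS.norm_fixed]
      exact (hYW t htN.le).2 (by omega)
    have hgn : |(inner ℝ u (z t) : ℝ)| ≤ ‖z t‖ := by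
      have := abs_real_inner_le_norm u (z t)
      rwa [hS.norm_fixed, one_mul] at this
    have hcz : c * (‖z t‖ + K * |(inner ℝ u (z t) : ℝ)|) * √(1 + K ^ 2) ≤ p * K :=
      le_trans (by gcongr) (hz t htN)
    obtain ⟨h3, h4, h5⟩ := ratio_step (norm_nonneg _) (hinv t hLt htN.le).1 (hinv t hLt htN.le).2
      hh h1 h2 hc0 hS.le_one (abs_nonneg _) hgn hK hcz
    refine excess_step (norm_nonneg _) (hinv t hLt htN.le).1 h4 hK.le (norm_nonneg _) h3 h5 hh h1 h2
      hc0 hS.le_one (abs_nonneg _) (norm_nonneg _) hT0 hbT he hve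
      (le_trans (by gcongr) (hχ t htN)) (le_trans (le_of_eq ?_) he')
    rw [hb]; simp only [hξ]; ring
  have hexc : ∀ t, L ≤ t → t ≤ N → ‖perp u (W t)‖ ≤
      (T + c * √(1 + T ^ 2) * (χ ^ (t - L) * E + lindley s ξ t)) * |(inner ℝ u (W t) : ℝ)| := by
    intro t hLt
    induction t, hLt using Nat.le_induction with
    | base =>
      intro htN
      refine (hinv L le_rfl htN).2.trans ?_
      gcongr
      rw [Nat.sub_self, pow_zero, one_mul]
      have h1 : K ≤ c * E := hE.trans (by gcongr)
      have h2 : c * E ≤ c * √(1 + T ^ 2) * E := by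
        gcongr
        exact le_mul_of_one_le_right hc0 hs1
      have h3 : 0 ≤ c * √(1 + T ^ 2) * lindley s ξ L :=
        mul_nonneg (by positivity) (lindley_nonneg s ξ L)
      linarith
    | succ t ht ih =>
      intro htN
      refine hstep t ht (by omega) _ _ (add_nonneg (by positivity) (lindley_nonneg s ξ t))
        (ih (by omega)) ?_
      have h1 : χ ^ (t + 1 - L) = χ * χ ^ (t - L) := by
        rw [Nat.sub_add_comm ht, pow_succ']
      have h2 : lindley s ξ t + ξ t - s ≤ lindley s ξ (t + 1) := le_max_left _ _
      have h3 : χ * lindley s ξ t ≤ lindley s ξ t :=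
        mul_le_of_le_one_left (lindley_nonneg s ξ t) hχ1
      rw [h1]
      linarith
  -- The decayed initial excess is at most 1 by `hE1`, and the spare 1 in `hℓ` absorbs it. So the
  -- excess after the last step can be taken to be 0.
  have hfin : ‖perp u (W N)‖ ≤ T * |(inner ℝ u (W N) : ℝ)| := by
    obtain ⟨m, rfl⟩ : ∃ m, N = m + 1 := ⟨N - 1, by omega⟩
    simp only [Nat.add_sub_cancel] at hE1 hℓ
    have h1 := hstep m (by omega) (by omega) _ 0
      (add_nonneg (mul_nonneg (pow_nonneg hχ0 (m - L)) hE0) (lindley_nonneg s ξ m))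
      (hexc m (by omega) (by omega)) (by
        have h3 : χ * (χ ^ (m - L) * E + lindley s ξ m) ≤ χ ^ (m - L) * E + lindley s ξ m :=
          mul_le_of_le_one_left
            (add_nonneg (mul_nonneg (pow_nonneg hχ0 (m - L)) hE0) (lindley_nonneg s ξ m)) hχ1
        have h4 : lindley s ξ m + ξ m + 1 ≤ s := hℓ
        linarith)
    simpa using h1
  have hWN : 0 < ‖W N‖ := norm_pos_iff.2 (hW N le_rfl)
  rw [(hYW N le_rfl).1, normalize, perp_smul, norm_smul, norm_inv, norm_norm, inv_mul_le_iff₀ hWN]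
  refine (pow_le_pow_iff_left₀ (norm_nonneg _) (by positivity) two_ne_zero).1 ?_
  have h1 := norm_sq_eq_inner_sq_add hS.norm_fixed (W N)
  have h2 := pow_le_pow_left₀ (norm_nonneg _) hfin 2
  rw [mul_pow, sq_abs] at h2
  have h3 : R ^ 2 * (1 + T ^ 2) = T ^ 2 := by
    conv_rhs => rw [← hT]
    rw [mul_pow, Real.sq_sqrt (by positivity)]
  rw [mul_pow, h1]
  have h4 : (1 + T ^ 2) * ‖perp u (W N)‖ ^ 2 ≤
      (1 + T ^ 2) * (((inner ℝ u (W N) : ℝ) ^ 2 + ‖perp u (W N)‖ ^ 2) * R ^ 2) := by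
    have : (1 + T ^ 2) * (((inner ℝ u (W N) : ℝ) ^ 2 + ‖perp u (W N)‖ ^ 2) * R ^ 2) =
      T ^ 2 * ((inner ℝ u (W N) : ℝ) ^ 2 + ‖perp u (W N)‖ ^ 2) := by
      linear_combination ((inner ℝ u (W N) : ℝ) ^ 2 + ‖perp u (W N)‖ ^ 2) * h3
    rw [this]; linarith
  exact le_of_mul_le_mul_left h4 (by positivity)

end Pathwise
end NoisyPower

namespace NoisyPower

/-! ### One-step second-moment inequalities for the capped process. -/

section Moments

lemma measurable_noiseScale {n : ℕ} (τ : ℝ) : Measurable (noiseScale τ : Vec n → ℝ) := by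
  unfold noiseScale
  exact ((continuous_supNorm.measurable).add (measurable_norm.div_const _)).const_mul τ

lemma measurable_cappedScale {n : ℕ} (τ k : ℝ) (t : ℕ) :
    Measurable (cappedScale τ k t : Vec n → ℝ) := by
  unfold cappedScale
  split_ifs
  · exact measurable_noiseScale τ
  · exact (measurable_noiseScale τ).min (measurable_norm.const_mul k)

/-- A sequence driven by the noise `z` depends on `x` and on `z 0, …, z (t - 1)` only. -/
lemma measurable_noisySeq {n : ℕ} (S : Vec n →L[ℝ] Vec n) {h : ℕ → Vec n → ℝ}
    (hh : ∀ t, Measurable (h t)) {X : Type*} [MeasurableSpace X] {x : X → Vec n}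
    {z : X → ℕ → Vec n} (hx : Measurable x) {t : ℕ} (hz : ∀ i < t, Measurable fun a => z a i) :
    Measurable fun a => noisySeq S h (x a) (z a) t := by
  induction t with
  | zero => exact hx
  | succ t ih =>
    have h1 := ih fun i hi => hz i (by omega)
    exact (S.measurable.comp h1).add (((hh t).comp h1).smul (hz t (by omega)))

/-- The process driven by a sequence of Gaussian vectors. -/
noncomputable def noisyProc {n : ℕ} {Ω : Type*} (S : Vec n →L[ℝ] Vec n) (τ k : ℝ)
    (g : ℕ → Ω → Vec n) (t : ℕ) (ω : Ω) : Vec n :=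
  noisySeq S (cappedScale τ k) (g 0 ω) (fun i => g (i + 1) ω) t

lemma measurable_noisyProc {n : ℕ} {Ω : Type*} (S : Vec n →L[ℝ] Vec n) (τ k : ℝ)
    (g : ℕ → Ω → Vec n) {r t : ℕ} (h : r ≤ t) :
    Measurable[sigmaOf g {i | i ≤ t}] (noisyProc S τ k g r) := by
  let := sigmaOf g {i | i ≤ t}
  exact measurable_noisySeq S (measurable_cappedScale τ k)
    (measurable_sigmaOf g (T := {i | i ≤ t}) (Nat.zero_le t))
    fun i hi => measurable_sigmaOf g (T := {i | i ≤ t}) (show i + 1 ≤ t by omega)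

/-- The aligned part is a martingale: the cross term with the fresh Gaussian has mean zero. The
offset z will be an earlier value of the aligned part. -/
lemma lintegral_inner_step {n : ℕ} {S : Vec n →L[ℝ] Vec n} {u : Vec n} {p : ℝ}
    (hS : IsPowerMap S u p) (w : Vec n) (z h : ℝ) :
    ∫⁻ x, ENNReal.ofReal (((inner ℝ u (S w + h • x) : ℝ) - z) ^ 2) ∂(stdGaussian (Vec n)) =
      ENNReal.ofReal (((inner ℝ u w : ℝ) - z) ^ 2 + h ^ 2) := by
  have h1 := lintegral_add_inner_sq_stdGaussian u ((inner ℝ u w : ℝ) - z) h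
  rw [hS.norm_fixed] at h1
  rw [show (inner ℝ u w - z) ^ 2 + h ^ 2 = (inner ℝ u w - z) ^ 2 + h ^ 2 * 1 ^ 2 by ring, ← h1]
  refine lintegral_congr fun x => ?_
  rw [inner_add_right, hS.inner_map, real_inner_smul_right]
  ring_nf

lemma lintegral_perp_step {n : ℕ} {S : Vec n →L[ℝ] Vec n} {u : Vec n} {p : ℝ}
    (hS : IsPowerMap S u p) (w : Vec n) (h : ℝ) :
    ∫⁻ x, ENNReal.ofReal (‖perp u (S w + h • x)‖ ^ 2) ∂(stdGaussian (Vec n)) ≤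
      ENNReal.ofReal ((1 - p) ^ 2 * ‖perp u w‖ ^ 2 + h ^ 2 * n) := by
  have h1 : ∀ x, ‖perp u (S w + h • x)‖ ≤ ‖S (perp u w) + h • x‖ := by
    intro x
    have h2 : perp u (S w + h • x) = perp u (S (perp u w) + h • x) := by
      rw [perp_add, perp_add, ← hS.perp_map w]
      rw [perp.eq_def u (perp u (S w)), inner_perp hS.norm_fixed, zero_smul, sub_zero]
    rw [h2]
    exact norm_perp_le hS.norm_fixed _
  calc _ ≤ ∫⁻ x, ENNReal.ofReal (‖S (perp u w) + h • x‖ ^ 2) ∂(stdGaussian (Vec n)) := by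
        refine lintegral_mono fun x => ENNReal.ofReal_le_ofReal ?_
        exact pow_le_pow_left₀ (norm_nonneg _) (h1 x) 2
    _ ≤ _ := by
        rw [lintegral_norm_add_sq_stdGaussian, ← mul_pow]
        refine ENNReal.ofReal_le_ofReal ?_
        have := hS.norm_map_le _ (inner_perp hS.norm_fixed w)
        gcongr

variable {n : ℕ} {Ω : Type*} [MeasurableSpace Ω] {P : Measure Ω} {g : ℕ → Ω → Vec n}

lemma sigmaOf_succ_notMem (t : ℕ) : t + 1 ∉ {i : ℕ | i ≤ t} := by simp

lemma GaussianSeq.lintegral_inner_step (hg : GaussianSeq P g) {S : Vec n →L[ℝ] Vec n} {u : Vec n}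
    {p : ℝ} (hS : IsPowerMap S u p) {τ k : ℝ} {t : ℕ} {Z : Ω → ℝ}
    (hZ : Measurable[sigmaOf g {i | i ≤ t}] Z) :
    ∫⁻ ω, ENNReal.ofReal (((inner ℝ u (noisyProc S τ k g (t + 1) ω) : ℝ) - Z ω) ^ 2) ∂P =
      ∫⁻ ω, ENNReal.ofReal (((inner ℝ u (noisyProc S τ k g t ω) : ℝ) - Z ω) ^ 2 +
        cappedScale τ k t (noisyProc S τ k g t ω) ^ 2) ∂P := by
  have hW := measurable_noisyProc S τ k g (le_refl t)
  have hH := measurable_cappedScale (n := n) τ k t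
  have hSm := S.measurable
  have hΦ : Measurable fun q : (Vec n × ℝ) × Vec n => ENNReal.ofReal
      (((inner ℝ u (S q.1.1 + cappedScale τ k t q.1.1 • q.2) : ℝ) - q.1.2) ^ 2) := by fun_prop
  have := hg.lintegral_freeze (sigmaOf_succ_notMem t) (Z := fun ω => (noisyProc S τ k g t ω, Z ω))
    (Measurable.prodMk hW hZ) hΦ
  have h2 : ∀ ω, noisyProc S τ k g (t + 1) ω = S (noisyProc S τ k g t ω) +
      cappedScale τ k t (noisyProc S τ k g t ω) • g (t + 1) ω := fun ω => rfl
  simp only [h2, this]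
  exact lintegral_congr fun ω => NoisyPower.lintegral_inner_step hS _ _ _

lemma GaussianSeq.lintegral_perp_step (hg : GaussianSeq P g) {S : Vec n →L[ℝ] Vec n} {u : Vec n}
    {p : ℝ} (hS : IsPowerMap S u p) {τ k : ℝ} (t : ℕ) :
    ∫⁻ ω, ENNReal.ofReal (‖perp u (noisyProc S τ k g (t + 1) ω)‖ ^ 2) ∂P ≤
      ∫⁻ ω, ENNReal.ofReal ((1 - p) ^ 2 * ‖perp u (noisyProc S τ k g t ω)‖ ^ 2 +
        cappedScale τ k t (noisyProc S τ k g t ω) ^ 2 * n) ∂P := by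
  have hW := measurable_noisyProc S τ k g (le_refl t)
  have hH := measurable_cappedScale (n := n) τ k t
  have hSm := S.measurable
  have hu := measurable_perp u
  have hΦ : Measurable fun q : Vec n × Vec n => ENNReal.ofReal
      (‖perp u (S q.1 + cappedScale τ k t q.1 • q.2)‖ ^ 2) := by fun_prop
  have h1 := hg.lintegral_freeze (sigmaOf_succ_notMem t) hW hΦ
  have h2 : ∀ ω, noisyProc S τ k g (t + 1) ω = S (noisyProc S τ k g t ω) +
      cappedScale τ k t (noisyProc S τ k g t ω) • g (t + 1) ω := fun ω => rfl
  simp only [h2, h1]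
  exact lintegral_mono fun ω => NoisyPower.lintegral_perp_step hS _ _

lemma measurable_proc (hg : GaussianSeq P g) (S : Vec n →L[ℝ] Vec n) (τ k : ℝ) (t : ℕ) :
    Measurable (noisyProc S τ k g t) :=
  (measurable_noisyProc S τ k g le_rfl).mono (sigmaOf_le hg _) le_rfl

/-- This is what the cap is for: the noise variance becomes a small multiple of the aligned and
orthogonal squares, so their moment recursions close without any control of the sup norm. -/
lemma cappedScale_sq_le {S : Vec n →L[ℝ] Vec n} {u : Vec n} {p : ℝ} (hS : IsPowerMap S u p)
    {τ k : ℝ} (hτ : 0 ≤ τ) (hk : 0 ≤ k) {t : ℕ} (ht : t ≠ 0) (w : Vec n) :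
    cappedScale τ k t w ^ 2 ≤ k ^ 2 * ((inner ℝ u w : ℝ) ^ 2 + ‖perp u w‖ ^ 2) := by
  rw [← norm_sq_eq_inner_sq_add hS.norm_fixed, ← mul_pow]
  exact pow_le_pow_left₀ (cappedScale_nonneg hτ hk t w) (cappedScale_le τ k ht w) 2

/-- One step of the second moment of the orthogonal part. -/
lemma GaussianSeq.lintegral_perp_le (hg : GaussianSeq P g) {S : Vec n →L[ℝ] Vec n} {u : Vec n}
    {p : ℝ} (hS : IsPowerMap S u p) {τ k r c : ℝ} (hτ : 0 ≤ τ) (hk : 0 ≤ k)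
    (hr : (1 - p) ^ 2 + k ^ 2 * n ≤ r) (hc : k ^ 2 * n ≤ c) {t : ℕ} (ht : t ≠ 0) :
    ∫⁻ ω, ENNReal.ofReal (‖perp u (noisyProc S τ k g (t + 1) ω)‖ ^ 2) ∂P ≤
      ENNReal.ofReal r * ∫⁻ ω, ENNReal.ofReal (‖perp u (noisyProc S τ k g t ω)‖ ^ 2) ∂P +
      ENNReal.ofReal c *
        ∫⁻ ω, ENNReal.ofReal ((inner ℝ u (noisyProc S τ k g t ω) : ℝ) ^ 2) ∂P := by
  have hr0 : 0 ≤ r := le_trans (by positivity) hr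
  have hc0 : 0 ≤ c := le_trans (by positivity) hc
  have hW := measurable_proc hg S τ k t
  have hperp := measurable_perp u
  refine (hg.lintegral_perp_step hS t).trans ?_
  rw [← lintegral_const_mul _ (by fun_prop), ← lintegral_const_mul _ (by fun_prop),
    ← lintegral_add_left (by fun_prop)]
  refine lintegral_mono fun ω => ?_
  rw [← ENNReal.ofReal_mul hr0, ← ENNReal.ofReal_mul hc0, ← ENNReal.ofReal_add (by positivity)
    (by positivity)]
  refine ENNReal.ofReal_le_ofReal ?_
  set w := noisyProc S τ k g t ω
  have h1 := mul_le_mul_of_nonneg_right (cappedScale_sq_le hS hτ hk ht w) (Nat.cast_nonneg n)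
  have h2 := mul_le_mul_of_nonneg_right hr (sq_nonneg ‖perp u w‖)
  have h3 := mul_le_mul_of_nonneg_right hc (sq_nonneg (inner ℝ u w : ℝ))
  nlinarith

/-- One step of a weighted second moment of both parts. -/
lemma GaussianSeq.lintegral_potential_le (hg : GaussianSeq P g) {S : Vec n →L[ℝ] Vec n}
    {u : Vec n} {p : ℝ} (hS : IsPowerMap S u p) {τ k a ε : ℝ} (hτ : 0 ≤ τ) (hk : 0 ≤ k)
    (ha : 0 ≤ a) (hak : a * ((1 - p) ^ 2 + k ^ 2 * n) + k ^ 2 ≤ a)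
    (hε : k ^ 2 + a * (k ^ 2 * n) ≤ ε) {t : ℕ} (ht : t ≠ 0) {Z : Ω → ℝ}
    (hZ : Measurable[sigmaOf g {i | i ≤ t}] Z) :
    ∫⁻ ω, ENNReal.ofReal (((inner ℝ u (noisyProc S τ k g (t + 1) ω) : ℝ) - Z ω) ^ 2) ∂P +
      ENNReal.ofReal a *
        ∫⁻ ω, ENNReal.ofReal (‖perp u (noisyProc S τ k g (t + 1) ω)‖ ^ 2) ∂P ≤
    ∫⁻ ω, ENNReal.ofReal (((inner ℝ u (noisyProc S τ k g t ω) : ℝ) - Z ω) ^ 2) ∂P +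
      ENNReal.ofReal a * ∫⁻ ω, ENNReal.ofReal (‖perp u (noisyProc S τ k g t ω)‖ ^ 2) ∂P +
      ENNReal.ofReal ε *
        ∫⁻ ω, ENNReal.ofReal ((inner ℝ u (noisyProc S τ k g t ω) : ℝ) ^ 2) ∂P := by
  have hε0 : 0 ≤ ε := le_trans (by positivity) hε
  have hW := measurable_proc hg S τ k t
  have hperp := measurable_perp u
  have hH := measurable_cappedScale (n := n) τ k t
  have hZ' : Measurable Z := hZ.mono (sigmaOf_le hg _) le_rfl
  rw [hg.lintegral_inner_step hS hZ]
  refine (add_le_add_right (mul_le_mul_right (hg.lintegral_perp_step hS t) _) _).trans ?_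
  rw [← lintegral_const_mul _ (by fun_prop), ← lintegral_const_mul _ (by fun_prop),
    ← lintegral_const_mul _ (by fun_prop), ← lintegral_add_left (by fun_prop),
    ← lintegral_add_left (by fun_prop), ← lintegral_add_left (by fun_prop)]
  refine lintegral_mono fun ω => ?_
  rw [← ENNReal.ofReal_mul ha, ← ENNReal.ofReal_mul ha, ← ENNReal.ofReal_mul hε0,
    ← ENNReal.ofReal_add (by positivity) (by positivity), ← ENNReal.ofReal_add (by positivity)
    (by positivity), ← ENNReal.ofReal_add (by positivity) (by positivity)]
  refine ENNReal.ofReal_le_ofReal ?_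
  set w := noisyProc S τ k g t ω
  have h0 := cappedScale_sq_le hS hτ hk ht w
  have h1 := mul_le_mul_of_nonneg_left h0 (show 0 ≤ 1 + a * n by positivity)
  have h2 := mul_le_mul_of_nonneg_right hak (sq_nonneg ‖perp u w‖)
  have h3 := mul_le_mul_of_nonneg_right hε (sq_nonneg (inner ℝ u w : ℝ))
  linear_combination h1 + h2 + h3

end Moments
end NoisyPower

namespace NoisyPower

/-! ### Second moments over many steps. -/

section MomentBounds

variable {n : ℕ} {Ω : Type*} [MeasurableSpace Ω] {P : Measure Ω} {g : ℕ → Ω → Vec n}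

lemma lintegral_inner_sq_stdGaussian {u : Vec n} (hu : ‖u‖ = 1) :
    ∫⁻ x, ENNReal.ofReal ((inner ℝ u x : ℝ) ^ 2) ∂(stdGaussian (Vec n)) = ENNReal.ofReal 1 := by
  have := lintegral_add_inner_sq_stdGaussian u 0 1
  simpa [hu] using this

lemma lintegral_norm_sq_stdGaussian :
    ∫⁻ x, ENNReal.ofReal (‖x‖ ^ 2) ∂(stdGaussian (Vec n)) = ENNReal.ofReal n := by
  have := lintegral_norm_add_sq_stdGaussian (0 : Vec n) 1
  simpa using this

/-- The first step is uncapped, so the second moment of its noise scale at a Gaussian start enters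
as a separate constant Q. -/
lemma GaussianSeq.lintegral_inner_one_le (hg : GaussianSeq P g) {S : Vec n →L[ℝ] Vec n}
    {u : Vec n} {p : ℝ} (hS : IsPowerMap S u p) {τ k Q : ℝ} (hQ0 : 0 ≤ Q)
    (hQ : ∫⁻ x, ENNReal.ofReal (noiseScale τ x ^ 2) ∂(stdGaussian (Vec n)) ≤ ENNReal.ofReal Q) :
    ∫⁻ ω, ENNReal.ofReal ((inner ℝ u (noisyProc S τ k g 1 ω) : ℝ) ^ 2) ∂P ≤
      ENNReal.ofReal (1 + Q) := by
  have h1 := hg.lintegral_inner_step hS (τ := τ) (k := k) (t := 0) (Z := fun _ => 0)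
    measurable_const
  simp only [sub_zero, zero_add] at h1
  have hm := measurable_noiseScale (n := n) τ
  rw [h1]
  refine (hg.lintegral_comp 0 (f := fun x => ENNReal.ofReal ((inner ℝ u x : ℝ) ^ 2 +
    cappedScale τ k 0 x ^ 2)) (by simp only [cappedScale, if_true]; fun_prop)).trans_le ?_
  simp only [cappedScale, if_true]
  calc _ = ∫⁻ x, (ENNReal.ofReal ((inner ℝ u x : ℝ) ^ 2) + ENNReal.ofReal (noiseScale τ x ^ 2))
        ∂(stdGaussian (Vec n)) := by
        refine lintegral_congr fun x => ?_
        rw [ENNReal.ofReal_add (by positivity) (by positivity)]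
    _ ≤ _ := by
        rw [lintegral_add_left (by fun_prop), lintegral_inner_sq_stdGaussian hS.norm_fixed,
          ENNReal.ofReal_add zero_le_one hQ0]
        gcongr

lemma GaussianSeq.lintegral_perp_one_le (hg : GaussianSeq P g) {S : Vec n →L[ℝ] Vec n}
    {u : Vec n} {p : ℝ} (hS : IsPowerMap S u p) {τ k Q : ℝ} (hQ0 : 0 ≤ Q)
    (hQ : ∫⁻ x, ENNReal.ofReal (noiseScale τ x ^ 2) ∂(stdGaussian (Vec n)) ≤ ENNReal.ofReal Q) :
    ∫⁻ ω, ENNReal.ofReal (‖perp u (noisyProc S τ k g 1 ω)‖ ^ 2) ∂P ≤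
      ENNReal.ofReal ((1 + Q) * n) := by
  refine (hg.lintegral_perp_step hS (τ := τ) (k := k) 0).trans ?_
  have hm := measurable_noiseScale (n := n) τ
  have hu := measurable_perp u
  refine (hg.lintegral_comp 0 (f := fun x => ENNReal.ofReal ((1 - p) ^ 2 * ‖perp u x‖ ^ 2 +
    cappedScale τ k 0 x ^ 2 * n)) (by simp only [cappedScale, if_true]; fun_prop)).trans_le ?_
  simp only [cappedScale, if_true]
  calc _ ≤ ∫⁻ x, (ENNReal.ofReal (‖x‖ ^ 2) + ENNReal.ofReal n * ENNReal.ofReal (noiseScale τ x ^ 2))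
        ∂(stdGaussian (Vec n)) := by
        refine lintegral_mono fun x => ?_
        rw [← ENNReal.ofReal_mul (by positivity),
          ← ENNReal.ofReal_add (by positivity) (by positivity)]
        refine ENNReal.ofReal_le_ofReal ?_
        have h1 := norm_sq_eq_inner_sq_add hS.norm_fixed x
        have h2 : (1 - p) ^ 2 ≤ 1 := by nlinarith [hS.pos, hS.le_one]
        have h3 := mul_le_mul_of_nonneg_right h2 (sq_nonneg ‖perp u x‖)
        nlinarith [sq_nonneg (inner ℝ u x : ℝ)]
    _ ≤ _ := by
        rw [lintegral_add_left (by fun_prop), lintegral_norm_sq_stdGaussian,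
          lintegral_const_mul _ (by fun_prop), one_add_mul, mul_comm Q,
          ENNReal.ofReal_add (by positivity) (by positivity), ENNReal.ofReal_mul (by positivity)]
        gcongr

/-- Second moments stay bounded as long as the accumulated growth is bounded. -/
theorem GaussianSeq.moments_le (hg : GaussianSeq P g) {S : Vec n →L[ℝ] Vec n} {u : Vec n} {p : ℝ}
    (hS : IsPowerMap S u p) {τ k a ε r c A X D : ℝ} (hτ : 0 ≤ τ) (hk : 0 ≤ k) (ha : 0 ≤ a)
    (hak : a * ((1 - p) ^ 2 + k ^ 2 * n) + k ^ 2 ≤ a) (hε : k ^ 2 + a * (k ^ 2 * n) ≤ ε)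
    (hr : (1 - p) ^ 2 + k ^ 2 * n ≤ r) (hc : k ^ 2 * n ≤ c) (hA : 0 ≤ A)
    (hX : A + a * (A * n) ≤ X / 2) (hD0 : 0 ≤ D) (hD : r * D + c * X ≤ D)
    (hM : ∫⁻ ω, ENNReal.ofReal ((inner ℝ u (noisyProc S τ k g 1 ω) : ℝ) ^ 2) ∂P ≤
      ENNReal.ofReal A)
    (hV : ∫⁻ ω, ENNReal.ofReal (‖perp u (noisyProc S τ k g 1 ω)‖ ^ 2) ∂P ≤
      ENNReal.ofReal (A * n)) {L : ℕ} (hL : L * ε ≤ 1 / 2) {t : ℕ} (ht1 : 1 ≤ t) (htL : t ≤ L) :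
    ∫⁻ ω, ENNReal.ofReal ((inner ℝ u (noisyProc S τ k g t ω) : ℝ) ^ 2) ∂P ≤ ENNReal.ofReal X ∧
    ∫⁻ ω, ENNReal.ofReal (‖perp u (noisyProc S τ k g t ω)‖ ^ 2) ∂P ≤
      ENNReal.ofReal (r ^ (t - 1) * (A * n) + D) := by
  have hε0 : 0 ≤ ε := le_trans (by positivity) hε
  have hr0 : 0 ≤ r := le_trans (by positivity) hr
  have hc0 : 0 ≤ c := le_trans (by positivity) hc
  have hX0 : 0 ≤ X := by
    have : 0 ≤ A + a * (A * n) := by positivity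
    linarith
  have hpot : ∀ t : ℕ, 1 ≤ t → t ≤ L →
      ∫⁻ ω, ENNReal.ofReal ((inner ℝ u (noisyProc S τ k g t ω) : ℝ) ^ 2) ∂P +
        ENNReal.ofReal a * ∫⁻ ω, ENNReal.ofReal (‖perp u (noisyProc S τ k g t ω)‖ ^ 2) ∂P ≤
        ENNReal.ofReal (X / 2 + (t - 1) * (ε * X)) ∧
      ∫⁻ ω, ENNReal.ofReal ((inner ℝ u (noisyProc S τ k g t ω) : ℝ) ^ 2) ∂P ≤
        ENNReal.ofReal X := by
    intro t ht1
    -- The potential starts below X/2 and gains at most ε X per step as long as it stays below X.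
    -- Since L ε ≤ 1/2, it stays below X until L.
    have hfin : ∀ s : ℕ, 1 ≤ s → s ≤ L → X / 2 + (s - 1) * (ε * X) ≤ X := by
      intro s _ hsL
      have h1 : (s : ℝ) - 1 ≤ L := by
        have : (s : ℝ) ≤ L := by exact_mod_cast hsL
        linarith
      have h2 : ((s : ℝ) - 1) * (ε * X) ≤ L * (ε * X) := by gcongr
      have h3 := mul_le_mul_of_nonneg_right hL hX0
      linarith
    induction t, ht1 using Nat.le_induction with
    | base =>
      intro hL1
      have h1 : ∫⁻ ω, ENNReal.ofReal ((inner ℝ u (noisyProc S τ k g 1 ω) : ℝ) ^ 2) ∂P +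
        ENNReal.ofReal a * ∫⁻ ω, ENNReal.ofReal (‖perp u (noisyProc S τ k g 1 ω)‖ ^ 2) ∂P ≤
        ENNReal.ofReal (X / 2 + ((1 : ℕ) - 1) * (ε * X)) := by
        calc _ ≤ ENNReal.ofReal A + ENNReal.ofReal a * ENNReal.ofReal (A * n) := by gcongr
          _ = ENNReal.ofReal (A + a * (A * n)) := by
            rw [← ENNReal.ofReal_mul ha, ← ENNReal.ofReal_add hA (by positivity)]
          _ ≤ _ := ENNReal.ofReal_le_ofReal (by simpa using hX)
      exact ⟨h1, le_self_add.trans (h1.trans (ENNReal.ofReal_le_ofReal (hfin 1 le_rfl hL1)))⟩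
    | succ t ht ih =>
      intro htL
      obtain ⟨ih1, ih2⟩ := ih (by omega)
      have h0 := hg.lintegral_potential_le hS hτ hk ha hak hε (t := t) (by omega)
        (Z := fun _ => 0) measurable_const
      simp only [sub_zero] at h0
      have ht' : (1 : ℝ) ≤ t := by exact_mod_cast ht
      have h1 := h0.trans (add_le_add ih1 (mul_le_mul_right ih2 (ENNReal.ofReal ε)))
      rw [← ENNReal.ofReal_mul hε0, ← ENNReal.ofReal_add (add_nonneg (by positivity)
        (mul_nonneg (by linarith) (by positivity))) (by positivity)] at h1
      have h2 : X / 2 + ((t : ℝ) - 1) * (ε * X) + ε * X =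
          X / 2 + (((t + 1 : ℕ) : ℝ) - 1) * (ε * X) := by push_cast; ring
      rw [h2] at h1
      exact ⟨h1, le_self_add.trans
        (h1.trans (ENNReal.ofReal_le_ofReal (hfin (t + 1) (by omega) htL)))⟩
  refine ⟨(hpot t ht1 htL).2, ?_⟩
  induction t, ht1 using Nat.le_induction with
  | base => exact hV.trans (ENNReal.ofReal_le_ofReal (by simpa using hD0))
  | succ t ht ih =>
    refine (hg.lintegral_perp_le hS hτ hk hr hc (t := t) (by omega)).trans ?_
    calc _ ≤ ENNReal.ofReal r * ENNReal.ofReal (r ^ (t - 1) * (A * n) + D) +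
          ENNReal.ofReal c * ENNReal.ofReal X := by
          gcongr
          · exact ih (by omega)
          · exact (hpot t ht (by omega)).2
      _ = ENNReal.ofReal (r * (r ^ (t - 1) * (A * n) + D) + c * X) := by
          rw [← ENNReal.ofReal_mul hr0, ← ENNReal.ofReal_mul hc0,
            ← ENNReal.ofReal_add (by positivity) (by positivity)]
      _ ≤ _ := by
          refine ENNReal.ofReal_le_ofReal ?_
          have h1 : r ^ (t + 1 - 1) = r * r ^ (t - 1) := by
            rw [← pow_succ', show t + 1 - 1 = t - 1 + 1 by omega]
          rw [h1]
          linarith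

/-- The aligned part moves little between two late times. -/
theorem GaussianSeq.lintegral_inner_sub_sq_le (hg : GaussianSeq P g) {S : Vec n →L[ℝ] Vec n}
    {u : Vec n} {p : ℝ} (hS : IsPowerMap S u p) {τ k a ε X B : ℝ} (hτ : 0 ≤ τ) (hk : 0 ≤ k)
    (ha : 0 ≤ a) (hak : a * ((1 - p) ^ 2 + k ^ 2 * n) + k ^ 2 ≤ a)
    (hε : k ^ 2 + a * (k ^ 2 * n) ≤ ε) (hX : 0 ≤ X) (hB : 0 ≤ B) {s L : ℕ} (hs : 1 ≤ s)
    (hM : ∀ t, 1 ≤ t → t ≤ L →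
      ∫⁻ ω, ENNReal.ofReal ((inner ℝ u (noisyProc S τ k g t ω) : ℝ) ^ 2) ∂P ≤ ENNReal.ofReal X)
    (hV : ∫⁻ ω, ENNReal.ofReal (‖perp u (noisyProc S τ k g s ω)‖ ^ 2) ∂P ≤ ENNReal.ofReal B)
    (hsL : s ≤ L) :
    ∫⁻ ω, ENNReal.ofReal (((inner ℝ u (noisyProc S τ k g L ω) : ℝ) -
      inner ℝ u (noisyProc S τ k g s ω)) ^ 2) ∂P ≤ ENNReal.ofReal (a * B + L * (ε * X)) := by
  have hε0 : 0 ≤ ε := le_trans (by positivity) hε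
  have key : ∀ t, s ≤ t → t ≤ L →
      ∫⁻ ω, ENNReal.ofReal (((inner ℝ u (noisyProc S τ k g t ω) : ℝ) -
        inner ℝ u (noisyProc S τ k g s ω)) ^ 2) ∂P +
      ENNReal.ofReal a * ∫⁻ ω, ENNReal.ofReal (‖perp u (noisyProc S τ k g t ω)‖ ^ 2) ∂P ≤
        ENNReal.ofReal (a * B + t * (ε * X)) := by
    intro t hst
    induction t, hst using Nat.le_induction with
    | base =>
      intro _
      simp only [sub_self, ne_eq, OfNat.ofNat_ne_zero, not_false_eq_true, zero_pow,
        ENNReal.ofReal_zero, lintegral_zero, zero_add]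
      calc _ ≤ ENNReal.ofReal a * ENNReal.ofReal B := by gcongr
        _ ≤ _ := by
          rw [← ENNReal.ofReal_mul ha]
          exact ENNReal.ofReal_le_ofReal (le_add_of_nonneg_right (by positivity))
    | succ t ht ih =>
      intro htL
      have hZ : Measurable[sigmaOf g {i | i ≤ t}]
          fun ω => (inner ℝ u (noisyProc S τ k g s ω) : ℝ) := by
        have h1 := measurable_noisyProc S τ k g ht
        exact (innerSL ℝ u).measurable.comp h1
      have h0 := hg.lintegral_potential_le hS hτ hk ha hak hε (t := t) (by omega) hZ
      have h1 := h0.trans (add_le_add (ih (by omega))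
        (mul_le_mul_right (hM t (by omega) (by omega)) (ENNReal.ofReal ε)))
      rw [← ENNReal.ofReal_mul hε0, ← ENNReal.ofReal_add (by positivity) (by positivity)] at h1
      refine h1.trans (ENNReal.ofReal_le_ofReal (le_of_eq ?_))
      push_cast; ring
  exact le_self_add.trans (key L hsL le_rfl)

end MomentBounds
end NoisyPower

namespace NoisyPower

/-! ### Dependence on the start along u, and anti-concentration at a constant time. -/

section Decoupling

/-- A seminorm that controls the variation of the noise scale. -/
noncomputable def noiseBound {n : ℕ} (τ k : ℝ) (w : Vec n) : ℝ := noiseScale τ w + k * ‖w‖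

lemma supNorm_add_le {n : ℕ} (x y : Vec n) : supNorm (x + y) ≤ supNorm x + supNorm y := by
  rw [supNorm, WithLp.ofLp_add]; exact norm_add_le _ _

lemma noiseScale_add_le {n : ℕ} {τ : ℝ} (hτ : 0 ≤ τ) (x y : Vec n) :
    noiseScale τ (x + y) ≤ noiseScale τ x + noiseScale τ y := by
  rw [noiseScale, noiseScale, noiseScale, ← mul_add]
  refine mul_le_mul_of_nonneg_left ?_ hτ
  have h1 := supNorm_add_le x y
  have h2 : ‖x + y‖ / n ≤ ‖x‖ / n + ‖y‖ / n := by
    rw [← add_div]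
    gcongr
    exact norm_add_le _ _
  linarith

lemma noiseScale_smul {n : ℕ} (τ a : ℝ) (x : Vec n) :
    noiseScale τ (a • x) = |a| * noiseScale τ x := by
  rw [noiseScale, noiseScale, supNorm_smul, norm_smul, Real.norm_eq_abs]; ring

lemma noiseBound_nonneg {n : ℕ} {τ k : ℝ} (hτ : 0 ≤ τ) (hk : 0 ≤ k) (x : Vec n) :
    0 ≤ noiseBound τ k x := add_nonneg (noiseScale_nonneg hτ x) (by positivity)

lemma noiseBound_add_le {n : ℕ} {τ k : ℝ} (hτ : 0 ≤ τ) (hk : 0 ≤ k) (x y : Vec n) :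
    noiseBound τ k (x + y) ≤ noiseBound τ k x + noiseBound τ k y := by
  have h1 := noiseScale_add_le hτ x y
  have h2 := mul_le_mul_of_nonneg_left (norm_add_le x y) hk
  simp only [noiseBound]
  linarith

lemma noiseBound_smul {n : ℕ} (τ k a : ℝ) (x : Vec n) :
    noiseBound τ k (a • x) = |a| * noiseBound τ k x := by
  rw [noiseBound, noiseBound, noiseScale_smul, norm_smul, Real.norm_eq_abs]; ring

lemma abs_cappedScale_sub_le {n : ℕ} {τ k : ℝ} (hτ : 0 ≤ τ) (hk : 0 ≤ k) (t : ℕ) (x y : Vec n) :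
    |cappedScale τ k t x - cappedScale τ k t y| ≤ noiseBound τ k (x - y) := by
  have hF : |noiseScale τ x - noiseScale τ y| ≤ noiseScale τ (x - y) := by
    have h1 := noiseScale_add_le hτ (x - y) y
    have h2 := noiseScale_add_le hτ (y - x) x
    have h3 : noiseScale τ (y - x) = noiseScale τ (x - y) := by
      rw [← neg_sub, ← neg_one_smul ℝ (x - y), noiseScale_smul]; simp
    rw [sub_add_cancel] at h1 h2
    rw [abs_le]; constructor <;> linarith
  have hN : |k * ‖x‖ - k * ‖y‖| ≤ k * ‖x - y‖ := by
    rw [← mul_sub, abs_mul, abs_of_nonneg hk]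
    exact mul_le_mul_of_nonneg_left (abs_norm_sub_norm_le x y) hk
  have hn : 0 ≤ k * ‖x - y‖ := by positivity
  have hf := noiseScale_nonneg hτ (x - y)
  unfold cappedScale noiseBound
  split_ifs
  · linarith
  · exact (abs_min_sub_min_le_max _ _ _ _).trans (max_le (by linarith) (by linarith))

lemma IsPowerMap.pow_fixed {n : ℕ} {S : Vec n →L[ℝ] Vec n} {u : Vec n} {p : ℝ}
    (hS : IsPowerMap S u p) (j : ℕ) : (S ^ j) u = u := by
  induction j with
  | zero => rfl
  | succ j ih => rw [pow_succ, mul_apply_eq_comp, hS.map_fixed, ih]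

lemma IsPowerMap.norm_pow_apply_le {n : ℕ} {S : Vec n →L[ℝ] Vec n} {u : Vec n} {p : ℝ}
    (hS : IsPowerMap S u p) (j : ℕ) (x : Vec n) : ‖(S ^ j) x‖ ≤ ‖x‖ := by
  induction j generalizing x with
  | zero => exact le_rfl
  | succ j ih =>
    rw [pow_succ, mul_apply_eq_comp]
    exact (ih _).trans (hS.norm_apply_le x)

/-- Changing the start along `u` shifts the aligned part by nearly the same amount. -/
theorem abs_inner_sub_sub_le {n : ℕ} {S : Vec n →L[ℝ] Vec n} {u : Vec n} {p : ℝ}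
    (hS : IsPowerMap S u p) {τ k K α : ℝ} (hτ : 0 ≤ τ) (hk : 0 ≤ k) {x y : Vec n}
    {z : ℕ → Vec n} (hxy : x = y + α • u) {r : ℕ}
    (hz : ∀ i < r, ∀ j < r, noiseBound τ k ((S ^ j) (z i)) ≤ K)
    (hu : ∀ i < r, |(inner ℝ u (z i) : ℝ)| ≤ K) :
    |(inner ℝ u (noisySeq S (cappedScale τ k) x z r) : ℝ) -
      inner ℝ u (noisySeq S (cappedScale τ k) y z r) - α| ≤
        |α| * noiseBound τ k u * (1 + K) ^ r := by
  set β := |α| * noiseBound τ k u with hβ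
  have hβ0 : 0 ≤ β := mul_nonneg (abs_nonneg _) (noiseBound_nonneg hτ hk u)
  -- S does not contract the sup norm, so the difference of the two processes is controlled after
  -- every further power S^j at once. The start u itself is fixed by all S^j.
  have key : ∀ t ≤ r, (∀ j, j + t ≤ r → noiseBound τ k ((S ^ j)
      (noisySeq S (cappedScale τ k) x z t - noisySeq S (cappedScale τ k) y z t)) ≤
        β * (1 + K) ^ t) ∧
      |(inner ℝ u (noisySeq S (cappedScale τ k) x z t) : ℝ) -
        inner ℝ u (noisySeq S (cappedScale τ k) y z t) - α| ≤ β * (1 + K) ^ t := by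
    intro t
    induction t with
    | zero =>
      intro _
      simp only [noisySeq, pow_zero, mul_one]
      refine ⟨fun j _ => ?_, ?_⟩
      · rw [hxy, add_sub_cancel_left, map_smul, hS.pow_fixed, noiseBound_smul]
      · rw [hxy, inner_add_right, real_inner_smul_right, real_inner_self_eq_norm_sq,
          hS.norm_fixed]
        simpa using hβ0
    | succ t ih =>
      intro htr
      obtain ⟨ih1, ih2⟩ := ih (by omega)
      set w := noisySeq S (cappedScale τ k) x z t
      set w' := noisySeq S (cappedScale τ k) y z t
      have hΔ : |cappedScale τ k t w - cappedScale τ k t w'| ≤ β * (1 + K) ^ t :=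
        (abs_cappedScale_sub_le hτ hk t w w').trans (ih1 0 (by omega))
      have hK : 0 ≤ K := (abs_nonneg _).trans (hu t (by omega))
      simp only [noisySeq]
      refine ⟨fun j hj => ?_, ?_⟩
      · have h1 : (S ^ j) (S w + cappedScale τ k t w • z t - (S w' + cappedScale τ k t w' • z t)) =
            (S ^ (j + 1)) (w - w') +
              (cappedScale τ k t w - cappedScale τ k t w') • (S ^ j) (z t) := by
          rw [pow_succ, mul_apply_eq_comp, ← map_smul, ← map_add, map_sub S, sub_smul]
          congr 1
          abel
        rw [h1]
        refine (noiseBound_add_le hτ hk _ _).trans ?_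
        rw [noiseBound_smul]
        have h2 := ih1 (j + 1) (by omega)
        have h3 := mul_le_mul hΔ (hz t (by omega) j (by omega)) (noiseBound_nonneg hτ hk _)
          (by positivity)
        calc _ ≤ β * (1 + K) ^ t + β * (1 + K) ^ t * K := add_le_add h2 h3
          _ = _ := by ring
      · have h3 := mul_le_mul hΔ (hu t (by omega)) (abs_nonneg _) (by positivity)
        rw [← abs_mul] at h3
        rw [inner_add_right, inner_add_right, hS.inner_map, hS.inner_map, real_inner_smul_right,
          real_inner_smul_right]
        calc _ = |((inner ℝ u w : ℝ) - inner ℝ u w' - α) +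
              (cappedScale τ k t w - cappedScale τ k t w') * inner ℝ u (z t)| := by
              simp only [w, w']; ring_nf
          _ ≤ _ := abs_add_le _ _
          _ ≤ β * (1 + K) ^ t + β * (1 + K) ^ t * K := add_le_add ih2 h3
          _ = _ := by ring
  exact (key r le_rfl).2

lemma measure_lt_le_of_lintegral_sq_le {Ω : Type*} [MeasurableSpace Ω] {P : Measure Ω} {f : Ω → ℝ}
    (hf : AEMeasurable f P) {Q K : ℝ} (hK : 0 < K)
    (hQ : ∫⁻ ω, ENNReal.ofReal (f ω ^ 2) ∂P ≤ ENNReal.ofReal Q) :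
    P {ω | K < |f ω|} ≤ ENNReal.ofReal (Q / K ^ 2) := by
  have h1 : {ω | K < |f ω|} ⊆ {ω | ENNReal.ofReal (K ^ 2) ≤ ENNReal.ofReal (f ω ^ 2)} := by
    intro ω hω
    refine ENNReal.ofReal_le_ofReal ?_
    rw [← sq_abs (f ω)]
    exact pow_le_pow_left₀ hK.le (le_of_lt hω) 2
  refine (measure_mono h1).trans ?_
  refine (meas_ge_le_lintegral_div (by fun_prop) (by positivity) ENNReal.ofReal_ne_top).trans ?_
  rw [ENNReal.ofReal_div_of_pos (by positivity)]
  gcongr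

variable {n : ℕ} {Ω : Type*} [MeasurableSpace Ω] {P : Measure Ω} {g : ℕ → Ω → Vec n}

lemma measurable_noiseBound (τ k : ℝ) : Measurable (noiseBound τ k : Vec n → ℝ) :=
  (measurable_noiseScale τ).add (measurable_norm.const_mul k)

/-- The aligned part of the process is unlikely to be small at a fixed time. -/
theorem GaussianSeq.measure_abs_inner_le (hg : GaussianSeq P g) {S : Vec n →L[ℝ] Vec n}
    {u : Vec n} {p : ℝ} (hS : IsPowerMap S u p) {τ k Q K κ : ℝ} (hτ : 0 ≤ τ) (hk : 0 ≤ k)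
    (hQ : ∀ j : ℕ, ∫⁻ x, ENNReal.ofReal (noiseBound τ k ((S ^ j) x) ^ 2) ∂(stdGaussian (Vec n)) ≤
      ENNReal.ofReal Q) (hK : 0 < K) (hQ0 : 0 ≤ Q) {r : ℕ}
    (hκ : K * noiseBound τ k u * (1 + K) ^ r ≤ κ) :
    P {ω | |(inner ℝ u (noisyProc S τ k g r ω) : ℝ)| ≤ κ} ≤
      ENNReal.ofReal (2 * κ + (r * r * (Q / K ^ 2) + (r + 1) * (1 / K ^ 2))) := by
  have hκ0 : 0 ≤ κ := le_trans (mul_nonneg (mul_nonneg hK.le (noiseBound_nonneg hτ hk u))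
    (by positivity)) hκ
  have hperp := measurable_perp u
  -- The second summand is the process started from the orthogonal part of g 0 only, hence
  -- independent of ⟨u, g 0⟩. Replacing the true aligned part by this sum costs at most κ, so the
  -- threshold κ becomes 2κ.
  set A : Set Ω := {ω | |(inner ℝ u (g 0 ω) : ℝ) + inner ℝ u (noisySeq S (cappedScale τ k)
    (perp u (g 0 ω)) (fun i => g (i + 1) ω) r)| ≤ 2 * κ} with hA
  set B : ℕ → ℕ → Set Ω := fun i j => {ω | K < |noiseBound τ k ((S ^ j) (g (i + 1) ω))|} with hB
  set C : ℕ → Set Ω := fun i => {ω | K < |(inner ℝ u (g i ω) : ℝ)|} with hC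
  have hsub : {ω | |(inner ℝ u (noisyProc S τ k g r ω) : ℝ)| ≤ κ} ⊆
      A ∪ ((⋃ i ∈ Finset.range r, ⋃ j ∈ Finset.range r, B i j) ∪ ⋃ i ∈ Finset.range (r + 1), C i) := by
    intro ω hω
    by_contra hcon
    simp only [Set.mem_union, Set.mem_iUnion, not_or, not_exists, Finset.mem_range, hA, hB, hC,
      Set.mem_ofPred_eq, not_le, not_lt] at hcon
    obtain ⟨h1, h2, h3⟩ := hcon
    have h4 := abs_inner_sub_sub_le hS (K := K) (α := inner ℝ u (g 0 ω)) hτ hk (x := g 0 ω)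
      (y := perp u (g 0 ω)) (z := fun i => g (i + 1) ω) (by rw [perp, sub_add_cancel]) (r := r)
      (fun i hi j hj => (le_abs_self _).trans (h2 i hi j hj))
      (fun i hi => h3 (i + 1) (by omega))
    have h5 : |(inner ℝ u (g 0 ω) : ℝ)| * noiseBound τ k u * (1 + K) ^ r ≤ κ := by
      refine le_trans ?_ hκ
      have := noiseBound_nonneg hτ hk u
      have := h3 0 (by omega)
      gcongr
    have h6 : |(inner ℝ u (noisySeq S (cappedScale τ k) (g 0 ω) (fun i => g (i + 1) ω) r) : ℝ)| ≤ κ :=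
      hω
    have h7 := h4.trans h5
    rw [abs_le] at h6 h7
    rw [lt_abs] at h1
    rcases h1 with h1 | h1 <;> linarith
  have hAle : P A ≤ ENNReal.ofReal (2 * κ) := by
    have hZ : Measurable[sigmaOf g {i | 1 ≤ i}] fun ω i => g (i + 1) ω := by
      refine @measurable_pi_lambda Ω ℕ (fun _ => Vec n) (sigmaOf g {i | 1 ≤ i}) _ _ fun i => ?_
      exact measurable_sigmaOf g (T := {i | 1 ≤ i}) (show 1 ≤ i + 1 by omega)
    have hm : ∀ z : ℕ → Vec n, Measurable fun y =>
        (inner ℝ u (noisySeq S (cappedScale τ k) y z r) : ℝ) := fun z =>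
      (innerSL ℝ u).measurable.comp
        (measurable_noisySeq S (measurable_cappedScale τ k) measurable_id fun i _ => measurable_const)
    have hmS : Measurable fun q : (ℕ → Vec n) × Vec n =>
        (inner ℝ u (noisySeq S (cappedScale τ k) (perp u q.2) q.1 r) : ℝ) :=
      (innerSL ℝ u).measurable.comp
        (measurable_noisySeq S (measurable_cappedScale τ k) (hperp.comp measurable_snd)
          fun i _ => (measurable_pi_apply i).comp measurable_fst)
    exact hg.measure_freeze_le (j := 0) (T := {i | 1 ≤ i}) (by simp) hZ
      (S := {q | |(inner ℝ u q.2 : ℝ) + inner ℝ u (noisySeq S (cappedScale τ k) (perp u q.2) q.1 r)| ≤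
        2 * κ}) (measurableSet_le (by fun_prop) measurable_const)
      fun z => stdGaussian_abs_inner_add_le hS.norm_fixed (hm z) (2 * κ)
  have hBle : ∀ i j, P (B i j) ≤ ENNReal.ofReal (Q / K ^ 2) := by
    intro i j
    have hSm := (S ^ j).measurable
    have hNm := measurable_noiseBound (n := n) τ k
    have hgm := hg.meas (i + 1)
    refine measure_lt_le_of_lintegral_sq_le (by fun_prop) hK ?_
    exact (hg.lintegral_comp (i + 1)
      (f := fun x => ENNReal.ofReal (noiseBound τ k ((S ^ j) x) ^ 2)) (by fun_prop)).trans_le (hQ j)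
  have hCle : ∀ i, P (C i) ≤ ENNReal.ofReal (1 / K ^ 2) := by
    intro i
    have hgm := hg.meas i
    refine measure_lt_le_of_lintegral_sq_le (by fun_prop) hK ?_
    exact (hg.lintegral_comp i
      (f := fun x => ENNReal.ofReal ((inner ℝ u x : ℝ) ^ 2)) (by fun_prop)).trans_le
      (lintegral_inner_sq_stdGaussian hS.norm_fixed).le
  refine (measure_mono hsub).trans ((measure_union_le _ _).trans ?_)
  rw [ENNReal.ofReal_add (by positivity) (by positivity)]
  refine add_le_add hAle ((measure_union_le _ _).trans ?_)
  rw [ENNReal.ofReal_add (by positivity) (by positivity)]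
  refine add_le_add ?_ ?_
  · refine (measure_biUnion_finset_le _ _).trans ?_
    calc _ ≤ ∑ i ∈ Finset.range r, ∑ j ∈ Finset.range r, ENNReal.ofReal (Q / K ^ 2) := by
          refine Finset.sum_le_sum fun i _ => (measure_biUnion_finset_le _ _).trans ?_
          exact Finset.sum_le_sum fun j _ => hBle i j
      _ = _ := by
          simp only [Finset.sum_const, Finset.card_range, nsmul_eq_mul]
          rw [ENNReal.ofReal_mul (by positivity), ENNReal.ofReal_mul (by positivity),
            ENNReal.ofReal_natCast, mul_assoc]
  · refine (measure_biUnion_finset_le _ _).trans ?_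
    calc _ ≤ ∑ i ∈ Finset.range (r + 1), ENNReal.ofReal (1 / K ^ 2) :=
          Finset.sum_le_sum fun i _ => hCle i
      _ = _ := by
          simp only [Finset.sum_const, Finset.card_range, nsmul_eq_mul]
          rw [ENNReal.ofReal_mul (by positivity), show ((r : ℝ) + 1) = ((r + 1 : ℕ) : ℝ) by push_cast; rfl,
            ENNReal.ofReal_natCast]

end Decoupling
end NoisyPower

namespace NoisyPower

/-! ### The ratio of orthogonal to aligned part at time L. -/

section RatioBound

variable {n : ℕ} {Ω : Type*} [MeasurableSpace Ω] {P : Measure Ω} {g : ℕ → Ω → Vec n}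

lemma exists_inner_eq_apply (A : Vec n →L[ℝ] Vec n) (hA : ∀ x, ‖A x‖ ≤ ‖x‖) (i : Fin n) :
    ∃ a : Vec n, ‖a‖ ≤ 1 ∧ ∀ x, A x i = inner ℝ a x := by
  refine ⟨(InnerProductSpace.toDual ℝ (Vec n)).symm ((EuclideanSpace.proj i).comp A), ?_, ?_⟩
  · rw [LinearIsometryEquiv.norm_map]
    refine ContinuousLinearMap.opNorm_le_bound _ zero_le_one fun x => ?_
    rw [one_mul]
    refine le_trans ?_ (hA x)
    exact (abs_apply_le_supNorm (A x) i).trans (supNorm_le_norm _)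
  · intro x
    rw [InnerProductSpace.toDual_symm_apply]
    rfl

/-- In the regime τ² log n ≤ 64 the sup norm of a Gaussian, of order √(log n), is compensated by τ,
so the bound is an absolute constant. -/
lemma lintegral_noiseBound_sq_le [NeZero n] {S : Vec n →L[ℝ] Vec n} {u : Vec n} {p : ℝ}
    (hS : IsPowerMap S u p) {τ k : ℝ} (hτ : 0 ≤ τ) (hk : 0 ≤ k) (hn : 1 ≤ Real.log n)
    (hτn : τ ^ 2 * Real.log n ≤ 64) (hkn : k ^ 2 * n ≤ 1) (j : ℕ) :
    ∫⁻ x, ENNReal.ofReal (noiseBound τ k ((S ^ j) x) ^ 2) ∂(stdGaussian (Vec n)) ≤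
      ENNReal.ofReal 2000 := by
  have hn1 : (1 : ℝ) ≤ n := by exact_mod_cast Nat.pos_of_ne_zero (NeZero.ne n)
  have hsup := lintegral_supNorm_sq_le ((S ^ j : Vec n →L[ℝ] Vec n) : Vec n →ₗ[ℝ] Vec n)
    fun i => exists_inner_eq_apply (S ^ j) (hS.norm_pow_apply_le j) i
  have hSm := (S ^ j).measurable
  have hsm : Measurable (supNorm : Vec n → ℝ) := continuous_supNorm.measurable
  have hτ64 : τ ^ 2 ≤ 64 := by nlinarith [sq_nonneg τ]
  set b := 2 * (τ / n + k) ^ 2 with hb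
  have hbn : b * n ≤ 260 := by
    have h1 : (τ / n + k) ^ 2 ≤ 2 * (τ / n) ^ 2 + 2 * k ^ 2 := by nlinarith [sq_nonneg (τ / n - k)]
    have h2 : (τ / n) ^ 2 * n ≤ 64 := by
      rw [div_pow, sq (n : ℝ), div_mul_eq_mul_div, div_le_iff₀ (by positivity)]
      nlinarith
    rw [hb]
    have h3 : (τ / n + k) ^ 2 * n ≤ (2 * (τ / n) ^ 2 + 2 * k ^ 2) * n := by gcongr
    nlinarith
  calc _ ≤ ∫⁻ x, (ENNReal.ofReal (2 * τ ^ 2) * ENNReal.ofReal (supNorm ((S ^ j) x) ^ 2) +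
        ENNReal.ofReal b * ENNReal.ofReal (‖x‖ ^ 2)) ∂(stdGaussian (Vec n)) := by
        refine lintegral_mono fun x => ?_
        rw [← ENNReal.ofReal_mul (by positivity), ← ENNReal.ofReal_mul (by positivity),
          ← ENNReal.ofReal_add (by positivity) (by positivity)]
        refine ENNReal.ofReal_le_ofReal ?_
        have h1 := hS.norm_pow_apply_le j x
        have h2 : noiseBound τ k ((S ^ j) x) ≤ τ * supNorm ((S ^ j) x) + (τ / n + k) * ‖x‖ := by
          have h3 : (τ / n + k) * ‖(S ^ j) x‖ ≤ (τ / n + k) * ‖x‖ := by gcongr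
          refine le_trans (le_of_eq ?_) (add_le_add_right h3 _)
          rw [noiseBound, noiseScale]; ring
        have h3 := pow_le_pow_left₀ (noiseBound_nonneg hτ hk _) h2 2
        refine h3.trans ?_
        rw [hb]
        nlinarith [sq_nonneg (τ * supNorm ((S ^ j) x) - (τ / n + k) * ‖x‖)]
    _ = ENNReal.ofReal (2 * τ ^ 2) * ∫⁻ x, ENNReal.ofReal (supNorm ((S ^ j) x) ^ 2)
          ∂(stdGaussian (Vec n)) + ENNReal.ofReal b * ENNReal.ofReal n := by
        rw [lintegral_add_left (by fun_prop), lintegral_const_mul _ (by fun_prop),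
          lintegral_const_mul _ (by fun_prop), lintegral_norm_sq_stdGaussian]
    _ ≤ ENNReal.ofReal (2 * τ ^ 2) * ENNReal.ofReal (4 * (Real.log n + 2)) +
          ENNReal.ofReal b * ENNReal.ofReal n := by gcongr; exact hsup
    _ ≤ _ := by
        rw [← ENNReal.ofReal_mul (by positivity), ← ENNReal.ofReal_mul (by positivity),
          ← ENNReal.ofReal_add (by positivity) (by positivity)]
        exact ENNReal.ofReal_le_ofReal (by nlinarith)

/-- With x = ϖp, Bernoulli gives s x ≤ (1 + x)^(s-1), and (1 - x)(1 + x) ≤ 1. The bound is uniform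
in p, so the constant time s need not depend on the spectral gap. -/
lemma mul_one_sub_pow_le {ϖ p : ℝ} (hϖ : 0 < ϖ) (hp : 0 ≤ p) (h1 : ϖ * p ≤ 1) {s : ℕ}
    (hs : 1 ≤ s) : p * (1 - ϖ * p) ^ (s - 1) ≤ 1 / (ϖ * s) := by
  set x := ϖ * p with hx
  have hx0 : 0 ≤ x := by positivity
  have hs0 : (1 : ℝ) ≤ s := by exact_mod_cast hs
  have h2 : 1 + ((s - 1 : ℕ) : ℝ) * x ≤ (1 + x) ^ (s - 1) :=
    one_add_mul_le_pow (by linarith) (s - 1)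
  rw [Nat.cast_sub hs, Nat.cast_one] at h2
  have h3 : (1 - x) ^ (s - 1) * (1 + x) ^ (s - 1) ≤ 1 := by
    rw [← mul_pow]
    exact pow_le_one₀ (mul_nonneg (by linarith) (by linarith)) (by nlinarith)
  have h4 : 0 ≤ (1 - x) ^ (s - 1) := pow_nonneg (by linarith) _
  rw [le_div_iff₀ (by positivity)]
  have h5 : s * x ≤ 1 + (s - 1) * x := by linarith
  calc p * (1 - x) ^ (s - 1) * (ϖ * s) = (1 - x) ^ (s - 1) * (s * x) := by rw [hx]; ring
    _ ≤ (1 - x) ^ (s - 1) * (1 + x) ^ (s - 1) := by gcongr; linarith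
    _ ≤ 1 := h3

/-- The weight a = θ² p/(ϖ n) solves a ϖ p = k²: the contraction of the orthogonal part then pays
for the noise that it injects into the aligned part. -/
lemma moment_parameters {n p θ ϖ k : ℝ} (hn : 0 < n) (hp : 0 < p) (hp1 : p ≤ 1) (hθ : 0 < θ)
    (hθ1 : θ < 1) (hϖ : ϖ = 1 - θ ^ 2) (hk : k ^ 2 * n = θ ^ 2 * p ^ 2) :
    (1 - p) ^ 2 + k ^ 2 * n ≤ 1 - ϖ * p ∧
    θ ^ 2 * p / (ϖ * n) * ((1 - p) ^ 2 + k ^ 2 * n) + k ^ 2 ≤ θ ^ 2 * p / (ϖ * n) ∧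
    k ^ 2 + θ ^ 2 * p / (ϖ * n) * (k ^ 2 * n) ≤ 2 * p ^ 2 / (ϖ * n) ∧ k ^ 2 * n ≤ p ^ 2 := by
  have hθ2 : θ ^ 2 < 1 := by nlinarith
  have hθ0 : 0 ≤ θ ^ 2 := sq_nonneg θ
  have hϖ0 : 0 < ϖ := by rw [hϖ]; linarith
  have hϖ1 : ϖ ≤ 1 := by rw [hϖ]; linarith
  have hk2 : k ^ 2 = θ ^ 2 * p ^ 2 / n := by rw [← hk]; field_simp
  have ha0 : 0 ≤ θ ^ 2 * p / (ϖ * n) := by positivity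
  have hr1 : (1 - p) ^ 2 + k ^ 2 * n ≤ 1 - ϖ * p := by
    have := mul_nonneg (mul_nonneg hp.le (sub_nonneg.2 hp1)) (show 0 ≤ 1 + θ ^ 2 by positivity)
    rw [hk, hϖ]
    linarith
  refine ⟨hr1, ?_, ?_, ?_⟩
  · have han : θ ^ 2 * p / (ϖ * n) * (ϖ * p) = k ^ 2 := by rw [hk2]; field_simp
    have := mul_le_mul_of_nonneg_left hr1 ha0
    linarith
  · rw [hk, hk2]
    have h1 : θ ^ 2 * p ^ 2 / n ≤ p ^ 2 / (ϖ * n) := by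
      rw [div_le_div_iff₀ hn (by positivity)]
      have h2 : θ ^ 2 * ϖ ≤ 1 := mul_le_one₀ hθ2.le hϖ0.le hϖ1
      have h3 := mul_le_mul_of_nonneg_left h2 (show 0 ≤ p ^ 2 * n by positivity)
      linarith
    have h2 : θ ^ 2 * p / (ϖ * n) * (θ ^ 2 * p ^ 2) ≤ p ^ 2 / (ϖ * n) := by
      rw [div_mul_eq_mul_div]
      gcongr
      have h3 : θ ^ 2 * p * θ ^ 2 ≤ 1 :=
        mul_le_one₀ (mul_le_one₀ hθ2.le hp.le hp1) hθ0 hθ2.le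
      calc _ = (θ ^ 2 * p * θ ^ 2) * p ^ 2 := by ring
        _ ≤ 1 * p ^ 2 := by gcongr
        _ = _ := one_mul _
    calc _ ≤ p ^ 2 / (ϖ * n) + p ^ 2 / (ϖ * n) := add_le_add h1 h2
      _ = _ := by ring
  · rw [hk]
    exact mul_le_of_le_one_left (sq_nonneg p) hθ2.le

/-- With high probability the orthogonal part is bounded by a multiple of the aligned part. -/
theorem GaussianSeq.measure_ratio_le [NeZero n] (hg : GaussianSeq P g) {S : Vec n →L[ℝ] Vec n}
    {u : Vec n} {p : ℝ} (hS : IsPowerMap S u p) {τ k Q K κ θ ϖ A X G M : ℝ} (hτ : 0 ≤ τ)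
    (hθ : 0 < θ) (hθ1 : θ < 1) (hϖ : ϖ = 1 - θ ^ 2) (hk : k = θ * p / √n) (hA : A = 1 + Q)
    (hX : X = 2 * (A * (1 + 1 / ϖ))) (hQ0 : 0 ≤ Q)
    (hQ : ∀ j : ℕ, ∫⁻ x, ENNReal.ofReal (noiseBound τ k ((S ^ j) x) ^ 2) ∂(stdGaussian (Vec n)) ≤
      ENNReal.ofReal Q) (hK : 0 < K) (hκ0 : 0 < κ) {s L : ℕ} (hs : 1 ≤ s) (hsL : s ≤ L)
    (hκ : K * noiseBound τ k u * (1 + K) ^ s ≤ κ) (hLG : L * p ≤ G) (hG : G ≤ ϖ * n / 4)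
    (hLn : (1 - ϖ * p) ^ (L - 1) * n ≤ 1) (hM : 0 < M) :
    P {ω | ¬ ((inner ℝ u (noisyProc S τ k g L ω) : ℝ) ≠ 0 ∧
      ‖perp u (noisyProc S τ k g L ω)‖ ≤
        2 * M / κ * |(inner ℝ u (noisyProc S τ k g L ω) : ℝ)|)} ≤
      ENNReal.ofReal ((2 * κ + (s * s * (Q / K ^ 2) + (s + 1) * (1 / K ^ 2))) +
        ((A / (ϖ ^ 2 * s) + X / (ϖ ^ 2 * n) + 2 * X * G / (ϖ * n)) / (κ / 2) ^ 2 +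
          (A + X / ϖ) / M ^ 2)) := by
  have hn1 : (1 : ℝ) ≤ n := by exact_mod_cast Nat.pos_of_ne_zero (NeZero.ne n)
  have hn0 : (0 : ℝ) < n := by linarith
  have hs1 : (1 : ℝ) ≤ s := by exact_mod_cast hs
  have hp := hS.pos
  have hp1 := hS.le_one
  have hθ2 : θ ^ 2 < 1 := by nlinarith
  have hϖ0 : 0 < ϖ := by rw [hϖ]; linarith
  have hϖ1 : ϖ ≤ 1 := by rw [hϖ]; nlinarith
  have hϖp : ϖ * p ≤ 1 := by nlinarith
  have hA0 : 0 < A := by rw [hA]; linarith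
  have hX0 : 0 < X := by rw [hX]; positivity
  have hk0 : 0 ≤ k := by rw [hk]; positivity
  have hkn : k ^ 2 * n = θ ^ 2 * p ^ 2 := by
    rw [hk, div_pow, Real.sq_sqrt hn0.le]; field_simp
  have hk2 : k ^ 2 = θ ^ 2 * p ^ 2 / n := by rw [← hkn]; field_simp
  have hQ1 : ∫⁻ x, ENNReal.ofReal (noiseScale τ x ^ 2) ∂(stdGaussian (Vec n)) ≤
      ENNReal.ofReal Q := by
    refine le_trans (lintegral_mono fun x => ENNReal.ofReal_le_ofReal ?_) (hQ 0)
    refine pow_le_pow_left₀ (noiseScale_nonneg hτ x) ?_ 2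
    exact le_add_of_nonneg_right (by positivity)
  obtain ⟨hr1, hak, hεk, hc⟩ := moment_parameters hn0 hp hp1 hθ hθ1 hϖ hkn
  set a := θ ^ 2 * p / (ϖ * n) with ha
  set ε := 2 * p ^ 2 / (ϖ * n) with hε
  set r := 1 - ϖ * p with hr
  -- D is the fixed point of V ↦ r V + p² X.
  set D := p * X / ϖ with hD
  have ha0 : 0 ≤ a := by positivity
  have hr0 : 0 ≤ r := by rw [hr]; linarith
  have hDr : r * D + p ^ 2 * X ≤ D := by
    rw [hr, hD]
    refine le_of_eq ?_
    field_simp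
    ring
  have hAX : A + a * (A * n) ≤ X / 2 := by
    have h1 : a * n ≤ 1 / ϖ := by
      rw [ha]
      have : θ ^ 2 * p / (ϖ * n) * n = θ ^ 2 * p / ϖ := by field_simp
      rw [this]
      gcongr
      exact mul_le_one₀ hθ2.le hp.le hp1
    have h2 := mul_le_mul_of_nonneg_left h1 hA0.le
    rw [hX]
    linarith
  have hLε : L * ε ≤ 1 / 2 := by
    have h1 : L * ε = (L * p) * (2 * p / (ϖ * n)) := by rw [hε]; ring
    rw [h1]
    have h2 : (L : ℝ) * p ≤ ϖ * n / 4 := hLG.trans hG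
    calc _ ≤ ϖ * n / 4 * (2 * p / (ϖ * n)) := by gcongr
      _ = p / 2 := by field_simp; ring
      _ ≤ _ := by linarith
  have hD0 : 0 ≤ D := by positivity
  have hmom : ∀ t : ℕ, 1 ≤ t → t ≤ L → _ := fun t h1 h2 =>
    hg.moments_le hS (τ := τ) hτ hk0 ha0 hak hεk hr1 hc hA0.le hAX hD0 hDr
      (hA ▸ hg.lintegral_inner_one_le hS hQ0 hQ1) (hA ▸ hg.lintegral_perp_one_le hS hQ0 hQ1)
      hLε h1 h2
  have hdiff := hg.lintegral_inner_sub_sq_le hS (τ := τ) hτ hk0 ha0 hak hεk hX0.le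
    (B := r ^ (s - 1) * (A * n) + D) (by positivity) hs (fun t h1 h2 => (hmom t h1 h2).1)
    (hmom s hs hsL).2 hsL
  have hanti := hg.measure_abs_inner_le hS hτ hk0 hQ hK hQ0 hκ
  have hW := measurable_proc hg S τ k
  have hperp := measurable_perp u
  have hE1 : P {ω | κ / 2 < |(inner ℝ u (noisyProc S τ k g L ω) : ℝ) -
      inner ℝ u (noisyProc S τ k g s ω)|} ≤
      ENNReal.ofReal ((A / (ϖ ^ 2 * s) + X / (ϖ ^ 2 * n) + 2 * X * G / (ϖ * n)) / (κ / 2) ^ 2) := by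
    have hWL := hW L
    have hWs := hW s
    refine measure_lt_le_of_lintegral_sq_le (by fun_prop) (by positivity)
      (hdiff.trans (ENNReal.ofReal_le_ofReal ?_))
    have h1 : a * (r ^ (s - 1) * (A * n)) ≤ A / (ϖ ^ 2 * s) := by
      have h2 := mul_one_sub_pow_le hϖ0 hp.le hϖp hs
      have h3 : a * (r ^ (s - 1) * (A * n)) = θ ^ 2 * (A / ϖ * (p * r ^ (s - 1))) := by
        rw [ha]; field_simp
      rw [h3]
      calc _ ≤ 1 * (A / ϖ * (1 / (ϖ * s))) := by gcongr
        _ = _ := by field_simp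
    have h4 : a * D ≤ X / (ϖ ^ 2 * n) := by
      have h5 : a * D = θ ^ 2 * p ^ 2 * (X / (ϖ ^ 2 * n)) := by rw [ha, hD]; field_simp
      rw [h5]
      refine mul_le_of_le_one_left (by positivity) ?_
      exact mul_le_one₀ hθ2.le (sq_nonneg p) (pow_le_one₀ hp.le hp1)
    have h6 : L * (ε * X) ≤ 2 * X * G / (ϖ * n) := by
      have h7 : L * (ε * X) = (2 * X / (ϖ * n)) * (p * (L * p)) := by rw [hε]; ring
      have h8 : 2 * X * G / (ϖ * n) = (2 * X / (ϖ * n)) * G := by ring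
      rw [h7, h8]
      gcongr
      refine le_trans ?_ hLG
      exact mul_le_of_le_one_left (by positivity) hp1
    rw [mul_add]
    linarith
  have hE2 : P {ω | M < |‖perp u (noisyProc S τ k g L ω)‖|} ≤
      ENNReal.ofReal ((A + X / ϖ) / M ^ 2) := by
    have hWL := hW L
    refine measure_lt_le_of_lintegral_sq_le (by fun_prop) hM
      ((hmom L (hs.trans hsL) le_rfl).2.trans (ENNReal.ofReal_le_ofReal ?_))
    have h1 : r ^ (L - 1) * (A * n) ≤ A := by
      have := mul_le_mul_of_nonneg_left hLn hA0.le
      linarith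
    have h2 : D ≤ X / ϖ := by
      rw [hD]; gcongr; exact mul_le_of_le_one_left hX0.le hp1
    linarith
  -- If the aligned part exceeds κ at time s and moves by at most κ/2 until L, it exceeds κ/2 there.
  -- With orthogonal part at most M the ratio is below 2M/κ.
  have hsub : {ω | ¬ ((inner ℝ u (noisyProc S τ k g L ω) : ℝ) ≠ 0 ∧
      ‖perp u (noisyProc S τ k g L ω)‖ ≤
        2 * M / κ * |(inner ℝ u (noisyProc S τ k g L ω) : ℝ)|)} ⊆
      {ω | |(inner ℝ u (noisyProc S τ k g s ω) : ℝ)| ≤ κ} ∪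
      ({ω | κ / 2 < |(inner ℝ u (noisyProc S τ k g L ω) : ℝ) -
        inner ℝ u (noisyProc S τ k g s ω)|} ∪ {ω | M < |‖perp u (noisyProc S τ k g L ω)‖|}) := by
    intro ω hω
    by_contra hcon
    simp only [Set.mem_union, Set.mem_ofPred_eq, not_or, not_le, not_lt, abs_norm] at hcon
    obtain ⟨h1, h2, h3⟩ := hcon
    refine hω ?_
    have h4 := abs_sub_abs_le_abs_sub (inner ℝ u (noisyProc S τ k g s ω) : ℝ)
      (inner ℝ u (noisyProc S τ k g L ω))
    rw [abs_sub_comm] at h4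
    have h5 : κ / 2 < |(inner ℝ u (noisyProc S τ k g L ω) : ℝ)| := by linarith
    refine ⟨abs_pos.1 (by linarith), h3.trans ?_⟩
    rw [div_mul_eq_mul_div, le_div_iff₀ hκ0]
    have h6 := mul_le_mul_of_nonneg_left h5.le hM.le
    linarith
  have hG0 : 0 ≤ G := le_trans (by positivity) hLG
  refine (measure_mono hsub).trans ((measure_union_le _ _).trans ?_)
  rw [ENNReal.ofReal_add (by positivity) (by positivity)]
  refine add_le_add hanti ((measure_union_le _ _).trans ?_)
  rw [ENNReal.ofReal_add (by positivity) (by positivity)]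
  exact add_le_add hE1 hE2

end RatioBound
end NoisyPower

namespace NoisyPower

/-! ### Tails of the workload, of the noise vectors and of the first iterate. -/

section TailEvents

lemma measure_lt_le_of_lintegral_exp_le {Ω : Type*} [MeasurableSpace Ω] {P : Measure Ω}
    {f : Ω → ℝ} (hf : AEMeasurable f P) {E : ℝ} (b : ℝ)
    (hE : ∫⁻ ω, ENNReal.ofReal (Real.exp (f ω)) ∂P ≤ ENNReal.ofReal E) :
    P {ω | b < f ω} ≤ ENNReal.ofReal (E * Real.exp (-b)) := by
  have h1 : {ω | b < f ω} ⊆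
      {ω | ENNReal.ofReal (Real.exp b) ≤ ENNReal.ofReal (Real.exp (f ω))} := fun ω hω =>
    ENNReal.ofReal_le_ofReal (Real.exp_le_exp.2 (le_of_lt hω))
  refine (measure_mono h1).trans ?_
  refine (meas_ge_le_lintegral_div (by fun_prop)
    (ENNReal.ofReal_pos.2 (Real.exp_pos b)).ne' ENNReal.ofReal_ne_top).trans ?_
  rw [Real.exp_neg, ← div_eq_mul_inv, ENNReal.ofReal_div_of_pos (Real.exp_pos b)]
  gcongr

/-- The two terms are dependent, so e^(a+b) ≤ e^(2a) + e^(2b) separates them. The exponent 2 on the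
norm is why √n ≥ 4 is needed. -/
lemma lintegral_exp_excess_le {n : ℕ} {u : Vec n} (hu : ‖u‖ ≤ 1) (hn : 4 ≤ √(n : ℝ)) (K : ℝ) :
    ∫⁻ x, ENNReal.ofReal (Real.exp (‖x‖ - √n + K * |(inner ℝ u x : ℝ)|))
      ∂(stdGaussian (Vec n)) ≤ ENNReal.ofReal (Real.exp 4 + 2 * Real.exp (2 * K ^ 2)) := by
  have hn1 : 1 ≤ n := by
    by_contra h
    rw [show n = 0 by omega] at hn
    norm_num at hn
  have h1 := lintegral_exp_norm_sub_le (n := n) (h := 2) (by norm_num) (by linarith) hn1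
  have h2 := lintegral_exp_abs_inner_le hu (2 * K)
  calc _ ≤ ∫⁻ x, (ENNReal.ofReal (Real.exp (2 * (‖x‖ - √n))) +
        ENNReal.ofReal (Real.exp (2 * K * |(inner ℝ u x : ℝ)|))) ∂(stdGaussian (Vec n)) := by
        refine lintegral_mono fun x => ?_
        rw [← ENNReal.ofReal_add (Real.exp_pos _).le (Real.exp_pos _).le]
        refine ENNReal.ofReal_le_ofReal ?_
        rcases le_total (‖x‖ - √n) (K * |(inner ℝ u x : ℝ)|) with h | h
        · have := Real.exp_le_exp.2 (show ‖x‖ - √n + K * |(inner ℝ u x : ℝ)| ≤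
            2 * K * |(inner ℝ u x : ℝ)| by linarith)
          linarith [Real.exp_pos (2 * (‖x‖ - √n))]
        · have := Real.exp_le_exp.2 (show ‖x‖ - √n + K * |(inner ℝ u x : ℝ)| ≤
            2 * (‖x‖ - √n) by linarith)
          linarith [Real.exp_pos (2 * K * |(inner ℝ u x : ℝ)|)]
    _ ≤ ENNReal.ofReal (Real.exp (2 ^ 2)) + ENNReal.ofReal (2 * Real.exp ((2 * K) ^ 2 / 2)) := by
        rw [lintegral_add_left (by fun_prop)]
        exact add_le_add h1 h2
    _ = _ := by
        rw [← ENNReal.ofReal_add (by positivity) (by positivity)]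
        ring_nf

variable {n : ℕ} {Ω : Type*} [MeasurableSpace Ω] {P : Measure Ω} {g : ℕ → Ω → Vec n}

lemma measurable_lindley {X : Type*} [MeasurableSpace X] (s : ℝ) {ξ : X → ℕ → ℝ} {t : ℕ}
    (hξ : ∀ i < t, Measurable fun a => ξ a i) : Measurable fun a => lindley s (ξ a) t := by
  induction t with
  | zero => exact measurable_const
  | succ t ih =>
    have h1 := ih fun i hi => hξ i (by omega)
    have h2 := hξ t (by omega)
    exact ((h1.add h2).sub_const s).max measurable_const

/-- The workload at time t uses g 1, …, g t only, so the next increment is independent of it and the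
exponential moment factors. -/
lemma GaussianSeq.lintegral_exp_lindley_add (hg : GaussianSeq P g) {f : Vec n → ℝ}
    (hf : Measurable f) {E s : ℝ}
    (hE : ∫⁻ x, ENNReal.ofReal (Real.exp (f x)) ∂(stdGaussian (Vec n)) ≤ ENNReal.ofReal E)
    {t : ℕ} (ht : ∫⁻ ω, ENNReal.ofReal (Real.exp (lindley s (fun i => f (g (i + 1) ω)) t)) ∂P ≤
      ENNReal.ofReal 2) :
    ∫⁻ ω, ENNReal.ofReal (Real.exp (lindley s (fun i => f (g (i + 1) ω)) t + f (g (t + 1) ω))) ∂P ≤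
      ENNReal.ofReal (2 * E) := by
  have hZ : Measurable[sigmaOf g {i | i ≤ t}]
      fun ω => lindley s (fun i => f (g (i + 1) ω)) t := by
    refine @measurable_lindley Ω (sigmaOf g {i | i ≤ t}) s _ t fun i hi => ?_
    exact hf.comp (measurable_sigmaOf g (T := {i | i ≤ t}) (show i + 1 ≤ t by omega))
  have h1 := hg.lintegral_freeze (sigmaOf_succ_notMem t) hZ
    (Φ := fun q => ENNReal.ofReal (Real.exp (q.1 + f q.2))) (by fun_prop)
  rw [h1]
  calc _ = ∫⁻ ω, ENNReal.ofReal (Real.exp (lindley s (fun i => f (g (i + 1) ω)) t)) *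
        ∫⁻ x, ENNReal.ofReal (Real.exp (f x)) ∂(stdGaussian (Vec n)) ∂P := by
        refine lintegral_congr fun ω => ?_
        rw [← lintegral_const_mul _ (by fun_prop)]
        refine lintegral_congr fun x => ?_
        rw [← ENNReal.ofReal_mul (Real.exp_pos _).le, ← Real.exp_add]
    _ ≤ ∫⁻ ω, ENNReal.ofReal (Real.exp (lindley s (fun i => f (g (i + 1) ω)) t)) *
        ENNReal.ofReal E ∂P := lintegral_mono fun ω => by gcongr
    _ = (∫⁻ ω, ENNReal.ofReal (Real.exp (lindley s (fun i => f (g (i + 1) ω)) t)) ∂P) *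
        ENNReal.ofReal E := by
        rw [lintegral_mul_const' _ _ ENNReal.ofReal_ne_top]
    _ ≤ _ := by
        rw [ENNReal.ofReal_mul zero_le_two]
        gcongr

/-- Exponential moments of the workload process. -/
lemma GaussianSeq.lintegral_exp_lindley_le (hg : GaussianSeq P g) {f : Vec n → ℝ}
    (hf : Measurable f) {E s : ℝ} (hE0 : 0 ≤ E)
    (hE : ∫⁻ x, ENNReal.ofReal (Real.exp (f x)) ∂(stdGaussian (Vec n)) ≤ ENNReal.ofReal E)
    (hs : E * Real.exp (-s) ≤ 1 / 2) (t : ℕ) :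
    ∫⁻ ω, ENNReal.ofReal (Real.exp (lindley s (fun i => f (g (i + 1) ω)) t)) ∂P ≤
      ENNReal.ofReal 2 := by
  have := hg.isProbabilityMeasure
  induction t with
  | zero => simp [lindley]
  | succ t ih =>
    have h1 := hg.lintegral_exp_lindley_add hf hE ih
    -- From exp(max(y - s, 0)) ≤ 1 + e^(-s) e^y and E e^(-s) ≤ 1/2, the bound 2 reproduces itself: 1
    -- + e^(-s) · 2E ≤ 2.
    calc _ ≤ ∫⁻ ω, (1 + ENNReal.ofReal (Real.exp (-s)) * ENNReal.ofReal (Real.exp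
          (lindley s (fun i => f (g (i + 1) ω)) t + f (g (t + 1) ω)))) ∂P := by
          refine lintegral_mono fun ω => ?_
          rw [← ENNReal.ofReal_mul (Real.exp_pos _).le, ← Real.exp_add, ← ENNReal.ofReal_one,
            ← ENNReal.ofReal_add zero_le_one (Real.exp_pos _).le]
          refine ENNReal.ofReal_le_ofReal ?_
          set y := lindley s (fun i => f (g (i + 1) ω)) t + f (g (t + 1) ω)
          have h2 : lindley s (fun i => f (g (i + 1) ω)) (t + 1) = max (y - s) 0 := rfl
          rw [h2]
          rcases max_cases (y - s) 0 with h | h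
          · rw [h.1, show -s + y = y - s by ring]; linarith
          · rw [h.1, Real.exp_zero]; linarith [Real.exp_pos (-s + y)]
      _ = 1 + ENNReal.ofReal (Real.exp (-s)) * ∫⁻ ω, ENNReal.ofReal (Real.exp
          (lindley s (fun i => f (g (i + 1) ω)) t + f (g (t + 1) ω))) ∂P := by
          rw [lintegral_add_left measurable_const, lintegral_const, measure_univ, mul_one,
            lintegral_const_mul' _ _ ENNReal.ofReal_ne_top]
      _ ≤ 1 + ENNReal.ofReal (Real.exp (-s)) * ENNReal.ofReal (2 * E) := by gcongr
      _ ≤ _ := by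
          rw [← ENNReal.ofReal_mul (Real.exp_pos _).le, ← ENNReal.ofReal_one,
            ← ENNReal.ofReal_add zero_le_one (mul_nonneg (Real.exp_pos _).le (by positivity))]
          exact ENNReal.ofReal_le_ofReal (by linarith)

lemma GaussianSeq.measure_lindley_lt_le (hg : GaussianSeq P g) {f : Vec n → ℝ}
    (hf : Measurable f) {E s : ℝ} (hE0 : 0 ≤ E)
    (hE : ∫⁻ x, ENNReal.ofReal (Real.exp (f x)) ∂(stdGaussian (Vec n)) ≤ ENNReal.ofReal E)
    (hs : E * Real.exp (-s) ≤ 1 / 2) (t : ℕ) :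
    P {ω | s - 1 < lindley s (fun i => f (g (i + 1) ω)) t + f (g (t + 1) ω)} ≤
      ENNReal.ofReal (2 * E * Real.exp (-(s - 1))) := by
  refine measure_lt_le_of_lintegral_exp_le ?_ (s - 1)
    (hg.lintegral_exp_lindley_add hf hE (hg.lintegral_exp_lindley_le hf hE0 hE hs t))
  have h1 : Measurable fun ω => lindley s (fun i => f (g (i + 1) ω)) t :=
    measurable_lindley s fun i _ => hf.comp (hg.meas (i + 1))
  exact (h1.add (hf.comp (hg.meas (t + 1)))).aemeasurable

lemma GaussianSeq.measure_norm_lt_le (hg : GaussianSeq P g) (hn : 2 ≤ √(n : ℝ)) (i : ℕ) (b : ℝ) :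
    P {ω | √n + b < ‖g i ω‖} ≤ ENNReal.ofReal (3 * Real.exp (-b)) := by
  have hn1 : 1 ≤ n := by
    by_contra h
    rw [show n = 0 by omega] at hn
    norm_num at hn
  have h1 := lintegral_exp_norm_sub_le (n := n) (h := 1) (by norm_num) (by linarith) hn1
  have hgm := hg.meas i
  have h2 := measure_lt_le_of_lintegral_exp_le (P := P) (f := fun ω => 1 * (‖g i ω‖ - √n))
    (by fun_prop) b ((hg.lintegral_comp i (f := fun x => ENNReal.ofReal (Real.exp (1 * (‖x‖ - √n))))
      (by fun_prop)).trans_le h1)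
  refine (measure_mono fun ω hω => ?_).trans (h2.trans (ENNReal.ofReal_le_ofReal ?_))
  · simp only [Set.mem_ofPred_eq] at hω ⊢; linarith
  · gcongr
    norm_num
    linarith [Real.exp_one_lt_d9]

lemma GaussianSeq.measure_inner_lt_le (hg : GaussianSeq P g) {u : Vec n} (hu : ‖u‖ ≤ 1) (i : ℕ)
    (b : ℝ) : P {ω | b < |(inner ℝ u (g i ω) : ℝ)|} ≤ ENNReal.ofReal (6 * Real.exp (-b)) := by
  have h1 := lintegral_exp_abs_inner_le hu 1
  have hgm := hg.meas i
  have h2 := measure_lt_le_of_lintegral_exp_le (P := P) (f := fun ω => 1 * |(inner ℝ u (g i ω) : ℝ)|)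
    (by fun_prop) b ((hg.lintegral_comp i
      (f := fun x => ENNReal.ofReal (Real.exp (1 * |(inner ℝ u x : ℝ)|))) (by fun_prop)).trans_le h1)
  refine (measure_mono fun ω hω => ?_).trans (h2.trans (ENNReal.ofReal_le_ofReal ?_))
  · simp only [Set.mem_ofPred_eq] at hω ⊢; linarith
  · gcongr
    have h3 : Real.exp (1 ^ 2 / 2) ≤ Real.exp 1 := Real.exp_le_exp.2 (by norm_num)
    linarith [Real.exp_one_lt_d9]

/-- All members of the sequence up to `N` are of moderate size with high probability. -/
lemma GaussianSeq.measure_exists_large_le (hg : GaussianSeq P g) {u : Vec n} (hu : ‖u‖ ≤ 1)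
    (hn : 2 ≤ √(n : ℝ)) {N : ℕ} (hN : (N : ℝ) ≤ 2 * n ^ 3) :
    P {ω | ∃ t < N, √n + 5 * Real.log n < ‖g (t + 1) ω‖ ∨
      5 * Real.log n < |(inner ℝ u (g (t + 1) ω) : ℝ)|} ≤ ENNReal.ofReal (18 / n ^ 2) := by
  have hn0 : (0 : ℝ) < n := by
    by_contra h
    rw [Real.sqrt_eq_zero'.2 (not_lt.1 h)] at hn
    norm_num at hn
  -- The factor 5 makes each failure n⁻⁵, which survives a union over at most 2n³ steps.
  have hexp : Real.exp (-(5 * Real.log n)) = 1 / n ^ 5 := by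
    rw [Real.exp_neg, mul_comm, Real.exp_mul, Real.exp_log hn0, one_div]
    norm_cast
  have hsub : {ω | ∃ t < N, √n + 5 * Real.log n < ‖g (t + 1) ω‖ ∨
      5 * Real.log n < |(inner ℝ u (g (t + 1) ω) : ℝ)|} ⊆
      ⋃ t ∈ Finset.range N, ({ω | √n + 5 * Real.log n < ‖g (t + 1) ω‖} ∪
        {ω | 5 * Real.log n < |(inner ℝ u (g (t + 1) ω) : ℝ)|}) := by
    rintro ω ⟨t, ht, h⟩
    simp only [Set.mem_iUnion, Finset.mem_range]
    exact ⟨t, ht, h⟩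
  refine (measure_mono hsub).trans ((measure_biUnion_finset_le _ _).trans ?_)
  calc _ ≤ ∑ t ∈ Finset.range N, ENNReal.ofReal (9 * (1 / n ^ 5)) := by
        refine Finset.sum_le_sum fun t _ => (measure_union_le _ _).trans ?_
        refine (add_le_add (hg.measure_norm_lt_le hn (t + 1) _)
          (hg.measure_inner_lt_le hu (t + 1) _)).trans ?_
        rw [hexp, ← ENNReal.ofReal_add (by positivity) (by positivity)]
        exact ENNReal.ofReal_le_ofReal (le_of_eq (by ring))
    _ = ENNReal.ofReal (N * (9 * (1 / n ^ 5))) := by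
        rw [Finset.sum_const, Finset.card_range, nsmul_eq_mul, ENNReal.ofReal_mul (Nat.cast_nonneg N),
          ENNReal.ofReal_natCast]
    _ ≤ _ := by
        refine ENNReal.ofReal_le_ofReal ?_
        calc _ ≤ (2 * n ^ 3 : ℝ) * (9 * (1 / n ^ 5)) := by gcongr
          _ = _ := by field_simp; ring

/-- If the noise level is large then the second iterate has a large entry. -/
lemma GaussianSeq.measure_supNorm_le (hg : GaussianSeq P g) {S : Vec n →L[ℝ] Vec n}
    (hS : ∀ x, ‖S x‖ ≤ ‖x‖) {τ : ℝ} (hτ : 0 < τ) (hn : 4 ≤ √(n : ℝ)) (hln : 1 ≤ Real.log n)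
    (hτn : 64 < τ ^ 2 * Real.log n) :
    P {ω | τ * supNorm (normalize (S (normalize (g 0 ω)) +
        (τ * (supNorm (normalize (g 0 ω)) + 1 / n)) • g 1 ω)) * √n ≤ 1} ≤
      ENNReal.ofReal (2 * Real.exp (-(n * (Real.exp (-(√(Real.log n) / 2 + 1) ^ 2 / 2) / 3))) +
        6 * Real.exp (-√n)) := by
  -- A level that some entry of a Gaussian vector exceeds with high probability, with τ t > 4 in the
  -- present regime.
  set t := √(Real.log n) / 2 with ht
  set e := Real.exp (-(n * (Real.exp (-(t + 1) ^ 2 / 2) / 3))) with he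
  have ht0 : 0 < t := by
    have : 0 < √(Real.log n) := Real.sqrt_pos.2 (by linarith)
    positivity
  have hτt : 4 < τ * t := by
    have h1 : 8 < τ * √(Real.log n) := by
      refine lt_of_pow_lt_pow_left₀ 2 (by positivity) ?_
      rw [mul_pow, Real.sq_sqrt (by linarith)]
      linarith
    rw [ht]; linarith
  have hg0 := hg.meas 0
  have hg1 := hg.meas 1
  have hsm : Measurable (supNorm : Vec n → ℝ) := continuous_supNorm.measurable
  have hm := measurable_noiseScale (n := n) τ
  have hSm := S.measurable
  have hA : P {ω | supNorm (g 0 ω) < t} ≤ ENNReal.ofReal e := by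
    have h1 := stdGaussian_supNorm_lt_le (0 : Vec n) one_pos ht0.le
    simp only [one_smul, zero_add, one_mul] at h1
    rw [← hg.law 0, Measure.map_apply hg0 (measurableSet_lt hsm measurable_const)] at h1
    exact h1
  have hB : P {ω | supNorm (S (g 0 ω) + noiseScale τ (g 0 ω) • g 1 ω) < noiseScale τ (g 0 ω) * t} ≤
      ENNReal.ofReal e := by
    refine hg.measure_freeze_le (j := 1) (T := {i | i ≤ 0}) (by simp)
      (measurable_sigmaOf g (T := {i | i ≤ 0}) (le_refl 0))
      (S := {q | supNorm (S q.1 + noiseScale τ q.1 • q.2) < noiseScale τ q.1 * t})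
      (measurableSet_lt (hsm.comp (by fun_prop)) (by fun_prop)) fun y => ?_
    by_cases hy : 0 < noiseScale τ y
    · have h1 := stdGaussian_supNorm_lt_le (S y) hy ht0.le
      simp only [Set.mem_ofPred_eq]
      exact h1
    · have h0 : noiseScale τ y = 0 := le_antisymm (not_lt.1 hy) (noiseScale_nonneg hτ.le y)
      have : {x : Vec n | (y, x) ∈ {q : Vec n × Vec n | supNorm (S q.1 + noiseScale τ q.1 • q.2) <
          noiseScale τ q.1 * t}} = ∅ := by
        ext x
        simp only [Set.mem_ofPred_eq, h0, zero_mul, Set.mem_empty_iff_false, iff_false, not_lt]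
        exact supNorm_nonneg _
      rw [this]
      simp
  have hC := fun i => hg.measure_norm_lt_le (by linarith) i √n
  have hsub : {ω | τ * supNorm (normalize (S (normalize (g 0 ω)) +
        (τ * (supNorm (normalize (g 0 ω)) + 1 / n)) • g 1 ω)) * √n ≤ 1} ⊆
      ({ω | supNorm (g 0 ω) < t} ∪
        {ω | supNorm (S (g 0 ω) + noiseScale τ (g 0 ω) • g 1 ω) < noiseScale τ (g 0 ω) * t}) ∪
      ({ω | √n + √n < ‖g 0 ω‖} ∪ {ω | √n + √n < ‖g 1 ω‖}) := by
    intro ω hω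
    by_contra hcon
    simp only [Set.mem_union, Set.mem_ofPred_eq, not_or, not_lt] at hcon
    obtain ⟨⟨h1, h2⟩, h3, h4⟩ := hcon
    refine absurd hω ?_
    rw [Set.mem_ofPred_eq, not_le]
    set x := g 0 ω
    set y := g 1 ω
    have hx : 0 < ‖x‖ := ht0.trans_le (h1.trans (supNorm_le_norm x))
    have hx0 : x ≠ 0 := norm_pos_iff.1 hx
    set h := noiseScale τ x with hh
    have hh4 : 4 < h := by
      refine hτt.trans_le ?_
      rw [hh, noiseScale]
      refine mul_le_mul_of_nonneg_left ?_ hτ.le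
      exact h1.trans (le_add_of_nonneg_right (by positivity))
    set w := S x + h • y with hw
    have hwt : 0 < ‖w‖ := (show 0 < h * t by positivity).trans_le (h2.trans (supNorm_le_norm w))
    have hxn : ‖x‖ • normalize x = x := by
      rw [normalize, smul_smul, mul_inv_cancel₀ hx.ne', one_smul]
    have heq : normalize (S (normalize x) + (τ * (supNorm (normalize x) + 1 / n)) • y) =
        normalize w := by
      rw [← normalize_smul hx (S (normalize x) + _), smul_add, smul_smul, ← noiseScale_eq τ hx0,
        ← map_smul, hxn]
    rw [heq, normalize, supNorm_smul, abs_of_nonneg (by positivity)]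
    -- Since h > 4, the noise dominates w: its largest entry is at least h t, while its norm is at
    -- most 2√n (1 + h) < 4 h √n.
    have h5 : ‖w‖ ≤ (√n + √n) * (1 + h) := by
      refine (norm_add_le _ _).trans ?_
      rw [norm_smul, Real.norm_eq_abs, abs_of_nonneg (by linarith)]
      have := (hS x).trans h3
      have := mul_le_mul_of_nonneg_left h4 (show 0 ≤ h by linarith)
      linarith
    have h6 : τ * (h * t) ≤ τ * supNorm w := mul_le_mul_of_nonneg_left h2 hτ.le
    have h7 : 4 * h < τ * (h * t) := by nlinarith
    have h8 : ‖w‖ < τ * supNorm w * √n := by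
      have h9 : (0 : ℝ) < √n := by linarith
      have h10 : 4 * h * √n < τ * supNorm w * √n :=
        mul_lt_mul_of_pos_right (h7.trans_le h6) h9
      have h11 : 1 * √n ≤ h * √n := by gcongr; linarith
      linarith
    calc (1 : ℝ) < τ * supNorm w * √n / ‖w‖ := (one_lt_div hwt).2 h8
      _ = _ := by field_simp
  refine (measure_mono hsub).trans ((measure_union_le _ _).trans ((add_le_add
    ((measure_union_le _ _).trans (add_le_add hA hB))
    ((measure_union_le _ _).trans (add_le_add (hC 0) (hC 1)))).trans ?_))
  rw [← ENNReal.ofReal_add (Real.exp_pos _).le (Real.exp_pos _).le,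
    ← ENNReal.ofReal_add (by positivity) (by positivity),
    ← ENNReal.ofReal_add (by positivity) (by positivity)]
  exact ENNReal.ofReal_le_ofReal (le_of_eq (by ring))

end TailEvents
end NoisyPower

namespace NoisyPower

/-! ### Choice of constants for the ratio bound, for large n. -/

section Constants

open Filter

lemma eventually_le_log (B : ℝ) : ∀ᶠ n : ℕ in atTop, B ≤ Real.log n :=
  (Real.tendsto_log_atTop.comp tendsto_natCast_atTop_atTop).eventually_ge_atTop B

lemma eventually_log_le_sqrt {c : ℝ} (hc : 0 < c) : ∀ᶠ n : ℕ in atTop, Real.log n ≤ c * √n := by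
  have h1 := (isLittleO_log_rpow_atTop (r := 1 / 2) (by norm_num)).bound hc
  filter_upwards [tendsto_natCast_atTop_atTop.eventually h1] with n hn
  rw [← Real.sqrt_eq_rpow, Real.norm_eq_abs, Real.norm_eq_abs,
    abs_of_nonneg (Real.sqrt_nonneg _)] at hn
  exact (le_abs_self _).trans hn

lemma sqrt_natCast_le {n : ℕ} (hn : 1 ≤ n) : √(n : ℝ) ≤ n := by
  have h1 : (1 : ℝ) ≤ n := by exact_mod_cast hn
  exact Real.sqrt_le_iff.2 ⟨by linarith, by nlinarith⟩

/-- The deviation caused by moving the start along u is proportional to this quantity. It tends to 0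
like 1/√(log n), even for a localized u. -/
lemma noiseBound_le_of_norm_one {n : ℕ} (hn : 1 ≤ n) {u : Vec n} (hu : ‖u‖ = 1) {τ k : ℝ}
    (hτ : 0 ≤ τ) (hln : 1 ≤ Real.log n) (hτn : τ ^ 2 * Real.log n ≤ 64) (hk : k * √n ≤ 1) :
    noiseBound τ k u * √(Real.log n) ≤ 17 := by
  have hn1 : (1 : ℝ) ≤ n := by exact_mod_cast hn
  have h1 : τ * √(Real.log n) ≤ 8 := by
    refine le_of_pow_le_pow_left₀ two_ne_zero (by norm_num) ?_
    rw [mul_pow, Real.sq_sqrt (by linarith)]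
    linarith
  have h2 : √(Real.log n) ≤ √n := Real.sqrt_le_sqrt ((Real.log_le_sub_one_of_pos (by linarith)).trans
    (by linarith))
  have h3 : supNorm u + ‖u‖ / n ≤ 2 := by
    have h4 := supNorm_le_norm u
    have h5 : 1 / (n : ℝ) ≤ 1 := by rw [div_le_one (by linarith)]; exact hn1
    rw [hu] at h4 ⊢
    linarith
  have h0 := Real.sqrt_nonneg (Real.log n)
  have h6 : noiseScale τ u * √(Real.log n) ≤ 16 := by
    rw [noiseScale, mul_right_comm]
    have : 0 ≤ τ * √(Real.log n) := by positivity
    have h7 : 0 ≤ supNorm u + ‖u‖ / n := add_nonneg (supNorm_nonneg _) (by positivity)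
    nlinarith
  have h8 : k * √(Real.log n) ≤ 1 := by
    by_cases hk0 : 0 ≤ k
    · exact (mul_le_mul_of_nonneg_left h2 hk0).trans hk
    · have : k * √(Real.log n) ≤ 0 := mul_nonpos_of_nonpos_of_nonneg (not_le.1 hk0).le h0
      linarith
  rw [noiseBound, hu, mul_one, add_mul]
  linarith

set_option maxHeartbeats 1000000 in
/-- With high probability the orthogonal part is bounded by a constant multiple of the aligned part
after a number of steps of order `log n / p`. -/
theorem eventually_measure_ratio_le {η θ : ℝ} (hη : 0 < η) (hθ : 0 < θ) (hθ1 : θ < 1) (K₀ : ℝ)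
    (hK₀ : 0 ≤ K₀) :
    ∃ K : ℝ, 0 < K ∧ K₀ ≤ K ∧ ∀ᶠ n : ℕ in atTop, ∀ {Ω : Type} [MeasurableSpace Ω]
      {P : Measure Ω} {g : ℕ → Ω → Vec n}, GaussianSeq P g → ∀ {S : Vec n →L[ℝ] Vec n}
      {u : Vec n} {p : ℝ}, IsPowerMap S u p → ∀ {τ : ℝ}, 0 ≤ τ → τ ^ 2 * Real.log n ≤ 64 →
      ∀ L : ℕ, Real.log n / ((1 - θ ^ 2) * p) + 1 ≤ L →
        (L : ℝ) ≤ Real.log n / ((1 - θ ^ 2) * p) + 2 →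
      P {ω | ¬ ((inner ℝ u (noisyProc S τ (θ * p / √n) g L ω) : ℝ) ≠ 0 ∧
        ‖perp u (noisyProc S τ (θ * p / √n) g L ω)‖ ≤
          K * |(inner ℝ u (noisyProc S τ (θ * p / √n) g L ω) : ℝ)|)} ≤ ENNReal.ofReal η := by
  set ϖ := 1 - θ ^ 2 with hϖ
  have hϖ0 : 0 < ϖ := by rw [hϖ]; nlinarith
  have hϖ1 : ϖ ≤ 1 := by rw [hϖ]; nlinarith
  set A : ℝ := 1 + 2000 with hA
  set X := 2 * (A * (1 + 1 / ϖ)) with hX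
  have hX0 : 0 < X := by positivity
  set κ := η / 8 with hκ
  have hκ0 : 0 < κ := by positivity
  -- The time s depends on η and θ only. It is so large that the drift of the aligned part after s
  -- is small compared with κ.
  obtain ⟨s₀, hs₀⟩ := exists_nat_ge (A / (ϖ ^ 2 * (η / 12 * (κ / 2) ^ 2)))
  set s := s₀ + 1 with hs
  have hs1 : A / (ϖ ^ 2 * s) ≤ η / 12 * (κ / 2) ^ 2 := by
    have : A / (ϖ ^ 2 * (η / 12 * (κ / 2) ^ 2)) ≤ s := hs₀.trans (by rw [hs]; push_cast; linarith)
    rw [div_le_iff₀ (by positivity)] at this ⊢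
    linarith
  set R : ℝ := s * s * 2000 + (s + 1) with hR
  -- This K bounds the noise up to time s in the decoupling and is chosen after s. The factor (1 +
  -- K)^s is then a constant that n beats.
  set K := 4 * R / η + 1 with hK
  have hR0 : 0 < R := by positivity
  have hK1 : 1 ≤ K := by rw [hK]; linarith [show 0 < 4 * R / η by positivity]
  -- The summand κ K₀ only serves to make the final ratio 2M/κ at least K₀.
  set M := 4 * (A + X / ϖ) / η + 1 + κ * K₀ with hM
  have hM1 : 1 ≤ M := by
    rw [hM]; linarith [show 0 < 4 * (A + X / ϖ) / η by positivity, show 0 ≤ κ * K₀ by positivity]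
  refine ⟨2 * M / κ, by positivity, ?_, ?_⟩
  · rw [le_div_iff₀ hκ0, hM]
    linarith [show 0 < 4 * (A + X / ϖ) / η by positivity, show 0 ≤ κ * K₀ by positivity]
  have hfrac : ∀ y Y : ℝ, 0 < y → 4 * y / η + 1 ≤ Y → y / Y ^ 2 ≤ η / 4 := by
    intro y Y hy hY
    have h0 : 0 < 4 * y / η := by positivity
    have h1 : 4 * y / η ≤ Y ^ 2 := by nlinarith
    rw [div_le_iff₀ hη] at h1
    rw [div_le_iff₀ (by nlinarith)]
    linarith
  set c₁ := min (ϖ / (4 * (1 / ϖ + 2))) (η / 12 * (κ / 2) ^ 2 * ϖ / (2 * X * (1 / ϖ + 2))) with hc₁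
  have hc₁0 : 0 < c₁ := by positivity
  set c₂ := η / 12 * (κ / 2) ^ 2 * ϖ ^ 2 / X with hc₂
  have hc₂0 : 0 < c₂ := by positivity
  filter_upwards [eventually_ge_atTop 1, eventually_le_log 1, eventually_le_log s,
    eventually_le_log ((17 * K * (1 + K) ^ s / κ) ^ 2), eventually_log_le_sqrt hc₁0,
    eventually_log_le_sqrt hc₂0] with n hn hln hlns hlnK hlc₁ hlc₂
  intro Ω _ P g hg S u p hSp τ hτ hτn L hL1 hL2
  have : NeZero n := ⟨by omega⟩
  have hn1 : (1 : ℝ) ≤ n := by exact_mod_cast hn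
  have hn0 : (0 : ℝ) < n := by linarith
  have hsn := sqrt_natCast_le hn
  have hsq : 0 < √(n : ℝ) := Real.sqrt_pos.2 hn0
  have hp := hSp.pos
  have hp1 := hSp.le_one
  have hln₁ : Real.log n ≤ c₁ * n := hlc₁.trans (by gcongr)
  have hln₂ : Real.log n ≤ c₂ * n := hlc₂.trans (by gcongr)
  have hk1 : θ * p / √n * √n ≤ 1 := by
    rw [div_mul_cancel₀ _ hsq.ne']
    exact mul_le_one₀ hθ1.le hp.le hp1
  have hkn : (θ * p / √n) ^ 2 * n ≤ 1 := by
    rw [← Real.sq_sqrt hn0.le, ← mul_pow, Real.sqrt_sq hsq.le]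
    exact pow_le_one₀ (by positivity) hk1
  have hlp : Real.log n ≤ Real.log n / (ϖ * p) := by
    rw [le_div_iff₀ (by positivity)]
    have h1 : ϖ * p ≤ 1 := mul_le_one₀ hϖ1 hp.le hp1
    exact mul_le_of_le_one_right (by linarith) h1
  have hLs : s ≤ L := by
    have : (s : ℝ) ≤ L := by linarith
    exact_mod_cast this
  have hLpos : 1 ≤ L := by omega
  have hLG : (L : ℝ) * p ≤ (1 / ϖ + 2) * Real.log n := by
    have h1 : (L : ℝ) * p ≤ (Real.log n / (ϖ * p) + 2) * p := by gcongr
    have h2 : (Real.log n / (ϖ * p) + 2) * p = Real.log n / ϖ + 2 * p := by field_simp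
    have h3 : (1 / ϖ + 2) * Real.log n = Real.log n / ϖ + 2 * Real.log n := by ring
    linarith
  have hG : (1 / ϖ + 2) * Real.log n ≤ ϖ * n / 4 := by
    calc _ ≤ (1 / ϖ + 2) * (ϖ / (4 * (1 / ϖ + 2)) * n) := by
          gcongr
          exact hln₁.trans (by gcongr; exact min_le_left _ _)
      _ = _ := by field_simp
  have hLn : (1 - ϖ * p) ^ (L - 1) * n ≤ 1 := by
    have h1 : (1 - ϖ * p) ^ (L - 1) ≤ Real.exp (-(Real.log n)) := by
      have h0 : 0 ≤ 1 - ϖ * p := by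
        have : ϖ * p ≤ 1 := mul_le_one₀ hϖ1 hp.le hp1
        linarith
      calc _ ≤ Real.exp (-(ϖ * p)) ^ (L - 1) := by gcongr; exact Real.one_sub_le_exp_neg _
        _ = Real.exp (((L - 1 : ℕ) : ℝ) * -(ϖ * p)) := (Real.exp_nat_mul _ _).symm
        _ ≤ _ := by
          rw [Real.exp_le_exp, Nat.cast_sub hLpos, Nat.cast_one]
          have h2 : Real.log n / (ϖ * p) ≤ L - 1 := by linarith
          rw [div_le_iff₀ (by positivity)] at h2
          linarith
    rw [Real.exp_neg, Real.exp_log hn0] at h1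
    calc _ ≤ (n : ℝ)⁻¹ * n := by gcongr
      _ = 1 := inv_mul_cancel₀ hn0.ne'
  have hanti : K * noiseBound τ (θ * p / √n) u * (1 + K) ^ s ≤ κ := by
    have h1 := noiseBound_le_of_norm_one hn hSp.norm_fixed hτ hln hτn hk1
    have h2 : 17 * K * (1 + K) ^ s / κ ≤ √(Real.log n) := Real.le_sqrt_of_sq_le hlnK
    rw [div_le_iff₀ hκ0] at h2
    have h3 : 0 < √(Real.log n) := Real.sqrt_pos.2 (by linarith)
    have h4 : K * noiseBound τ (θ * p / √n) u * (1 + K) ^ s * √(Real.log n) ≤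
        κ * √(Real.log n) := by
      have h5 := mul_le_mul_of_nonneg_left h1 (show 0 ≤ K * (1 + K) ^ s by positivity)
      linarith
    exact le_of_mul_le_mul_right h4 h3
  refine (hg.measure_ratio_le hSp (τ := τ) (s := s) (L := L) hτ hθ hθ1 hϖ rfl hA hX (by norm_num)
    (fun j => lintegral_noiseBound_sq_le hSp hτ (by positivity) hln hτn hkn j) (by linarith) hκ0
    (by omega) hLs hanti hLG hG hLn (by linarith)).trans (ENNReal.ofReal_le_ofReal ?_)
  have h1 : (s : ℝ) * s * (2000 / K ^ 2) + (s + 1) * (1 / K ^ 2) ≤ η / 4 := by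
    have := hfrac R K hR0 le_rfl
    rw [hR] at this
    refine le_trans (le_of_eq ?_) this
    ring
  have h2 : (A + X / ϖ) / M ^ 2 ≤ η / 4 := by
    refine hfrac _ _ (by positivity) ?_
    rw [hM]
    linarith [show 0 ≤ κ * K₀ by positivity]
  have h3 : X / (ϖ ^ 2 * n) ≤ η / 12 * (κ / 2) ^ 2 := by
    rw [div_le_iff₀ (by positivity)]
    have h4 : 1 ≤ c₂ * n := hln.trans hln₂
    calc X = X * 1 := (mul_one X).symm
      _ ≤ X * (c₂ * n) := by gcongr
      _ = _ := by rw [hc₂]; field_simp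
  have h4 : 2 * X * ((1 / ϖ + 2) * Real.log n) / (ϖ * n) ≤ η / 12 * (κ / 2) ^ 2 := by
    rw [div_le_iff₀ (by positivity)]
    calc _ ≤ 2 * X * ((1 / ϖ + 2) *
          (η / 12 * (κ / 2) ^ 2 * ϖ / (2 * X * (1 / ϖ + 2)) * n)) := by
          gcongr
          exact hln₁.trans (by gcongr; exact min_le_right _ _)
      _ = _ := by field_simp
  have h5 : (A / (ϖ ^ 2 * s) + X / (ϖ ^ 2 * n) + 2 * X * ((1 / ϖ + 2) * Real.log n) / (ϖ * n)) /
      (κ / 2) ^ 2 ≤ η / 4 := by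
    rw [div_le_iff₀ (by positivity)]
    linarith
  have h6 : 2 * κ = η / 4 := by rw [hκ]; ring
  linarith

end Constants
end NoisyPower

namespace NoisyPower

/-! ### The utility bound for the scaled iteration. -/

section AbstractUtility

open Filter

/-- The normalized iteration `y_{t+1} = x / ‖x‖` with `x = S y_t + τ (‖y_t‖_∞ + 1/n) z_t`. -/
noncomputable def powerSeq {n : ℕ} (S : Vec n →L[ℝ] Vec n) (τ : ℝ) (x : Vec n) (z : ℕ → Vec n) :
    ℕ → Vec n
  | 0 => normalize x
  | t + 1 => normalize (S (powerSeq S τ x z t) +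
      (τ * (supNorm (powerSeq S τ x z t) + 1 / n)) • z t)

/-- The event that the error bound is below the threshold `θ` and is violated. -/
def failureEvent {n : ℕ} {Ω : Type*} (S : Vec n →L[ℝ] Vec n) (u : Vec n) (p τ θ b : ℝ) (N : ℕ)
    (g : ℕ → Ω → Vec n) : Set Ω :=
  {ω | ∃ c : ℝ, (∀ t, 1 ≤ t → t ≤ N →
      τ * (supNorm (powerSeq S τ (g 0 ω) (fun i => g (i + 1) ω) t) + 1 / n) ≤ c) ∧
    c * b ≤ p * θ ∧
    c * b < p * ‖perp u (powerSeq S τ (g 0 ω) (fun i => g (i + 1) ω) N)‖}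

/-- If the noise is large compared to the dimension then the error bound is not small. -/
lemma eventually_measure_failure_le_of_large {η : ℝ} (hη : 0 < η) :
    ∀ᶠ n : ℕ in atTop, ∀ {Ω : Type} [MeasurableSpace Ω] {P : Measure Ω} {g : ℕ → Ω → Vec n},
      GaussianSeq P g → ∀ {S : Vec n →L[ℝ] Vec n} {u : Vec n} {p : ℝ}, IsPowerMap S u p →
      ∀ {τ θ s : ℝ}, 0 < τ → θ < 1 → 0 ≤ s → 64 < τ ^ 2 * Real.log n → ∀ N : ℕ, 1 ≤ N →
      P (failureEvent S u p τ θ (√n + s) N g) ≤ ENNReal.ofReal η := by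
  filter_upwards [eventually_ge_atTop 1, eventually_le_log 4, eventually_le_log (24 / η),
    eventually_log_le_sqrt one_pos] with n hn hln hlη hls
  intro Ω _ P g hg S u p hS τ θ s hτ hθ1 hs hτn N hN
  have hn0 : (0 : ℝ) < n := by exact_mod_cast hn
  have hsq : 0 < √(n : ℝ) := Real.sqrt_pos.2 hn0
  have h1 := hg.measure_supNorm_le hS.norm_apply_le hτ (by linarith) (by linarith) hτn
  refine (measure_mono ?_).trans (h1.trans (ENNReal.ofReal_le_ofReal ?_))
  · rintro ω ⟨c, hc, hcb, -⟩
    -- Only the first iterate is used: c√n ≤ c b ≤ pθ < 1 contradicts a large entry of y_1.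
    have h2 := hc 1 le_rfl hN
    simp only [Set.mem_ofPred_eq]
    set y := powerSeq S τ (g 0 ω) (fun i => g (i + 1) ω) 1 with hy
    have h3 : τ * supNorm y ≤ c := by
      refine le_trans ?_ h2
      gcongr
      exact le_add_of_nonneg_right (by positivity)
    have hc0 : 0 ≤ c := le_trans (mul_nonneg hτ.le (supNorm_nonneg _)) h3
    calc τ * supNorm y * √n ≤ c * √n := by gcongr
      _ ≤ c * (√n + s) := by gcongr; linarith
      _ ≤ p * θ := hcb
      _ ≤ 1 := by
        have := hS.pos
        have := hS.le_one
        nlinarith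
  · have h2 : 2 ≤ √(Real.log n) := Real.le_sqrt_of_sq_le (by linarith)
    have h3 : (√(Real.log n) / 2 + 1) ^ 2 ≤ Real.log n := by
      rw [← Real.sq_sqrt (show 0 ≤ Real.log n by linarith)]
      rw [Real.sqrt_sq (Real.sqrt_nonneg _)]
      gcongr
      linarith
    have h4 : 1 / √n ≤ Real.exp (-(√(Real.log n) / 2 + 1) ^ 2 / 2) := by
      have h5 : 1 / √n = Real.exp (-(Real.log n / 2)) := by
        rw [Real.exp_neg, ← Real.log_sqrt hn0.le, Real.exp_log hsq, one_div]
      rw [h5, Real.exp_le_exp]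
      linarith
    have h6 : √n / 3 ≤ n * (Real.exp (-(√(Real.log n) / 2 + 1) ^ 2 / 2) / 3) := by
      calc √n / 3 = n * (1 / √n / 3) := by
            field_simp
            exact Real.sq_sqrt hn0.le
        _ ≤ _ := by gcongr
    have h7 : Real.exp (-(√n / 3)) ≤ η / 8 := by
      have h8 : 24 / η ≤ √n := by linarith
      rw [div_le_iff₀ hη] at h8
      have h9 := Real.add_one_le_exp (√(n : ℝ) / 3)
      rw [Real.exp_neg, inv_le_comm₀ (Real.exp_pos _) (by positivity)]
      refine le_trans ?_ h9
      rw [inv_div, div_le_iff₀ hη]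
      linarith
    have h8 : Real.exp (-(n * (Real.exp (-(√(Real.log n) / 2 + 1) ^ 2 / 2) / 3))) ≤
        Real.exp (-(√n / 3)) := Real.exp_le_exp.2 (by linarith)
    have h9 : Real.exp (-√n) ≤ Real.exp (-(√n / 3)) := Real.exp_le_exp.2 (by linarith)
    linarith

set_option maxHeartbeats 1000000 in
/-- The utility guarantee for the normalized iteration driven by Gaussian vectors. -/
theorem eventually_measure_failure_le {η θ : ℝ} (hη : 0 < η) (hη1 : η < 1) (hθ : 0 < θ)
    (hθ1 : θ < 1) :
    ∃ C : ℝ, 1 ≤ C ∧ ∀ᶠ n : ℕ in atTop, ∀ {Ω : Type} [MeasurableSpace Ω] {P : Measure Ω}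
      {g : ℕ → Ω → Vec n}, GaussianSeq P g → ∀ {S : Vec n →L[ℝ] Vec n} {u : Vec n} {p : ℝ},
      IsPowerMap S u p → ∀ {τ : ℝ}, 1 / (2 * n) ≤ τ → ∀ N : ℕ, (N : ℝ) ≤ 2 * n ^ 3 →
      C * (Real.log n / p) ≤ N →
      P (failureEvent S u p τ θ (√n + √(2 * Real.log (2 * N / η))) N g) ≤ ENNReal.ofReal η := by
  set ϖ := 1 - θ ^ 2 with hϖ
  have hϖ0 : 0 < ϖ := by rw [hϖ]; nlinarith
  -- θ' leaves room between θ and 1 for the fluctuation of ‖z_t‖ around √n, so that a contraction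
  -- rate 1 - (1 - θ') p survives the noise.
  set θ' := (1 + θ) / 2 with hθ'
  have hθ'1 : 0 < 1 - θ' := by rw [hθ']; linarith
  have hθ'0 : 0 < θ' := by rw [hθ']; linarith
  have hθθ' : θ * (1 + (1 - θ) / 2) ≤ θ' := by rw [hθ']; nlinarith
  obtain ⟨K, hK, hKθ, hratio⟩ := eventually_measure_ratio_le (η := η / 4) (by positivity) hθ hθ1
    (1 / (1 - θ')) (by positivity)
  -- This is the condition for the ratio K to be preserved. It holds because K ≥ 1/(1 - θ').
  have hKs : θ' * √(1 + K ^ 2) ≤ K := by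
    rw [div_le_iff₀ hθ'1] at hKθ
    refine le_of_pow_le_pow_left₀ two_ne_zero hK.le ?_
    rw [mul_pow, Real.sq_sqrt (by positivity)]
    have h1 : θ' ^ 2 ≤ 1 := by nlinarith
    have h2 : 1 ≤ K ^ 2 * (1 - θ') := by nlinarith
    nlinarith
  set K' := K * √(1 + K ^ 2) with hK'
  set E := Real.exp 4 + 2 * Real.exp (2 * K' ^ 2) with hE
  have hE0 : 0 < E := by positivity
  set m := min (1 / (2 * E)) (η / (8 * E * Real.exp 1)) with hm
  have hm0 : 0 < m := by positivity
  -- In units of log n / p, the summand 1/ϖ covers the phase up to L, the 3 covers roundings, and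
  -- the last summand makes the initial excess decay by n⁻³.
  set C := 1 / ϖ + 3 + 3 / (1 - θ') with hC
  have hC1 : 1 ≤ C := by rw [hC]; linarith [show 0 < 1 / ϖ by positivity, show 0 < 3 / (1 - θ') by positivity]
  set c := (1 - θ) / (10 * (1 + K)) with hc
  have hc0 : 0 < c := by rw [hc]; exact div_pos (by linarith) (by positivity)
  refine ⟨C, hC1, ?_⟩
  filter_upwards [eventually_measure_failure_le_of_large hη, hratio, eventually_ge_atTop 1,
    eventually_le_log 4, eventually_le_log (72 / η), eventually_le_log (Real.log (2 * K)),
    eventually_le_log (Real.exp (Real.log m ^ 2 / 2)), eventually_log_le_sqrt one_pos,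
    eventually_log_le_sqrt hc0] with n hlarge hratio hn hln hlη hlK hls hl1 hlc
  intro Ω _ P g hg S u p hS τ hτ N hN hNC
  have hn1 : (1 : ℝ) ≤ n := by exact_mod_cast hn
  have hn0 : (0 : ℝ) < n := by linarith
  have hsq : 0 < √(n : ℝ) := Real.sqrt_pos.2 hn0
  have hsn := sqrt_natCast_le hn
  have hp := hS.pos
  have hp1 := hS.le_one
  have hτ0 : 0 < τ := lt_of_lt_of_le (by positivity) hτ
  have hlp : Real.log n ≤ Real.log n / p := by
    rw [le_div_iff₀ hp]
    exact mul_le_of_le_one_right (by linarith) hp1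
  have hNl : Real.log n ≤ N := by
    refine le_trans ?_ hNC
    have : 0 ≤ Real.log n / p := by linarith
    nlinarith
  have hN1 : 1 ≤ N := by
    have : (1 : ℝ) ≤ N := by linarith
    exact_mod_cast this
  set s := √(2 * Real.log (2 * N / η)) with hs
  have hs0 : 0 ≤ s := Real.sqrt_nonneg _
  by_cases hτn : τ ^ 2 * Real.log n ≤ 64
  swap
  · exact hlarge hg hS hτ0 hθ1 hs0 (not_le.1 hτn) N hN1
  -- N ≥ log n tends to infinity, hence so does s. This is all that the workload bound needs from
  -- the logarithmic term in R.
  have hsm : Real.exp (-s) ≤ m := by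
    have h1 : Real.exp (Real.log m ^ 2 / 2) ≤ 2 * N / η := by
      rw [le_div_iff₀ hη]
      have : (0 : ℝ) ≤ N := by positivity
      nlinarith
    have h2 : Real.log m ^ 2 / 2 ≤ Real.log (2 * N / η) := by
      rw [Real.le_log_iff_exp_le (lt_of_lt_of_le (Real.exp_pos _) h1)]; exact h1
    have h3 : -Real.log m ≤ s := Real.le_sqrt_of_sq_le (by rw [neg_sq]; linarith)
    calc _ ≤ Real.exp (Real.log m) := Real.exp_le_exp.2 (by linarith)
      _ = m := Real.exp_log hm0
  set L := ⌈Real.log n / (ϖ * p)⌉₊ + 1 with hL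
  have hL1 : Real.log n / (ϖ * p) + 1 ≤ L := by
    rw [hL]; push_cast; linarith [Nat.le_ceil (Real.log n / (ϖ * p))]
  have hL2 : (L : ℝ) ≤ Real.log n / (ϖ * p) + 2 := by
    have := (Nat.ceil_lt_add_one (show 0 ≤ Real.log n / (ϖ * p) from
      div_nonneg (by linarith) (by positivity))).le
    rw [hL]; push_cast; linarith
  have hNL : 3 / (1 - θ') * (Real.log n / p) ≤ N - (L + 1) := by
    have h1 : Real.log n / (ϖ * p) = 1 / ϖ * (Real.log n / p) := by field_simp
    rw [hC] at hNC
    linarith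
  have hNLpos : 0 < 3 / (1 - θ') * (Real.log n / p) := by
    have : 0 < Real.log n / p := by linarith
    positivity
  have hLN : L + 1 ≤ N := by
    have : ((L + 1 : ℕ) : ℝ) ≤ N := by push_cast; linarith
    exact_mod_cast this
  have hχp : 0 ≤ (1 - θ') * p := by positivity
  have hχ0 : 0 ≤ 1 - (1 - θ') * p := by
    have : (1 - θ') * p ≤ 1 := mul_le_one₀ (by linarith) hp.le hp1
    linarith
  have hχ1 : 1 - (1 - θ') * p ≤ 1 := by linarith
  -- The initial excess is 2 K n² because τ may be as small as 1/(2n), and K ≤ (τ/n) E is required.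
  have hdecay : (1 - (1 - θ') * p) ^ (N - 1 - L) * (2 * K * n ^ 2) ≤ 1 := by
    have h5 : (1 - (1 - θ') * p) ^ (N - 1 - L) ≤ Real.exp (-(3 * Real.log n)) := by
      calc _ ≤ Real.exp (-((1 - θ') * p)) ^ (N - 1 - L) := by
            gcongr
            exact Real.one_sub_le_exp_neg _
        _ = Real.exp (((N - 1 - L : ℕ) : ℝ) * -((1 - θ') * p)) := (Real.exp_nat_mul _ _).symm
        _ ≤ _ := by
          rw [Real.exp_le_exp, show N - 1 - L = N - (L + 1) by omega, Nat.cast_sub hLN]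
          push_cast
          have h6 := mul_le_mul_of_nonneg_right hNL
            (show 0 ≤ (1 - θ') * p by positivity)
          have h7 : 3 / (1 - θ') * (Real.log n / p) * ((1 - θ') * p) = 3 * Real.log n := by
            field_simp
          linarith
    have h8 : Real.exp (-(3 * Real.log n)) * (n : ℝ) ^ 3 = 1 := by
      rw [Real.exp_neg, mul_comm 3, Real.exp_mul, Real.exp_log hn0]
      norm_cast
      field_simp
    have h9 : 2 * K ≤ (n : ℝ) := by
      have := Real.exp_le_exp.2 hlK
      rwa [Real.exp_log (by positivity), Real.exp_log hn0] at this
    calc _ ≤ Real.exp (-(3 * Real.log n)) * (n * n ^ 2) := by gcongr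
      _ = 1 := by rw [← h8]; ring
  set k := θ * p / √n with hk
  have hk0 : 0 ≤ k := by positivity
  set f : Vec n → ℝ := fun x => ‖x‖ - √n + K' * |(inner ℝ u x : ℝ)| with hf
  have hfm : Measurable f := by fun_prop
  have hfE : ∫⁻ x, ENNReal.ofReal (Real.exp (f x)) ∂(stdGaussian (Vec n)) ≤ ENNReal.ofReal E :=
    lintegral_exp_excess_le hS.norm_fixed.le (by linarith) K'
  have hEm : E * Real.exp (-s) ≤ 1 / 2 := by
    calc _ ≤ E * (1 / (2 * E)) := by gcongr; exact hsm.trans (min_le_left _ _)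
      _ = _ := by field_simp
  have hB2 := hg.measure_lindley_lt_le hfm hE0.le hfE hEm (N - 1)
  have hB1 := hg.measure_exists_large_le hS.norm_fixed.le (by linarith) hN
  have hB3 := hratio hg hS hτ0.le hτn L hL1 hL2
  have hsub : failureEvent S u p τ θ (√n + s) N g ⊆
      {ω | ∃ t < N, √n + 5 * Real.log n < ‖g (t + 1) ω‖ ∨
        5 * Real.log n < |(inner ℝ u (g (t + 1) ω) : ℝ)|} ∪
      ({ω | s - 1 < lindley s (fun i => f (g (i + 1) ω)) (N - 1) + f (g (N - 1 + 1) ω)} ∪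
        {ω | ¬ ((inner ℝ u (noisyProc S τ k g L ω) : ℝ) ≠ 0 ∧
          ‖perp u (noisyProc S τ k g L ω)‖ ≤
            K * |(inner ℝ u (noisyProc S τ k g L ω) : ℝ)|)}) := by
    rintro ω ⟨d, hd, hdb, hfail⟩
    by_contra hcon
    simp only [Set.mem_union, not_or] at hcon
    obtain ⟨hcon1, hcon2, hcon3⟩ := hcon
    have h1 : ∀ t < N, ‖g (t + 1) ω‖ ≤ √n + 5 * Real.log n ∧
        |(inner ℝ u (g (t + 1) ω) : ℝ)| ≤ 5 * Real.log n := fun t ht =>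
      ⟨not_lt.1 fun h => hcon1 ⟨t, ht, Or.inl h⟩, not_lt.1 fun h => hcon1 ⟨t, ht, Or.inr h⟩⟩
    have h2 : lindley s (fun i => f (g (i + 1) ω)) (N - 1) + f (g (N - 1 + 1) ω) ≤ s - 1 :=
      not_lt.1 hcon2
    obtain ⟨h3, h4⟩ := not_not.1 hcon3
    have hd0 : 0 ≤ d := le_trans (mul_nonneg hτ0.le (add_nonneg (supNorm_nonneg _)
      (by positivity))) (hd 1 le_rfl hN1)
    have hkz : ∀ t < N, k * (‖g (t + 1) ω‖ + K * |(inner ℝ u (g (t + 1) ω) : ℝ)|) ≤ θ' * p := by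
      intro t ht
      obtain ⟨h5, h6⟩ := h1 t ht
      have h7 : ‖g (t + 1) ω‖ + K * |(inner ℝ u (g (t + 1) ω) : ℝ)| ≤
          √n * (1 + (1 - θ) / 2) := by
        have h8 : K * |(inner ℝ u (g (t + 1) ω) : ℝ)| ≤ K * (5 * Real.log n) := by gcongr
        have h9 : 5 * (1 + K) * Real.log n ≤ 5 * (1 + K) * (c * √n) := by gcongr
        have h10 : 5 * (1 + K) * (c * √n) = (1 - θ) / 2 * √n := by rw [hc]; field_simp; ring
        linarith
      calc _ ≤ k * (√n * (1 + (1 - θ) / 2)) := by gcongr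
        _ = p * (θ * (1 + (1 - θ) / 2)) := by rw [hk]; field_simp
        _ ≤ p * θ' := by
          gcongr
        _ = _ := mul_comm _ _
    refine absurd hfail (not_lt.2 ?_)
    have hb0 : 0 ≤ √(n : ℝ) + s := by positivity
    have hpath := norm_perp_le_of_path hS (τ := τ) (k := k) (K := K) (c := d) (b := √n + s) (s := s)
      (χ := 1 - (1 - θ') * p) (E := 2 * K * n ^ 2) (R := d * (√n + s) / p) hτ0.le hk0 hK
      (x := g 0 ω) (z := fun i => g (i + 1) ω)
      (Y := powerSeq S τ (g 0 ω) (fun i => g (i + 1) ω)) (L := L) (N := N) (by omega) (by omega)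
      (fun t ht => by
        calc _ ≤ θ' * p * √(1 + K ^ 2) :=
                mul_le_mul_of_nonneg_right (hkz t ht) (Real.sqrt_nonneg _)
          _ = p * (θ' * √(1 + K ^ 2)) := by ring
          _ ≤ _ := by gcongr)
      (fun t ht => by
        have h5 : k * ‖g (t + 1) ω‖ ≤
            k * (‖g (t + 1) ω‖ + K * |(inner ℝ u (g (t + 1) ω) : ℝ)|) := by
          gcongr
          exact le_add_of_nonneg_right (by positivity)
        have := hkz t ht
        show 1 - p + k * ‖g (t + 1) ω‖ ≤ _
        linarith)
      hχ0 hχ1 h3 h4 rfl (fun t _ => rfl) hd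
      (by
        rw [hk, le_div_iff₀ hsq]
        have : d * √n ≤ d * (√n + s) := by gcongr; linarith
        linarith)
      rfl (by field_simp)
      (by
        rw [div_lt_one hp]
        exact hdb.trans_lt (mul_lt_of_lt_one_right hp hθ1))
      hb0
      (by
        have h5 : 1 ≤ 2 * n * τ := by
          rw [div_le_iff₀ (by positivity)] at hτ
          linarith
        calc K = K * 1 := (mul_one K).symm
          _ ≤ K * (2 * n * τ) := by gcongr
          _ = _ := by field_simp)
      (by positivity)
      hdecay
      (by
        have h5 : lindley s (fun i => f (g (i + 1) ω)) (N - 1) + f (g (N - 1 + 1) ω) + 1 ≤ s := by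
          linarith
        exact h5)
    rw [le_div_iff₀ hp] at hpath
    linarith
  refine (measure_mono hsub).trans ((measure_union_le _ _).trans ((add_le_add hB1
    ((measure_union_le _ _).trans (add_le_add hB2 hB3))).trans ?_))
  rw [← ENNReal.ofReal_add (by positivity) (by positivity),
    ← ENNReal.ofReal_add (by positivity) (by positivity)]
  refine ENNReal.ofReal_le_ofReal ?_
  have h1 : 18 / (n : ℝ) ^ 2 ≤ η / 4 := by
    rw [div_le_iff₀ (by positivity)]
    rw [div_le_iff₀ hη] at hlη
    have h2 : Real.log n ≤ n := by linarith
    have h3 : 72 ≤ n * η := hlη.trans (by gcongr)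
    have h4 : n * η ≤ (n : ℝ) ^ 2 * η := by gcongr; exact le_self_pow₀ hn1 two_ne_zero
    linarith
  have h2 : 2 * E * Real.exp (-(s - 1)) ≤ η / 4 := by
    have h3 : Real.exp (-(s - 1)) = Real.exp (-s) * Real.exp 1 := by
      rw [← Real.exp_add]; ring_nf
    rw [h3]
    calc _ ≤ 2 * E * (η / (8 * E * Real.exp 1) * Real.exp 1) := by
          gcongr
          exact hsm.trans (min_le_right _ _)
      _ = _ := by field_simp; norm_num
  linarith

end AbstractUtility
end NoisyPower

namespace NoisyPower

/-! ### From the graph and its seed to the scaled operator and a Gaussian sequence. -/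

section Transfer

lemma stdGaussian_map_smul {n : ℕ} {a : ℝ} (ha : a = 1 ∨ a = -1) :
    (stdGaussian (Vec n)).map (fun x => a • x) = stdGaussian (Vec n) := by
  rcases ha with rfl | rfl
  · simp
  · have := stdGaussian_map (LinearIsometryEquiv.neg ℝ (E := Vec n))
    refine Eq.trans ?_ this
    congr 1
    funext x
    simp

/-- The signs are allowed because a negative leading eigenvalue makes the aligned part alternate,
which the symmetry of the Gaussian law absorbs. -/
lemma gaussianSeq_infinitePi {n : ℕ} {a : ℕ → ℝ} (ha : ∀ t, a t = 1 ∨ a t = -1) :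
    GaussianSeq (Measure.infinitePi fun _ : ℕ => stdGaussian (Vec n))
      (fun t ω => a t • ω t) where
  meas t := by fun_prop
  indep := iIndepFun_infinitePi (X := fun t x => a t • x) (by fun_prop)
  law t := by
    have h1 := Measure.infinitePi_map_eval (fun _ : ℕ => stdGaussian (Vec n)) t
    rw [show (fun ω : ℕ → Vec n => a t • ω t) = (fun x => a t • x) ∘ fun ω => ω t from rfl,
      ← Measure.map_map (by fun_prop) (by fun_prop), h1, stdGaussian_map_smul (ha t)]

/-- The seed obtained from a sequence of vectors. -/
noncomputable def seedOf {n : ℕ} (N : ℕ) (e : Metric.sphere (0 : Vec n) 1) (ω : ℕ → Vec n) :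
    Seed n N :=
  (direction e (ω 0), fun i => ω (i + 1))

lemma measurable_seedOf {n : ℕ} (N : ℕ) (e : Metric.sphere (0 : Vec n) 1) :
    Measurable (seedOf N e) :=
  ((measurable_direction e).comp (measurable_pi_apply 0)).prodMk
    (measurable_pi_lambda _ fun _ => measurable_pi_apply _)

lemma map_seedOf {n : ℕ} (N : ℕ) (e : Metric.sphere (0 : Vec n) 1) :
    (Measure.infinitePi fun _ : ℕ => stdGaussian (Vec n)).map (seedOf N e) = seedLaw n N := by
  have h1 : (Measure.infinitePi fun _ : ℕ => stdGaussian (Vec n)).map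
      (fun ω (i : Fin (N + 1)) => ω i) = Measure.pi fun _ => stdGaussian (Vec n) := by
    rw [Measure.map_infinitePi_infinitePi_of_inj Fin.val_injective, Measure.infinitePi_eq_pi]
  have h2 := (measurePreserving_piFinSuccAbove (fun _ : Fin (N + 1) => stdGaussian (Vec n)) 0).map_eq
  have h3 := Measure.map_prod_map (stdGaussian (Vec n))
    (Measure.pi fun _ : Fin N => stdGaussian (Vec n)) (measurable_direction e) measurable_id
  rw [Measure.map_id, map_direction_stdGaussian] at h3
  rw [seedLaw, h3, ← h2, ← h1, Measure.map_map (MeasurableEquiv.measurable _) (by fun_prop),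
    Measure.map_map ((measurable_direction e).prodMap measurable_id) (by
      exact (MeasurableEquiv.measurable _).comp (by fun_prop))]
  rfl

/-- From log(1/δ) ≥ 1 - δ ≥ 1/5. The growth of σ with N is what bounds N in terms of n. -/
lemma noiseLevel_sq_ge (N : ℕ) {ε δ : ℝ} (hε : 0 < ε) (hε1 : ε ≤ 1) (hδ : 0 < δ)
    (hδ1 : δ ≤ 4 / 5) : 4 / 5 * (N : ℝ) ≤ noiseLevel N ε δ ^ 2 := by
  have hl : 1 / 5 ≤ Real.log (1 / δ) := by
    have h1 := Real.one_sub_inv_le_log_of_pos (show 0 < 1 / δ by positivity)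
    rw [inv_div, div_one] at h1
    linarith
  have h2 : 1 ≤ ε⁻¹ ^ 2 := one_le_pow₀ ((one_le_inv₀ hε).2 hε1)
  have h3 : 4 / 5 * (N : ℝ) ≤ 4 * N * Real.log (1 / δ) := by
    have := mul_le_mul_of_nonneg_left hl (show (0 : ℝ) ≤ 4 * N by positivity)
    linarith
  rw [noiseLevel, mul_pow, Real.sq_sqrt (by positivity)]
  calc _ ≤ 4 * N * Real.log (1 / δ) := h3
    _ ≤ _ := le_mul_of_one_le_left (by positivity) h2

lemma density_nonneg {n : ℕ} (G : SimpleGraph (Fin n)) : 0 ≤ density G := by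
  refine div_nonneg (Finset.sum_nonneg fun i _ => Finset.sum_nonneg fun j _ => ?_) (by positivity)
  unfold adj
  rw [SimpleGraph.adjMatrix_apply]
  split_ifs <;> norm_num

lemma density_le_one {n : ℕ} (G : SimpleGraph (Fin n)) : density G ≤ 1 := by
  refine div_le_one_of_le₀ ?_ (by positivity)
  calc _ ≤ ∑ _i : Fin n, ∑ _j : Fin n, (1 : ℝ) := by
        refine Finset.sum_le_sum fun i _ => Finset.sum_le_sum fun j _ => ?_
        unfold adj
        rw [SimpleGraph.adjMatrix_apply]
        split_ifs <;> norm_num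
    _ = _ := by simp [sq]

lemma abs_centered_le_one {n : ℕ} (G : SimpleGraph (Fin n)) (i j : Fin n) :
    |centered G i j| ≤ 1 := by
  have h1 := density_nonneg G
  have h2 := density_le_one G
  simp only [centered, Matrix.sub_apply, Matrix.smul_apply, Matrix.of_apply, smul_eq_mul, mul_one]
  unfold adj
  rw [SimpleGraph.adjMatrix_apply, abs_le]
  split_ifs <;> constructor <;> linarith

lemma supNorm_applyB_le {n : ℕ} (G : SimpleGraph (Fin n)) (y : Vec n) :
    supNorm (applyB G y) ≤ n * supNorm y := by
  refine (pi_norm_le_iff_of_nonneg (mul_nonneg (by positivity) (supNorm_nonneg y))).2 fun a => ?_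
  have h1 : applyB G y a = ∑ b, centered G a b * y b := by
    simp [applyB, Matrix.toLpLin_apply, Matrix.mulVec, dotProduct]
  change |applyB G y a| ≤ _
  rw [h1]
  calc _ ≤ ∑ b, |centered G a b * y b| := Finset.abs_sum_le_sum_abs _ _
    _ ≤ ∑ _b : Fin n, supNorm y := by
        refine Finset.sum_le_sum fun b _ => ?_
        rw [abs_mul]
        calc _ ≤ 1 * supNorm y := by
              gcongr
              · exact abs_centered_le_one G a b
              · exact abs_apply_le_supNorm y b
          _ = _ := one_mul _
    _ = _ := by simp

/-- The entries of B are at most 1 in absolute value, so B expands the sup norm by at most n. -/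
lemma abs_eigenvalue_le {n : ℕ} {G : SimpleGraph (Fin n)} {l : ℝ} {u : Vec n} (hu : u ≠ 0)
    (h : applyB G u = l • u) : |l| ≤ n := by
  have h1 := supNorm_applyB_le G u
  rw [h, supNorm_smul] at h1
  have h2 : 0 < supNorm u := by
    refine norm_pos_iff.2 fun h0 => hu ?_
    ext i
    exact congrFun h0 i
  exact le_of_mul_le_mul_right h1 h2

/-- The operator `B / l`. -/
noncomputable def scaledB {n : ℕ} (G : SimpleGraph (Fin n)) (l : ℝ) : Vec n →L[ℝ] Vec n :=
  l⁻¹ • LinearMap.toContinuousLinearMap (Matrix.toEuclideanLin (centered G))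

lemma scaledB_apply {n : ℕ} (G : SimpleGraph (Fin n)) (l : ℝ) (x : Vec n) :
    scaledB G l x = l⁻¹ • applyB G x := rfl

/-- Dividing by the signed eigenvalue makes the top vector a fixed point. In the eigenbasis every
other coordinate is multiplied by at most λ₂/λ₁ = 1 - p in absolute value. -/
lemma IsSpectralDecomposition.isPowerMap {n : ℕ} (hn0 : 0 < n) (hn1 : 1 < n) {G : SimpleGraph (Fin n)}
    {lam : Fin n → ℝ} {v : OrthonormalBasis (Fin n) ℝ (Vec n)}
    (h : IsSpectralDecomposition G lam v) {lam1 lam2 : ℝ} (h1 : lam1 = |lam ⟨0, hn0⟩|)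
    (h2 : lam2 = |lam ⟨1, hn1⟩|) (hlt : lam2 < lam1) :
    IsPowerMap (scaledB G (lam ⟨0, hn0⟩)) (v ⟨0, hn0⟩) ((lam1 - lam2) / lam1) := by
  set z : Fin n := ⟨0, hn0⟩ with hz
  have hlam2 : 0 ≤ lam2 := by rw [h2]; exact abs_nonneg _
  have hlam1 : 0 < lam1 := by linarith
  have hl0 : lam z ≠ 0 := by rw [h1] at hlam1; exact abs_pos.1 hlam1
  have hcoord : ∀ i x, (inner ℝ (v i) (scaledB G (lam z) x) : ℝ) =
      lam i / lam z * inner ℝ (v i) x := by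
    intro i x
    conv_lhs => rw [← v.sum_repr' x]
    rw [map_sum, inner_sum, Finset.sum_eq_single i]
    · rw [map_smul, scaledB_apply, h.1, real_inner_smul_right, real_inner_smul_right,
        real_inner_smul_right, real_inner_self_eq_norm_sq, v.norm_eq_one]
      ring
    · intro j _ hj
      rw [map_smul, scaledB_apply, h.1, real_inner_smul_right, real_inner_smul_right,
        real_inner_smul_right, v.inner_eq_zero (Ne.symm hj)]
      simp
    · intro hi; exact absurd (Finset.mem_univ i) hi
  refine ⟨v.norm_eq_one z, div_pos (by linarith) hlam1, ?_, ?_, ?_, ?_⟩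
  · rw [div_le_one hlam1]; linarith
  · rw [scaledB_apply, h.1, smul_smul, inv_mul_cancel₀ hl0, one_smul]
  · intro x; rw [hcoord, div_self hl0, one_mul]
  · intro x hx
    have hq : 1 - (lam1 - lam2) / lam1 = lam2 / lam1 := by field_simp; ring
    rw [hq]
    refine le_of_pow_le_pow_left₀ two_ne_zero (by positivity) ?_
    rw [mul_pow, ← v.sum_sq_norm_inner_right, ← v.sum_sq_norm_inner_right x, Finset.mul_sum]
    refine Finset.sum_le_sum fun i _ => ?_
    rw [hcoord, norm_mul, mul_pow]
    by_cases hi : i = z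
    · rw [hi, hx]; simp
    · gcongr
      rw [norm_div, Real.norm_eq_abs, Real.norm_eq_abs, ← h1, h2]
      have hi0 : i.val ≠ 0 := fun h0 => hi (Fin.ext h0)
      have hi1 : (⟨1, hn1⟩ : Fin n) ≤ i := by
        rw [Fin.le_def]
        exact Nat.one_le_iff_ne_zero.2 hi0
      exact div_le_div_of_nonneg_right (h.2 hi1) hlam1.le

lemma normalize_smul_of_sq {n : ℕ} {a : ℝ} (ha : a = 1 ∨ a = -1) (x : Vec n) :
    normalize (a • x) = a • normalize x := by
  rcases ha with rfl | rfl
  · simp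
  · simp [normalize, norm_neg]

lemma supNorm_smul_of_sq {n : ℕ} {a : ℝ} (ha : a = 1 ∨ a = -1) (x : Vec n) :
    supNorm (a • x) = supNorm x := by
  rw [supNorm_smul]
  rcases ha with rfl | rfl <;> simp

/-- The iterates agree, up to signs, with the normalized iteration of the scaled operator. -/
lemma iterate_seedOf {n N : ℕ} (G : SimpleGraph (Fin n)) {σ l c : ℝ} (hl : 0 < l)
    (hc : c = 1 ∨ c = -1) {e : Metric.sphere (0 : Vec n) 1} {ω : ℕ → Vec n} (hω : ω 0 ≠ 0)
    (t : Fin (N + 1)) :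
    iterate G σ (seedOf N e ω) t = c ^ (t : ℕ) •
      powerSeq (scaledB G (c * l)) (σ / l) (c ^ 0 • ω 0) (fun i => c ^ (i + 1) • ω (i + 1)) t := by
  have hc2 : c * c = 1 := by rcases hc with rfl | rfl <;> norm_num
  have hpow : ∀ k : ℕ, c ^ k = 1 ∨ c ^ k = -1 := by
    intro k
    rcases hc with rfl | rfl
    · exact Or.inl (one_pow k)
    · exact neg_one_pow_eq_or ℝ k
  have hsq : ∀ k : ℕ, c ^ k * c ^ k = 1 := fun k => by rw [← mul_pow, hc2, one_pow]
  rw [iterate_eq_iterateFrom]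
  induction t using Fin.induction with
  | zero =>
    rw [iterateFrom_zero]
    simp only [Fin.val_zero, pow_zero, one_smul, powerSeq]
    exact direction_coe e hω
  | succ t ih =>
    rw [iterateFrom_succ, ih]
    simp only [Fin.val_castSucc, Fin.val_succ]
    rw [powerSeq, ← normalize_smul_of_sq (hpow _)]
    set y := powerSeq (scaledB G (c * l)) (σ / l) (c ^ 0 • ω 0)
      (fun i => c ^ (i + 1) • ω (i + 1)) t
    have h1 : (seedOf N e ω).2 t = ω (t + 1) := rfl
    -- Each step contributes one sign c from the eigenvalue c l. Pulling c^(t+1) out of the step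
    -- puts the same sign on the noise vector.
    have h2 : applyB G (c ^ (t : ℕ) • y) = (c * l) • scaledB G (c * l) (c ^ (t : ℕ) • y) := by
      rw [scaledB_apply, smul_smul, mul_inv_cancel₀, one_smul]
      exact mul_ne_zero (by rcases hc with rfl | rfl <;> norm_num) hl.ne'
    rw [step, h1, h2, supNorm_smul_of_sq (hpow _), map_smul]
    conv_rhs => rw [← normalize_smul hl]
    refine congrArg normalize ?_
    simp only [smul_add, smul_smul]
    congr 2
    · rw [pow_succ]; ring
    · have h3 := hsq (t + 1)
      field_simp
      linear_combination (-(supNorm y + 1 / (n : ℝ)) * σ) * h3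

end Transfer
end NoisyPower

namespace NoisyPower

/-! ### The utility guarantee for graphs. -/

section Utility

open Filter

lemma maxSup_nonneg {n N : ℕ} (G : SimpleGraph (Fin n)) (σ : ℝ) (ω : Seed n N) :
    0 ≤ maxSup G σ ω :=
  Real.iSup_nonneg fun _ => supNorm_nonneg _

lemma supNorm_iterate_le_maxSup {n N : ℕ} (G : SimpleGraph (Fin n)) (σ : ℝ) (ω : Seed n N)
    (t : Fin N) : supNorm (iterate G σ ω t.succ) ≤ maxSup G σ ω :=
  le_ciSup (f := fun t : Fin N => supNorm (iterate G σ ω t.succ)) (Set.finite_range _).bddAbove t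

/-- If the error bound is at most `1`, then the number of iterations is at most `2 n³`. -/
lemma le_of_errorBound_le_one {n N : ℕ} (hn : 1 ≤ n) {G : SimpleGraph (Fin n)} {ε δ η gap : ℝ}
    (hε : 0 < ε) (hε1 : ε ≤ 1) (hδ : 0 < δ) (hδ1 : δ ≤ 4 / 5) (hgap : 0 < gap) (hgapn : gap ≤ n)
    {ω : Seed n N} (h : errorBound G (noiseLevel N ε δ) η gap ω ≤ 1) :
    (N : ℝ) ≤ 2 * (n : ℝ) ^ 3 := by
  have hσ := noiseLevel_sq_ge N hε hε1 hδ hδ1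
  have hσ0 : 0 ≤ noiseLevel N ε δ := by rw [noiseLevel]; positivity
  set σ := noiseLevel N ε δ
  have hn0 : (0 : ℝ) < n := by exact_mod_cast hn
  rw [errorBound, div_le_one hgap] at h
  have h1 : σ * (0 + 1 / (n : ℝ)) * (√n + 0) ≤
      σ * (maxSup G σ ω + 1 / (n : ℝ)) * (√n + √(2 * Real.log (2 * N / η))) := by
    have := maxSup_nonneg G σ ω
    gcongr
    positivity
  -- Only the summands 1/n and √n of the bound are kept. With σ² ≥ 4N/5 this already gives N ≤ (5/4)
  -- n³.
  have h2 : σ * √n ≤ (n : ℝ) ^ 2 := by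
    have h3 := h1.trans (h.trans hgapn)
    rw [zero_add, add_zero, mul_one_div, div_mul_eq_mul_div, div_le_iff₀ hn0] at h3
    linarith
  have h4 : σ ^ 2 * n ≤ (n : ℝ) ^ 3 * n := by
    have := pow_le_pow_left₀ (by positivity) h2 2
    rw [mul_pow, Real.sq_sqrt hn0.le] at this
    linarith
  have := le_of_mul_le_mul_right h4 hn0
  have : 0 ≤ (n : ℝ) ^ 3 := by positivity
  linarith

/-- A violation of the error bound below the threshold is a failure of the scaled iteration. -/
lemma mem_failureEvent_seedOf {n N : ℕ} {G : SimpleGraph (Fin n)} {σ l c gap θ η : ℝ} {u : Vec n}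
    (hσ : 0 ≤ σ) (hl : 0 < l) (hgap : 0 < gap) (hc : c = 1 ∨ c = -1)
    {e : Metric.sphere (0 : Vec n) 1} {ω : ℕ → Vec n} (hω : ω 0 ≠ 0)
    (h1 : errorBound G σ η gap (seedOf N e ω) ≤ θ)
    (h2 : errorBound G σ η gap (seedOf N e ω) < projError u (lastIterate G σ (seedOf N e ω))) :
    ω ∈ failureEvent (scaledB G (c * l)) u (gap / l) (σ / l) θ
      (√n + √(2 * Real.log (2 * N / η))) N (fun t (ω : ℕ → Vec n) => c ^ t • ω t) := by
  have hpow : ∀ k : ℕ, c ^ k = 1 ∨ c ^ k = -1 := by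
    intro k
    rcases hc with rfl | rfl
    · exact Or.inl (one_pow k)
    · exact neg_one_pow_eq_or ℝ k
  have hit := iterate_seedOf (N := N) G (σ := σ) hl hc (e := e) hω
  set M := maxSup G σ (seedOf N e ω) with hM
  have heq : σ / l * (M + 1 / n) * (√n + √(2 * Real.log (2 * N / η))) =
      gap / l * errorBound G σ η gap (seedOf N e ω) := by
    rw [errorBound, ← hM]
    field_simp
  refine ⟨σ / l * (M + 1 / n), ?_, ?_, ?_⟩
  · intro t ht htN
    obtain ⟨k, rfl⟩ : ∃ k, t = k + 1 := ⟨t - 1, by omega⟩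
    have h3 := supNorm_iterate_le_maxSup G σ (seedOf N e ω) ⟨k, by omega⟩
    rw [hit, supNorm_smul_of_sq (hpow _)] at h3
    gcongr
    exact h3
  · rw [heq]
    gcongr
  · rw [heq]
    have h3 : projError u (lastIterate G σ (seedOf N e ω)) = ‖perp u
        (powerSeq (scaledB G (c * l)) (σ / l) (c ^ 0 • ω 0) (fun i => c ^ (i + 1) • ω (i + 1)) N)‖ := by
      change ‖perp u (iterate G σ (seedOf N e ω) (Fin.last N))‖ = _
      rw [hit, perp_smul, norm_smul]
      rcases hpow (Fin.last N : Fin (N + 1)) with h | h <;> rw [h] <;> simp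
    rw [← h3]
    gcongr

/-- The utility of the noisy power iteration. -/
theorem exists_utility_const {η θ : ℝ} (hη : 0 < η) (hη1 : η < 1) (hθ : 0 < θ) (hθ1 : θ < 1) :
    ∃ C : ℝ, 0 < C ∧
      ∀ (n : ℕ) (h0 : 0 < n) (hn : 1 < n) (G : SimpleGraph (Fin n)) (lam : Fin n → ℝ)
        (v : OrthonormalBasis (Fin n) ℝ (Vec n)) (lam1 lam2 : ℝ),
        IsSpectralDecomposition G lam v →
        lam1 = |lam ⟨0, h0⟩| → lam2 = |lam ⟨1, hn⟩| → lam2 < lam1 →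
        ∀ (N : ℕ) (ε δ : ℝ), C * (lam1 / (lam1 - lam2) * Real.log n) ≤ N →
          0 < ε → ε ≤ 1 → 0 < δ → δ ≤ 4 / 5 →
          ENNReal.ofReal (1 - η) ≤
            seedLaw n N {ω |
              errorBound G (noiseLevel N ε δ) η (lam1 - lam2) ω ≤ θ →
              projError (v ⟨0, h0⟩) (lastIterate G (noiseLevel N ε δ) ω) ≤
                errorBound G (noiseLevel N ε δ) η (lam1 - lam2) ω} := by
  obtain ⟨C, hC, hev⟩ := eventually_measure_failure_le hη hη1 hθ hθ1
  obtain ⟨n₀, hn₀⟩ := eventually_atTop.1 hev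
  -- Since λ₁/(λ₁ - λ₂) · log n > 1/2, the summand 4 n₀³ forces N > 2 n³ whenever n < n₀, where the
  -- error bound exceeds θ for every seed.
  refine ⟨C + 4 * (n₀ : ℝ) ^ 3 + 1, by positivity, ?_⟩
  intro n h0 hn G lam v lam1 lam2 hsd h1 h2 hlt N ε δ hN hε hε1 hδ hδ1
  have hn0 : (0 : ℝ) < n := by positivity
  have hlam2 : 0 ≤ lam2 := h2 ▸ abs_nonneg _
  have hlam1 : 0 < lam1 := hlam2.trans_lt hlt
  have hgap : 0 < lam1 - lam2 := sub_pos.2 hlt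
  have hv0 : ‖v ⟨0, h0⟩‖ = 1 := v.orthonormal.1 _
  have hlam1n : lam1 ≤ n := h1 ▸ abs_eigenvalue_le (norm_ne_zero_iff.1 (by rw [hv0]; simp)) (hsd.1 _)
  have hlog : 1 / 2 < Real.log n := by
    have h3 : Real.log 2 ≤ Real.log n := Real.log_le_log two_pos (by exact_mod_cast hn)
    linarith [Real.log_two_gt_d9]
  have hratio : 1 ≤ lam1 / (lam1 - lam2) := by rw [one_le_div hgap]; linarith
  have hX : 1 / 2 < lam1 / (lam1 - lam2) * Real.log n := by nlinarith
  have hσ := noiseLevel_sq_ge N hε hε1 hδ hδ1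
  have hσ0 : 0 ≤ noiseLevel N ε δ := by rw [noiseLevel]; positivity
  have : NeZero n := ⟨by omega⟩
  set e : Metric.sphere (0 : Vec n) 1 := ⟨v ⟨0, h0⟩, by simp⟩ with he
  set P := Measure.infinitePi fun _ : ℕ => stdGaussian (Vec n) with hP
  have hmap : P.map (seedOf N e) = seedLaw n N := map_seedOf N e
  have hle : ENNReal.ofReal (1 - η) ≤ 1 := by
    rw [← ENNReal.ofReal_one]
    exact ENNReal.ofReal_le_ofReal (by linarith)
  set good := {ω : Seed n N | errorBound G (noiseLevel N ε δ) η (lam1 - lam2) ω ≤ θ →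
    projError (v ⟨0, h0⟩) (lastIterate G (noiseLevel N ε δ) ω) ≤
      errorBound G (noiseLevel N ε δ) η (lam1 - lam2) ω} with hgood
  rw [← hmap]
  -- This inequality holds for arbitrary sets, so the good event need not be shown measurable.
  refine le_trans ?_ (Measure.le_map_apply (measurable_seedOf N e).aemeasurable _)
  by_cases hcase : n₀ ≤ n ∧ (N : ℝ) ≤ 2 * (n : ℝ) ^ 3
  · obtain ⟨c, hc, hcl⟩ : ∃ c : ℝ, (c = 1 ∨ c = -1) ∧ lam ⟨0, h0⟩ = c * lam1 := by
      rcases abs_choice (lam ⟨0, h0⟩) with h | h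
      · exact ⟨1, Or.inl rfl, by rw [h1, h, one_mul]⟩
      · exact ⟨-1, Or.inr rfl, by rw [h1, h]; ring⟩
    have hpm := hsd.isPowerMap h0 hn h1 h2 hlt
    rw [hcl] at hpm
    have hNpos : (1 : ℝ) ≤ N := by
      have h3 : (0 : ℝ) < N := lt_of_lt_of_le (by positivity) hN
      exact_mod_cast h3
    have hτ : 1 / (2 * (n : ℝ)) ≤ noiseLevel N ε δ / lam1 := by
      have h3 : 1 / 2 ≤ noiseLevel N ε δ := by
        have h4 : (1 : ℝ) / 2 ≤ |noiseLevel N ε δ| := by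
          rw [← abs_of_pos (show (0 : ℝ) < 1 / 2 by norm_num)]
          exact sq_le_sq.1 (by linarith)
        rwa [abs_of_nonneg hσ0] at h4
      calc 1 / (2 * (n : ℝ)) = 1 / 2 / n := by rw [div_div]
        _ ≤ noiseLevel N ε δ / lam1 := by gcongr
    have hg : GaussianSeq P (fun t (ω : ℕ → Vec n) => c ^ t • ω t) :=
      gaussianSeq_infinitePi fun t => by
        rcases hc with rfl | rfl
        · exact Or.inl (one_pow t)
        · exact neg_one_pow_eq_or ℝ t
    have hNC : C * (Real.log n / ((lam1 - lam2) / lam1)) ≤ N := by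
      have h3 : C * (Real.log n / ((lam1 - lam2) / lam1)) =
          C * (lam1 / (lam1 - lam2) * Real.log n) := by field_simp
      have h4 : (0 : ℝ) ≤ (n₀ : ℝ) ^ 3 := by positivity
      rw [h3]
      refine le_trans ?_ hN
      gcongr
      linarith
    have hfail := hn₀ n hcase.1 hg hpm hτ N hcase.2 hNC
    -- Anti-concentration at level 0. Off this null set the arbitrary default direction `e` plays no
    -- role.
    have hzero : P {ω : ℕ → Vec n | ω 0 = 0} = 0 := by
      have h3 := stdGaussian_abs_inner_add_le hv0 (m := fun _ => 0) measurable_const 0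
      rw [ENNReal.ofReal_zero, nonpos_iff_eq_zero, ← hg.law 0] at h3
      have h4 := le_antisymm (h3 ▸ Measure.le_map_apply (hg.meas 0).aemeasurable _) zero_le
      refine measure_mono_null (fun ω hω => ?_) h4
      have : ω 0 = 0 := hω
      simp [this]
    have hcompl : P ((seedOf N e ⁻¹' good)ᶜ) ≤ ENNReal.ofReal η := by
      refine le_trans (measure_mono ?_) ((measure_union_le _ _).trans
        ((add_le_add hfail hzero.le).trans (add_zero _).le))
      intro ω hω
      by_cases hω0 : ω 0 = 0
      · exact Or.inr hω0
      · have h3 : ¬ (errorBound G (noiseLevel N ε δ) η (lam1 - lam2) (seedOf N e ω) ≤ θ →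
            projError (v ⟨0, h0⟩) (lastIterate G (noiseLevel N ε δ) (seedOf N e ω)) ≤
              errorBound G (noiseLevel N ε δ) η (lam1 - lam2) (seedOf N e ω)) := hω
        push Not at h3
        exact Or.inl (mem_failureEvent_seedOf hσ0 hlam1 hgap hc hω0 h3.1 h3.2)
    have h5 : (1 : ENNReal) ≤ P (seedOf N e ⁻¹' good) + ENNReal.ofReal η := by
      rw [← measure_univ (μ := P), ← Set.union_compl_self (seedOf N e ⁻¹' good)]
      exact (measure_union_le _ _).trans (add_le_add le_rfl hcompl)
    rw [ENNReal.ofReal_sub _ hη.le, ENNReal.ofReal_one]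
    exact tsub_le_iff_right.2 h5
  · have huniv : seedOf N e ⁻¹' good = Set.univ := by
      refine Set.eq_univ_of_forall fun ω hR => absurd ?_ hcase
      have h3 : (N : ℝ) ≤ 2 * (n : ℝ) ^ 3 := le_of_errorBound_le_one (by omega) hε hε1 hδ hδ1 hgap
        (by linarith) (hR.trans hθ1.le)
      refine ⟨?_, h3⟩
      by_contra hlt'
      have h4 : (n : ℝ) ^ 3 ≤ (n₀ : ℝ) ^ 3 := by
        gcongr
        omega
      have h5 : (C + 4 * (n₀ : ℝ) ^ 3 + 1) * (1 / 2) ≤ N :=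
        le_trans (by gcongr) hN
      linarith
    rw [huniv, measure_univ]
    exact hle

end Utility
end NoisyPower

/-! ### Assembly of both parts. -/

open NoisyPower in
theorem mainTheorem8 :
    (∀ (n N : ℕ) (ε δ : ℝ), 2 ≤ n → 1 ≤ N → 0 < ε → ε ≤ 1 → 0 < δ → δ ≤ 4 / 5 →
      EdgeDP (seedLaw n N)
        (fun (G : SimpleGraph (Fin n)) ω => transcript G (noiseLevel N ε δ) ω) ε δ ∧
      EdgeDP (seedLaw n N)
        (fun (G : SimpleGraph (Fin n)) ω => labels G (noiseLevel N ε δ) ω) ε δ) ∧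
    (∀ η θ : ℝ, 0 < η → η < 1 → 0 < θ → θ < 1 →
      ∃ C : ℝ, 0 < C ∧
        ∀ (n : ℕ) (hn : 2 ≤ n) (G : SimpleGraph (Fin n)) (lam : Fin n → ℝ)
          (v : OrthonormalBasis (Fin n) ℝ (Vec n)) (lam1 lam2 : ℝ),
          IsSpectralDecomposition G lam v →
          lam1 = |lam ⟨0, by omega⟩| → lam2 = |lam ⟨1, by omega⟩| → lam2 < lam1 →
          ∀ (N : ℕ) (ε δ : ℝ), C * (lam1 / (lam1 - lam2) * Real.log n) ≤ N →
            0 < ε → ε ≤ 1 → 0 < δ → δ ≤ 4 / 5 →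
            ENNReal.ofReal (1 - η) ≤
              seedLaw n N {ω |
                errorBound G (noiseLevel N ε δ) η (lam1 - lam2) ω ≤ θ →
                projError (v ⟨0, by omega⟩) (lastIterate G (noiseLevel N ε δ) ω) ≤
                  errorBound G (noiseLevel N ε δ) η (lam1 - lam2) ω}) := by
  refine ⟨fun n N ε δ hn hN hε hε1 hδ hδ1 => ?_, fun η θ hη hη1 hθ hθ1 => ?_⟩
  rotate_left
  · obtain ⟨C, hC, h⟩ := exists_utility_const hη hη1 hθ hθ1
    exact ⟨C, hC, fun n hn => h n (by omega) hn⟩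
  have : NeZero n := ⟨by omega⟩
  exact ⟨edgeDP_transcript hN hε hε1 hδ hδ1, edgeDP_labels hN hε hε1 hδ hδ1⟩
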